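/- Notation. Let $M\ge 0$, let $d_1,\dots,d_M\ge 1$ be mutually distinct integers, $\mathcal D=\{d_1,\dots,d_M\}$ (in this order), and $n\in\mathbb Z_{\ge0}$. Write $\mathrm W_{\rm C}[f_1,\dots,f_m](x)=\det\bigl(f_k(x+j-1)\bigr)_{1\le j,k\le m}$ for the Casoratian and $\mathrm W[f_1,\dots,f_m](\eta)=\det\bigl(f_k^{(j-1)}(\eta)\bigr)_{1\le j,k\le m}$ for the Wronskian. We consider three systems ($0<c<1$, $0<q<1$): * Meixner (M): $\boldsymbol\lambda=(\beta,c)$, $\eta(x)=x$, $\check P_n(x;\boldsymbol\lambda)={}_2F_1(-n,-x;\beta\mid 1-c^{-1})$, $B(x;\boldsymbol\lambda)=c(x+\beta)$, $\mathcal E_n(\boldsymbol\lambda)=(1-c)n$, $\mathfrak t(\boldsymbol\lambda)=(\beta,c^{-1})$, $\boldsymbol\lambda+M\tilde{\boldsymbol\delta}=(\beta+M,c)$, $\alpha(\boldsymbol\lambda)=c$, $\alpha'(\boldsymbol\lambda)=-(1-c)\beta$, $\nu(x;\boldsymbol\lambda)=c^x$. * little $q$-Jacobi (l$q$J): $\boldsymbol\lambda=(\alpha,\beta)$,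 $a=q^\alpha$, $b=q^\beta$, $\eta(x)=1-q^x$, $\check P_n(x;\boldsymbol\lambda)={}_3\phi_1(q^{-n},abq^{n+1},q^{-x};bq\mid q;q^x/a)$, $B(x;\boldsymbol\lambda)=a(q^{-x}-bq)$, $\mathcal E_n(\boldsymbol\lambda)=(q^{-n}-1)(1-abq^{n+1})$, $\mathfrak t(\boldsymbol\lambda)=(-\alpha,\beta)$, $\boldsymbol\lambda+M\tilde{\boldsymbol\delta}=(\alpha-M,\beta+M)$, $\alpha(\boldsymbol\lambda)=a$, $\alpha'(\boldsymbol\lambda)=-(1-a)(1-bq)$, $\nu(x;\boldsymbol\lambda)=a^x$. * little $q$-Laguerre (l$q$L): $\boldsymbol\lambda=\alpha$, $a=q^\alpha$, $\eta(x)=1-q^x$, $\check P_n(x;\boldsymbol\lambda)={}_2\phi_0(q^{-n},q^{-x};-\mid q;q^x/a)$, $B(x;\boldsymbol\lambda)=aq^{-x}$, $\mathcal E_n=q^{-n}-1$, $\mathfrak t(\boldsymbol\lambda)=-\alpha$, $\boldsymbol\lambda+M\tilde{\boldsymbol\delta}=\alpha-M$, $\alpha(\boldsymbol\lambda)=a$,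 $\alpha'(\boldsymbol\lambda)=-(1-a)$, $\nu(x;\boldsymbol\lambda)=a^x$. In each case put $\check\xi_v(x;\boldsymbol\lambda)=\check P_v(x;\mathfrak t(\boldsymbol\lambda))$, $B'(x;\boldsymbol\lambda)=B(x;\mathfrak t(\boldsymbol\lambda))$, $\tilde{\mathcal E}_v(\boldsymbol\lambda)=\alpha(\boldsymbol\lambda)\mathcal E_v(\mathfrak t(\boldsymbol\lambda))+\alpha'(\boldsymbol\lambda)$, $\varphi_M(x)=\prod_{1\le j<k\le M}\frac{\eta(x+k-1)-\eta(x+j-1)}{\eta(k-j)}$, $$\mathcal C_{\mathcal D}=\frac1{\varphi_M(0)}\prod_{1\le j<k\le M}\frac{\tilde{\mathcal E}_{d_j}-\tilde{\mathcal E}_{d_k}}{\alpha B'(j-1)},\qquad \mathcal C_{\mathcal D,n}=(-1)^M\mathcal C_{\mathcal D}\,\frac{\varphi_M(0)}{\varphi_{M+1}(0)}\prod_{j=1}^M\frac{\mathcal E_n-\tilde{\mathcal E}_{d_j}}{\alpha B'(j-1)} .$$ The multi-indexed polynomial $P_{\mathcal D,n}(\eta;\boldsymbol\lambda)$ is the polynomial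 in $\eta$ such that for all real $x$ $$\mathrm W_{\rm C}[\check\xi_{d_1},\dots,\check\xi_{d_M},\nu\check P_n](x;\boldsymbol\lambda)=\mathcal C_{\mathcal D,n}(\boldsymbol\lambda)\,\varphi_{M+1}(x)\,P_{\mathcal D,n}(\eta(x);\boldsymbol\lambda)\,\nu(x;\boldsymbol\lambda+M\tilde{\boldsymbol\delta}).$$ With the classical Laguerre and Jacobi polynomials $L^{(\alpha)}_n$, $P^{(\alpha,\beta)}_n$, the multi-indexed Laguerre and Jacobi polynomials of Odake–Sasaki with index set $\mathcal D$ are the polynomials given by * type I Laguerre: $P^{\rm L,I}_{\mathcal D,n}(\eta;g)=e^{-M\eta}\,\mathrm W[\mu_1,\dots,\mu_M,L^{(g-1/2)}_n](\eta)$, $\mu_j(\eta)=e^{\eta}L^{(g-1/2)}_{d_j}(-\eta)$; * type II Laguerre: $P^{\rm L,II}_{\mathcal D,n}(\eta;g)=\eta^{(g+\frac12)M}\,\mathrm W[\nu_1,\dots,\nu_M,L^{(g-1/2)}_n](\eta)$ for $\eta>0$, $\nu_j(\eta)=\eta^{\frac12-g}L^{(1/2-g)}_{d_j}(\eta)$;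 * type II Jacobi: $P^{\rm J,II}_{\mathcal D,n}(\eta;(g,h))=\bigl(\tfrac{1-\eta}2\bigr)^{(g+\frac12)M}\,\mathrm W[\nu_1,\dots,\nu_M,P^{(g-1/2,h-1/2)}_n](\eta)$ for $-1<\eta<1$, $\nu_j(\eta)=\bigl(\tfrac{1-\eta}2\bigr)^{\frac12-g}P^{(1/2-g,h-1/2)}_{d_j}(\eta)$. Theorem. In each of the following cases the polynomials $P_{\mathcal D,n}$ (for every $c\in(0,1)$, resp. $q\in(0,1)$) and the polynomial on the right-hand side exist and are uniquely determined by the above relations, the denominator on the right-hand side is non-zero, and the limit holds for every real $\eta$. 1. (M → L, type I) If $\alpha>-1$, then with $g=\alpha+\frac12$ $$\lim_{c\to1^-}P_{\mathcal D,n}\Bigl(\frac{\eta}{1-c};(\alpha+1,c)\Bigr)=\frac{P^{\rm L,I}_{\mathcal D,n}(\eta;g)}{P^{\rm L,I}_{\mathcal D,n}(0;g)} .$$ 2. (l$q$J → J, type II) If $\alpha>-1$, $\beta>-1$, $d_j<\alpha$ for all $j$, and $\alpha-\beta\ne d_j+d_k+1$ for all $j\ne k$, then with $g=\alpha+\frac12$,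 $h=\beta+\frac12$ $$\lim_{q\to1^-}P_{\mathcal D,n}\bigl(1-\eta;(\alpha,\beta)\bigr)=\frac{P^{\rm J,II}_{\mathcal D,n}(1-2\eta;(g,h))}{P^{\rm J,II}_{\mathcal D,n}(-1;(g,h))} .$$ 3. (l$q$L → L, type II) If $\alpha>-1$ and $d_j<\alpha$ for all $j$, then with $g=\alpha+\frac12$ $$\lim_{q\to1^-}\frac{P_{\mathcal D,n}\bigl(1-(1-q)\eta;\alpha\bigr)}{P_{\mathcal D,n}(1;\alpha)}=\frac{P^{\rm L,II}_{\mathcal D,n}(\eta;g)}{P^{\rm L,II}_{\mathcal D,n}(0;g)} .$$ -/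

import Mathlib

open Polynomial Filter Topology

noncomputable section

/-! ### Discrete quantum mechanics with real shifts: data of a solvable system -/

/-- The explicit data of an exactly solvable system of discrete quantum mechanics with real shifts,
as functions of the parameters `p : Λ` and of the (real) coordinate `x`. It is only used through the
three concrete instances `meixnerSystem`, `littleQJacobiSystem` and `littleQLaguerreSystem`. -/
structure ShiftSystem (Λ : Type) where
  /-- the sinusoidal coordinate `η(x)` -/
  eta : ℝ → ℝ
  /-- the potential function `B(x; p)` -/
  B : Λ → ℝ → ℝ
  /-- the energy eigenvalue `ℰ_n(p)` -/
  energy : Λ → ℕ → ℝ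
  /-- the eigenpolynomial `P̌_n(x; p) = P_n(η(x); p)`, normalised by `P̌_n(0; p) = 1` -/
  P : Λ → ℕ → ℝ → ℝ
  /-- the twist `𝔱(p)` of the parameters -/
  twist : Λ → Λ
  /-- the shifted parameters `p + M δ̃` -/
  shift : Λ → ℕ → Λ
  /-- the constant `α(p)` in `ℋ(p) = α(p) ℋ(𝔱(p)) + α'(p)` -/
  alpha : Λ → ℝ
  /-- the constant `α'(p)` in `ℋ(p) = α(p) ℋ(𝔱(p)) + α'(p)` -/
  alpha' : Λ → ℝ
  /-- the ratio `ν(x; p) = φ₀(x; p) / φ₀(x; 𝔱(p))` of the ground states -/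
  nu : Λ → ℝ → ℝ

/-- The `q`-shifted factorial `(a; q)_k = ∏_{i<k} (1 - a q^i)`. -/
def qPoch (a q : ℝ) (k : ℕ) : ℝ := ∏ i ∈ Finset.range k, (1 - a * q ^ i)

/-- The Meixner polynomial `M_n(x; β, c) = ₂F₁(-n, -x; β | 1 - c⁻¹)`. -/
def meixner (β c : ℝ) (n : ℕ) (x : ℝ) : ℝ :=
  ∑ k ∈ Finset.range (n + 1),
    (ascPochhammer ℝ k).eval (-(n : ℝ)) * (ascPochhammer ℝ k).eval (-x) /
      (ascPochhammer ℝ k).eval β * ((1 - c⁻¹) ^ k / k.factorial)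

/-- The little `q`-Jacobi polynomial, with `P̌_n(0) = 1`:
`P̌_n(x) = ₃φ₁(q⁻ⁿ, a b qⁿ⁺¹, q⁻ˣ; b q | q; qˣ / a)`. -/
def littleQJacobi (q a b : ℝ) (n : ℕ) (x : ℝ) : ℝ :=
  ∑ k ∈ Finset.range (n + 1),
    qPoch ((q ^ n)⁻¹) q k * qPoch (a * b * q ^ (n + 1)) q k * qPoch (q ^ (-x)) q k /
      (qPoch (b * q) q k * qPoch q q k) *
      ((-1) ^ k * q ^ (k.choose 2))⁻¹ * (q ^ x / a) ^ k

/-- The little `q`-Laguerre polynomial, with `P̌_n(0) = 1`: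
`P̌_n(x) = ₂φ₀(q⁻ⁿ, q⁻ˣ; - | q; qˣ / a)`. -/
def littleQLaguerre (q a : ℝ) (n : ℕ) (x : ℝ) : ℝ :=
  ∑ k ∈ Finset.range (n + 1),
    qPoch ((q ^ n)⁻¹) q k * qPoch (q ^ (-x)) q k / qPoch q q k *
      ((-1) ^ k * q ^ (k.choose 2))⁻¹ * (q ^ x / a) ^ k

/-- The Meixner system; the parameters are `p = (β, c)`. -/
def meixnerSystem : ShiftSystem (ℝ × ℝ) where
  eta x := x
  B p x := p.2 * (x + p.1)
  energy p n := (1 - p.2) * n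
  P p n x := meixner p.1 p.2 n x
  twist p := (p.1, p.2⁻¹)
  shift p M := (p.1 + M, p.2)
  alpha p := p.2
  alpha' p := -((1 - p.2) * p.1)
  nu p x := p.2 ^ x

/-- The little `q`-Jacobi system; the parameters are the exponents `p = (α, β)` in
`a = q^α`, `b = q^β`. -/
def littleQJacobiSystem (q : ℝ) : ShiftSystem (ℝ × ℝ) where
  eta x := 1 - q ^ x
  B p x := q ^ p.1 * (q ^ (-x) - q ^ p.2 * q)
  energy p n := ((q ^ n)⁻¹ - 1) * (1 - q ^ p.1 * q ^ p.2 * q ^ (n + 1))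
  P p n x := littleQJacobi q (q ^ p.1) (q ^ p.2) n x
  twist p := (-p.1, p.2)
  shift p M := (p.1 - M, p.2 + M)
  alpha p := q ^ p.1
  alpha' p := -((1 - q ^ p.1) * (1 - q ^ p.2 * q))
  nu p x := (q ^ p.1) ^ x

/-- The little `q`-Laguerre system; the parameter is the exponent `p = α` in `a = q^α`. -/
def littleQLaguerreSystem (q : ℝ) : ShiftSystem ℝ where
  eta x := 1 - q ^ x
  B p x := q ^ p * q ^ (-x)
  energy _ n := (q ^ n)⁻¹ - 1
  P p n x := littleQLaguerre q (q ^ p) n x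
  twist p := -p
  shift p M := p - M
  alpha p := q ^ p
  alpha' p := -(1 - q ^ p)
  nu p x := (q ^ p) ^ x

/-! ### Multi-indexed polynomials from Casoratians -/

/-- The Casorati determinant `W_C[f₁, …, f_m](x) = det (f_k(x + j - 1))_{1 ≤ j, k ≤ m}`. -/
def casoratian {m : ℕ} (f : Fin m → ℝ → ℝ) (x : ℝ) : ℝ :=
  Matrix.det (Matrix.of fun j k : Fin m => f k (x + ((j : ℕ) : ℝ)))

namespace ShiftSystem

variable {Λ : Type} (S : ShiftSystem Λ)

/-- The virtual state polynomial `ξ̌_v(x; p) = P̌_v(x; 𝔱(p))`. -/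
def xi (p : Λ) (v : ℕ) (x : ℝ) : ℝ := S.P (S.twist p) v x

/-- The virtual state energy `ℰ̃_v(p) = α(p) ℰ_v(𝔱(p)) + α'(p)`. -/
def virtualEnergy (p : Λ) (v : ℕ) : ℝ := S.alpha p * S.energy (S.twist p) v + S.alpha' p

/-- `α(p) B'(x; p)`, where `B'(x; p) = B(x; 𝔱(p))`. -/
def alphaB' (p : Λ) (x : ℝ) : ℝ := S.alpha p * S.B (S.twist p) x

/-- The auxiliary function
`φ_M(x) = ∏_{1 ≤ j < k ≤ M} (η(x + k - 1) - η(x + j - 1)) / η(k - j)`. -/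
def phiAux (M : ℕ) (x : ℝ) : ℝ :=
  ∏ j : Fin M, ∏ k ∈ Finset.Ioi j,
    (S.eta (x + ((k : ℕ) : ℝ)) - S.eta (x + ((j : ℕ) : ℝ))) /
      S.eta (((k : ℕ) : ℝ) - ((j : ℕ) : ℝ))

/-- The normalisation constant
`C_𝒟 = φ_M(0)⁻¹ ∏_{1 ≤ j < k ≤ M} (ℰ̃_{d_j} - ℰ̃_{d_k}) / (α B'(j - 1))`. -/
def constD (p : Λ) {M : ℕ} (d : Fin M → ℕ) : ℝ :=
  1 / S.phiAux M 0 *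
    ∏ j : Fin M, ∏ k ∈ Finset.Ioi j,
      (S.virtualEnergy p (d j) - S.virtualEnergy p (d k)) / S.alphaB' p ((j : ℕ) : ℝ)

/-- The normalisation constant
`C_{𝒟,n} = (-1)^M C_𝒟 (φ_M(0) / φ_{M+1}(0)) ∏_{1 ≤ j ≤ M} (ℰ_n - ℰ̃_{d_j}) / (α B'(j - 1))`. -/
def constDn (p : Λ) {M : ℕ} (d : Fin M → ℕ) (n : ℕ) : ℝ :=
  (-1) ^ M * S.constD p d *
    (S.phiAux M 0 / S.phiAux (M + 1) 0 *
      ∏ j : Fin M,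
        (S.energy p n - S.virtualEnergy p (d j)) / S.alphaB' p ((j : ℕ) : ℝ))

/-- `Q` is the multi-indexed polynomial `P_{𝒟,n}(η; p)` with `𝒟 = {d₁, …, d_M}`: for all `x`,
`W_C[ξ̌_{d₁}, …, ξ̌_{d_M}, ν P̌_n](x; p) = C_{𝒟,n}(p) φ_{M+1}(x) Q(η(x)) ν(x; p + M δ̃)`. -/
def IsMultiIndexed (p : Λ) {M : ℕ} (d : Fin M → ℕ) (n : ℕ) (Q : ℝ[X]) : Prop :=
  ∀ x : ℝ,
    casoratian
        (Fin.snoc (α := fun _ => ℝ → ℝ) (fun j : Fin M => S.xi p (d j))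
          (fun y => S.nu p y * S.P p n y)) x =
      S.constDn p d n * S.phiAux (M + 1) x * Q.eval (S.eta x) * S.nu (S.shift p M) x

/-- The multi-indexed polynomial `P_{𝒟,n}(η; p)`. -/
def multiIndexed (p : Λ) {M : ℕ} (d : Fin M → ℕ) (n : ℕ) : ℝ[X] :=
  Classical.epsilon (S.IsMultiIndexed p d n)

end ShiftSystem

/-! ### Multi-indexed Laguerre and Jacobi polynomials from Wronskians -/

/-- The Laguerre polynomial `L_n^{(α)}(x) = ∑_k (α + k + 1)_{n-k} / ((n - k)! k!) (-x)^k`. -/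
def laguerreL (α : ℝ) (n : ℕ) (x : ℝ) : ℝ :=
  ∑ k ∈ Finset.range (n + 1),
    (ascPochhammer ℝ (n - k)).eval (α + k + 1) / ((n - k).factorial * k.factorial) * (-x) ^ k

/-- The Jacobi polynomial
`P_n^{(α,β)}(x) = ∑_k (n + α + β + 1)_k (α + k + 1)_{n-k} / ((n - k)! k!) ((x - 1) / 2)^k`. -/
def jacobiP (α β : ℝ) (n : ℕ) (x : ℝ) : ℝ :=
  ∑ k ∈ Finset.range (n + 1),
    (ascPochhammer ℝ k).eval (n + α + β + 1) * (ascPochhammer ℝ (n - k)).eval (α + k + 1) /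
      ((n - k).factorial * k.factorial) * ((x - 1) / 2) ^ k

/-- The Wronskian `W[f₁, …, f_m](x) = det (f_k^{(j-1)}(x))_{1 ≤ j, k ≤ m}`. -/
def wronskianDet {m : ℕ} (f : Fin m → ℝ → ℝ) (x : ℝ) : ℝ :=
  Matrix.det (Matrix.of fun j k : Fin m => iteratedDeriv (j : ℕ) (f k) x)

/-- `Q` is the multi-indexed Laguerre polynomial `P^L_{𝒟,n}(η; g)` with all indices of type I:
`Q(η) = e^{-Mη} W[μ₁, …, μ_M, L_n^{(g-1/2)}](η)` with `μ_j(η) = e^η L_{d_j}^{(g-1/2)}(-η)`. -/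
def IsMultiIndexedLaguerreI (g : ℝ) {M : ℕ} (d : Fin M → ℕ) (n : ℕ) (Q : ℝ[X]) : Prop :=
  ∀ η : ℝ,
    Q.eval η = Real.exp (-(M * η)) *
      wronskianDet
        (Fin.snoc (α := fun _ => ℝ → ℝ)
          (fun (j : Fin M) (y : ℝ) => Real.exp y * laguerreL (g - 1 / 2) (d j) (-y))
          (laguerreL (g - 1 / 2) n)) η

/-- `Q` is the multi-indexed Laguerre polynomial `P^L_{𝒟,n}(η; g)` with all indices of type II:
`Q(η) = η^{(g+1/2)M} W[ν₁, …, ν_M, L_n^{(g-1/2)}](η)` for `η > 0`, with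
`ν_j(η) = η^{1/2-g} L_{d_j}^{(1/2-g)}(η)`. -/
def IsMultiIndexedLaguerreII (g : ℝ) {M : ℕ} (d : Fin M → ℕ) (n : ℕ) (Q : ℝ[X]) : Prop :=
  ∀ η : ℝ, 0 < η →
    Q.eval η = η ^ ((g + 1 / 2) * M) *
      wronskianDet
        (Fin.snoc (α := fun _ => ℝ → ℝ)
          (fun (j : Fin M) (y : ℝ) => y ^ (1 / 2 - g) * laguerreL (1 / 2 - g) (d j) y)
          (laguerreL (g - 1 / 2) n)) η

/-- `Q` is the multi-indexed Jacobi polynomial `P^J_{𝒟,n}(η; (g, h))` with all indices of type II: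
`Q(η) = ((1-η)/2)^{(g+1/2)M} W[ν₁, …, ν_M, P_n^{(g-1/2,h-1/2)}](η)` for `-1 < η < 1`, with
`ν_j(η) = ((1-η)/2)^{1/2-g} P_{d_j}^{(1/2-g,h-1/2)}(η)`. -/
def IsMultiIndexedJacobiII (g h : ℝ) {M : ℕ} (d : Fin M → ℕ) (n : ℕ) (Q : ℝ[X]) : Prop :=
  ∀ η : ℝ, -1 < η → η < 1 →
    Q.eval η = ((1 - η) / 2) ^ ((g + 1 / 2) * M) *
      wronskianDet
        (Fin.snoc (α := fun _ => ℝ → ℝ)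
          (fun (j : Fin M) (y : ℝ) =>
            ((1 - y) / 2) ^ (1 / 2 - g) * jacobiP (1 / 2 - g) (h - 1 / 2) (d j) y)
          (jacobiP (g - 1 / 2) (h - 1 / 2) n)) η

/-- The multi-indexed Laguerre polynomial, all indices of type I. -/
def multiIndexedLaguerreI (g : ℝ) {M : ℕ} (d : Fin M → ℕ) (n : ℕ) : ℝ[X] :=
  Classical.epsilon (IsMultiIndexedLaguerreI g d n)

/-- The multi-indexed Laguerre polynomial, all indices of type II. -/
def multiIndexedLaguerreII (g : ℝ) {M : ℕ} (d : Fin M → ℕ) (n : ℕ) : ℝ[X] :=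
  Classical.epsilon (IsMultiIndexedLaguerreII g d n)

/-- The multi-indexed Jacobi polynomial, all indices of type II. -/
def multiIndexedJacobiII (g h : ℝ) {M : ℕ} (d : Fin M → ℕ) (n : ℕ) : ℝ[X] :=
  Classical.epsilon (IsMultiIndexedJacobiII g h d n)

end

noncomputable section

/-! ### Products over pairs and determinants of linear functionals -/

/-! Both sides of each limit are determinants whose entry in row `j` and column `k` is a linear
functional `l k` applied to a monic polynomial of degree `j` in a shift or a derivative. Row
operations allow any monic family to be replaced by any other (`det_functional_monic`). The right
choice brings the Casoratian and the Wronskian to the same normal form, after which the limit is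
taken entry by entry and only the normalisations remain to be compared.

For the two `q`-systems the columns are power sums in `z = q ^ x`, the eigenstate carrying an extra
factor `q ^ (α x)`. A unit shift multiplies the `i`-th power by `q ^ i` or `q ^ (i + α)`. With the
rows `∏ (X - q ^ l)`, each factor divided by `q - 1`, the Casoratian becomes `redMat` with
`qWeight`. The type II Wronskian becomes `redMat` with `diffWeight`, the limit of `qWeight`
(`casoratian_mul_pow`, `rpow_mul_wronskianDet`). The power coefficients obey a two-term recursion
(`lqjCoeff_succ`) whose ratios tend to the Jacobi ratios and, after rescaling `z` by `1 - q`, to the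
Laguerre ratios.

For Meixner with step `h = 1 - c`, each polynomial is a Newton series in `h x` with the coefficients
of a confluent hypergeometric polynomial. A shift acts on these coefficients as `1 + h D`; the
factor `c ^ x` changes this to `1 + h (c D - 1)` for the eigenstate. The rows `(X - 1) ^ j`
therefore yield powers of `D` and of `c D - 1` (`casoratian_meixner`). As `c → 1`, Newton series
become ordinary polynomials, and `D`, `D - 1` are the operators of the type I Wronskian up to a
common shift by one.

The normalising values are computed at a singular point of the differential equation common to all
columns. There the equation and its derivatives reduce to two-term recursions in the row index, in
which the column enters only through its spectral parameter, so the determinant is a Vandermonde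
product (`det_of_recursion`). In the Jacobi and Meixner cases this product is the limit of `C_{𝒟,n}
φ_{M+1}(0)` up to elementary factors (`redMat_jacobi_one`, `laguerreMat_zero_det`). In the little
`q`-Laguerre case a ratio is formed and only the non-vanishing at `0` is needed
(`redMat_laguerre_zero_ne`). -/

theorem prod_pairs_swap {m : ℕ} (u : Fin m → Fin m → ℝ) :
    ∏ j, ∏ k ∈ Finset.Ioi j, u j k = ∏ k, ∏ j ∈ Finset.Iio k, u j k :=
  Finset.prod_comm' (by simp)

theorem prod_Iio_eq_prod_range {m : ℕ} (g : ℕ → ℝ) (k : Fin m) :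
    ∏ j ∈ Finset.Iio k, g (j : ℕ) = ∏ i ∈ Finset.range (k : ℕ), g i := by
  refine Finset.prod_bij (fun a _ => (a : ℕ)) ?_ ?_ ?_ ?_
  · intro a ha
    simpa using ha
  · intro a _ b _ h
    exact Fin.ext h
  · intro b hb
    have hb' : b < (k : ℕ) := by simpa using hb
    exact ⟨⟨b, hb'.trans k.2⟩, by simpa [Fin.lt_def] using hb', rfl⟩
  · intro a _
    rfl

theorem prod_pairs_left {m : ℕ} (g : ℕ → ℝ) :
    ∏ j : Fin m, ∏ _k ∈ Finset.Ioi j, g (j : ℕ) =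
      ∏ k : Fin m, ∏ i ∈ Finset.range (k : ℕ), g i := by
  rw [prod_pairs_swap (fun j _ => g (j : ℕ))]
  exact Finset.prod_congr rfl fun k _ => prod_Iio_eq_prod_range g k

theorem prod_pairs_const {m : ℕ} (z : ℝ) :
    ∏ j : Fin m, ∏ _k ∈ Finset.Ioi j, z = ∏ k : Fin m, z ^ (k : ℕ) := by
  rw [prod_pairs_left (fun _ => z)]
  simp

/-- Separates the pairs that contain the last index, which is the eigenstate, from the pairs of
virtual states. -/
theorem prod_pairs_castSucc {M : ℕ} (u : Fin (M + 1) → Fin (M + 1) → ℝ) :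
    ∏ j, ∏ k ∈ Finset.Ioi j, u j k =
      (∏ j : Fin M, ∏ k ∈ Finset.Ioi j, u j.castSucc k.castSucc) *
        ∏ j : Fin M, u j.castSucc (Fin.last M) := by
  have h1 : ∀ k : Fin M, Finset.Iio k.castSucc = (Finset.Iio k).map Fin.castSuccEmb := by
    intro k
    ext a
    refine Fin.lastCases ?_ (fun i => ?_) a
    · simp only [Finset.mem_Iio, Finset.mem_map, Fin.coe_castSuccEmb]
      exact ⟨fun h => absurd h (Fin.le_last _).not_gt,
        fun ⟨x, _, hx⟩ => absurd hx (Fin.castSucc_lt_last x).ne⟩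
    · simp
  have h2 : Finset.Iio (Fin.last M) = Finset.univ.map Fin.castSuccEmb := by
    ext a
    refine Fin.lastCases ?_ (fun i => ?_) a
    · simp only [Finset.mem_Iio, Finset.mem_map, Fin.coe_castSuccEmb]
      exact ⟨fun h => absurd h (lt_irrefl _),
        fun ⟨x, _, hx⟩ => absurd hx (Fin.castSucc_lt_last x).ne⟩
    · simp
  rw [prod_pairs_swap, prod_pairs_swap (fun j k : Fin M => u j.castSucc k.castSucc),
    Fin.prod_univ_castSucc]
  simp only [h1, h2, Finset.prod_map, Fin.coe_castSuccEmb]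

/-- A family of linear functionals, evaluated on polynomials of degrees `0, 1, …`, has a determinant
that depends on these polynomials only through their leading coefficients. -/
theorem det_functional {m : ℕ} (l : Fin m → ℝ[X] →ₗ[ℝ] ℝ) (p : ℕ → ℝ[X])
    (hp : ∀ j, (p j).natDegree ≤ j) :
    Matrix.det (Matrix.of fun j k : Fin m => l k (p j)) =
      (∏ j : Fin m, (p j).coeff j) *
        Matrix.det (Matrix.of fun j k : Fin m => l k (X ^ (j : ℕ))) := by
  -- Expanding `p j` in monomials factors the matrix through the coefficient matrix, which is lower
  -- triangular by the degree bound.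
  have hmul : (Matrix.of fun j k : Fin m => l k (p j)) =
      (Matrix.of fun j i : Fin m => (p j).coeff i) *
        (Matrix.of fun j k : Fin m => l k (X ^ (j : ℕ))) := by
    ext j k
    rw [Matrix.mul_apply]
    simp only [Matrix.of_apply]
    rw [Fin.sum_univ_eq_sum_range (fun i => (p j).coeff i * l k (X ^ i)) m]
    conv_lhs => rw [(p j).as_sum_range_C_mul_X_pow' ((hp j).trans_lt j.2), map_sum]
    refine Finset.sum_congr rfl fun i _ => ?_
    rw [← smul_eq_C_mul, map_smul, smul_eq_mul]
  rw [hmul, Matrix.det_mul, Matrix.det_of_isLowerTriangular]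
  · simp
  · intro i j hij
    exact coeff_eq_zero_of_natDegree_lt ((hp i).trans_lt (by simpa using hij))

theorem det_functional_monic {m : ℕ} (l : Fin m → ℝ[X] →ₗ[ℝ] ℝ) (p r : ℕ → ℝ[X])
    (hp : ∀ j, (p j).Monic) (hpd : ∀ j, (p j).natDegree = j)
    (hr : ∀ j, (r j).Monic) (hrd : ∀ j, (r j).natDegree = j) :
    Matrix.det (Matrix.of fun j k : Fin m => l k (p j)) =
      Matrix.det (Matrix.of fun j k : Fin m => l k (r j)) := by
  have h : ∀ s : ℕ → ℝ[X], (∀ j, (s j).Monic) → (∀ j, (s j).natDegree = j) →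
      ∏ j : Fin m, (s j).coeff j = 1 := by
    intro s hs hsd
    refine Finset.prod_eq_one fun j _ => ?_
    have := hs j
    rwa [Monic, leadingCoeff, hsd] at this
  rw [det_functional l p (fun j => (hpd j).le), det_functional l r (fun j => (hrd j).le),
    h p hp hpd, h r hr hrd]

theorem prodLinear_monic (r : ℕ → ℝ) (j : ℕ) :
    (∏ i ∈ Finset.range j, (X - C (r i))).Monic :=
  monic_prod_of_monic _ _ fun i _ => monic_X_sub_C (r i)

theorem prodLinear_natDegree (r : ℕ → ℝ) (j : ℕ) :
    (∏ i ∈ Finset.range j, (X - C (r i))).natDegree = j := by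
  rw [natDegree_prod_of_monic _ _ fun i _ => monic_X_sub_C (r i)]
  simp

/-- Newton products are monic of degree `j`, so they may be replaced by powers of the nodes. -/
theorem det_prodLinear {m : ℕ} (E : Fin m → ℝ) (r : ℕ → ℝ) :
    Matrix.det (Matrix.of fun j k : Fin m => ∏ i ∈ Finset.range (j : ℕ), (E k - r i)) =
      ∏ j, ∏ k ∈ Finset.Ioi j, (E k - E j) := by
  have h := det_functional_monic (fun k : Fin m => Polynomial.leval (E k))
    (fun j => ∏ i ∈ Finset.range j, (X - C (r i))) (fun j => X ^ j)
    (prodLinear_monic r) (prodLinear_natDegree r) (fun j => monic_X_pow j)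
    (fun j => natDegree_X_pow j)
  simp only [Polynomial.leval_apply, eval_prod, eval_sub, eval_X, eval_C, eval_pow] at h
  rw [h, ← Matrix.det_vandermonde, ← Matrix.det_transpose]
  congr 1

/-- Columns that satisfy a common two-term recursion whose spectral parameter is the node `E k`
have a Vandermonde determinant. -/
theorem det_of_recursion {m : ℕ} (u : Fin m → ℕ → ℝ) (E : Fin m → ℝ) (r c : ℕ → ℝ)
    (hc : ∀ i, i + 1 < m → c i ≠ 0)
    (h : ∀ k j, j + 1 < m → c j * u k (j + 1) = (E k - r j) * u k j) :
    Matrix.det (Matrix.of fun j k : Fin m => u k j) =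
      (∏ k, u k 0) * ∏ j : Fin m, ∏ k ∈ Finset.Ioi j, (E k - E j) / c j := by
  -- The solved recursion: up to a row factor and a column factor, the entry is a Newton product in
  -- the node `E k`.
  have hu : ∀ k, ∀ j, j < m → u k j =
      u k 0 * ((∏ i ∈ Finset.range j, (c i)⁻¹) * ∏ i ∈ Finset.range j, (E k - r i)) := by
    intro k j
    induction j with
    | zero => simp
    | succ j ih =>
      intro hj
      have h1 := h k j hj
      have h2 := hc j hj
      rw [ih (by omega)] at h1
      rw [Finset.prod_range_succ, Finset.prod_range_succ]
      have : u k (j + 1) = (c j)⁻¹ * (c j * u k (j + 1)) := by field_simp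
      rw [this, h1]
      ring
  have hM : (Matrix.of fun j k : Fin m => u k j) = Matrix.of fun j k : Fin m =>
      u k 0 * (Matrix.of fun j k : Fin m => (∏ i ∈ Finset.range (j : ℕ), (c i)⁻¹) *
        (Matrix.of fun j k : Fin m => ∏ i ∈ Finset.range (j : ℕ), (E k - r i)) j k) j k := by
    ext j k
    exact hu k j j.2
  rw [hM, Matrix.det_mul_row, Matrix.det_mul_column, det_prodLinear,
    ← prod_pairs_left (fun i => (c i)⁻¹), ← Finset.prod_mul_distrib]
  congr 1
  refine Finset.prod_congr rfl fun j _ => ?_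
  rw [← Finset.prod_mul_distrib]
  exact Finset.prod_congr rfl fun k _ => by rw [div_eq_inv_mul]

/-! ### Generalities on the multi-indexed polynomials -/

namespace ShiftSystem

variable {Λ : Type} (S : ShiftSystem Λ)

/-- The energies of the `M` virtual states followed by the energy of the eigenstate. -/
def levels (p : Λ) {M : ℕ} (d : Fin M → ℕ) (n : ℕ) : Fin (M + 1) → ℝ :=
  Fin.snoc (α := fun _ => ℝ) (fun j : Fin M => S.virtualEnergy p (d j)) (S.energy p n)

/-- The product `C_{𝒟,n} φ_{M+1}(0)` in closed form. -/
def levelProd (p : Λ) {M : ℕ} (d : Fin M → ℕ) (n : ℕ) : ℝ :=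
  ∏ j : Fin (M + 1), ∏ k ∈ Finset.Ioi j,
    (S.levels p d n j - S.levels p d n k) / S.alphaB' p ((j : ℕ) : ℝ)

/-- The sign `(-1) ^ M` reverses the differences `ℰ_n - ℰ̃_{d_j}` and the `φ` factors cancel, so the
eigenstate enters on the same footing as the virtual states, as the last of `M + 1` levels. -/
theorem constDn_mul_phiAux (p : Λ) {M : ℕ} (d : Fin M → ℕ) (n : ℕ)
    (h1 : S.phiAux M 0 ≠ 0) (h2 : S.phiAux (M + 1) 0 ≠ 0) :
    S.constDn p d n * S.phiAux (M + 1) 0 = S.levelProd p d n := by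
  have h3 : (-1 : ℝ) ^ M * ∏ j : Fin M,
      (S.energy p n - S.virtualEnergy p (d j)) / S.alphaB' p ((j : ℕ) : ℝ) =
      ∏ j : Fin M, (S.virtualEnergy p (d j) - S.energy p n) / S.alphaB' p ((j : ℕ) : ℝ) := by
    have : (-1 : ℝ) ^ M = ∏ _j : Fin M, (-1 : ℝ) := by simp
    rw [this, ← Finset.prod_mul_distrib]
    exact Finset.prod_congr rfl fun j _ => by ring
  rw [levelProd, prod_pairs_castSucc]
  simp only [levels, Fin.snoc_castSucc, Fin.snoc_last, Fin.val_castSucc]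
  rw [← h3, constDn, constD]
  field_simp

theorem levelProd_ne_zero (p : Λ) {M : ℕ} (d : Fin M → ℕ) (n : ℕ)
    (h1 : ∀ j k, j ≠ k → S.levels p d n j ≠ S.levels p d n k)
    (h2 : ∀ j : ℕ, S.alphaB' p (j : ℝ) ≠ 0) : S.levelProd p d n ≠ 0 :=
  Finset.prod_ne_zero_iff.2 fun j _ => Finset.prod_ne_zero_iff.2 fun k hk =>
    div_ne_zero (sub_ne_zero.2 (h1 j k (ne_of_lt (by simpa using hk)))) (h2 j)

theorem levels_ne (p : Λ) {M : ℕ} (d : Fin M → ℕ) (n : ℕ)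
    (h1 : ∀ j k, j ≠ k → S.virtualEnergy p (d j) ≠ S.virtualEnergy p (d k))
    (h2 : ∀ j, S.energy p n ≠ S.virtualEnergy p (d j)) (j k : Fin (M + 1)) (hjk : j ≠ k) :
    S.levels p d n j ≠ S.levels p d n k := by
  induction j using Fin.lastCases with
  | last =>
    induction k using Fin.lastCases with
    | last => exact absurd rfl hjk
    | cast k => simpa [levels] using h2 k
  | cast j =>
    induction k using Fin.lastCases with
    | last => simpa [levels] using (h2 j).symm
    | cast k => simpa [levels] using h1 j k (fun h => hjk (by rw [h]))

theorem isMultiIndexed_multiIndexed {p : Λ} {M : ℕ} {d : Fin M → ℕ} {n : ℕ}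
    (h : ∃! Q : ℝ[X], S.IsMultiIndexed p d n Q) :
    S.IsMultiIndexed p d n (S.multiIndexed p d n) :=
  Classical.epsilon_spec h.exists

/-- Once the non-zero factors are cancelled, two candidates agree on the range of `η`, which is
infinite. -/
theorem isMultiIndexed_unique {p : Λ} {M : ℕ} {d : Fin M → ℕ} {n : ℕ}
    (hc : S.constDn p d n ≠ 0) (hφ : ∀ x, S.phiAux (M + 1) x ≠ 0)
    (hν : ∀ x, S.nu (S.shift p M) x ≠ 0) (hη : Function.Injective S.eta) {Q R : ℝ[X]}
    (hQ : S.IsMultiIndexed p d n Q) (hR : S.IsMultiIndexed p d n R) : Q = R := by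
  refine eq_of_infinite_eval_eq Q R (Set.Infinite.mono ?_ (Set.infinite_range_of_injective hη))
  rintro _ ⟨x, rfl⟩
  have h := (hQ x).symm.trans (hR x)
  exact mul_left_cancel₀ (mul_ne_zero hc (hφ x)) (mul_right_cancel₀ (hν x) h)

end ShiftSystem

theorem tendsto_det {m : ℕ} {l : Filter ℝ} {A : ℝ → Matrix (Fin m) (Fin m) ℝ}
    {B : Matrix (Fin m) (Fin m) ℝ} (h : ∀ j k, Tendsto (fun e => A e j k) l (𝓝 (B j k))) :
    Tendsto (fun e => (A e).det) l (𝓝 B.det) :=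
  (continuous_id.matrix_det.tendsto B).comp
    (tendsto_pi_nhds.2 fun j => tendsto_pi_nhds.2 fun k => h j k)

section

/-! ### Determinants of power series columns -/

/-- The linear functional `p ↦ ∑_{i ≤ N} c_i z^i p(y_i)`. -/
def nodeFun (N : ℕ) (c y : ℕ → ℝ) (z : ℝ) : ℝ[X] →ₗ[ℝ] ℝ :=
  ∑ i ∈ Finset.range (N + 1), (c i * z ^ i) • Polynomial.leval (y i)

theorem nodeFun_apply (N : ℕ) (c y : ℕ → ℝ) (z : ℝ) (p : ℝ[X]) :
    nodeFun N c y z p = ∑ i ∈ Finset.range (N + 1), c i * z ^ i * p.eval (y i) := by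
  simp [nodeFun, LinearMap.sum_apply]

/-- The exponents of the columns: `0` for the virtual states and `α` for the eigenstate. -/
def offset (M : ℕ) (α : ℝ) : Fin (M + 1) → ℝ := Fin.snoc (α := fun _ => ℝ) (fun _ => 0) α

/-- The extra powers of the variable in the columns: `0` for the virtual states and `M` for the
eigenstate. -/
def excess (M : ℕ) : Fin (M + 1) → ℕ := Fin.snoc (α := fun _ => ℕ) (fun _ => 0) M

/-- The matrix of weighted columns, from which the common power of the variable is removed. -/
def redMat {M : ℕ} (N : Fin (M + 1) → ℕ) (c : Fin (M + 1) → ℕ → ℝ)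
    (w : Fin (M + 1) → ℕ → ℕ → ℝ) (z : ℝ) : Matrix (Fin (M + 1)) (Fin (M + 1)) ℝ :=
  Matrix.of fun j k => ∑ i ∈ Finset.range (N k + 1), c k i * w k j i * z ^ (i + excess M k - j)

/-- The weights vanish where the exponents in `redMat` would be negative. -/
def Truncates {M : ℕ} (w : Fin (M + 1) → ℕ → ℕ → ℝ) : Prop :=
  ∀ (k : Fin (M + 1)) (j i : ℕ), j < M + 1 → i + excess M k < j → w k j i = 0

variable {M : ℕ}

/-- The last column has excess `M ≥ j`, so a negative exponent can occur only in a virtual column.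
-/
theorem truncates_of_castSucc {w : Fin (M + 1) → ℕ → ℕ → ℝ}
    (h : ∀ (k : Fin M) (j i : ℕ), i < j → w k.castSucc j i = 0) : Truncates w := by
  intro k j i hj hi
  induction k using Fin.lastCases with
  | last => simp [excess] at hi; omega
  | cast k => exact h k j i (by simpa [excess] using hi)

theorem prod_excess (z : ℝ) : ∏ k : Fin (M + 1), z ^ excess M k = z ^ M := by
  rw [Fin.prod_univ_castSucc]
  simp [excess]

/-- The factor `z ^ M` is put into the last column. Every entry of row `j` is then divisible by `z ^
j`, because the lower terms have zero weight. -/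
theorem det_weighted_mul_pow (N : Fin (M + 1) → ℕ) (c : Fin (M + 1) → ℕ → ℝ)
    {w : Fin (M + 1) → ℕ → ℕ → ℝ} (hw : Truncates w) (z : ℝ) :
    Matrix.det (Matrix.of fun j k : Fin (M + 1) =>
        ∑ i ∈ Finset.range (N k + 1), c k i * w k j i * z ^ i) * z ^ M =
      (∏ j : Fin (M + 1), z ^ (j : ℕ)) * (redMat N c w z).det := by
  rw [← Matrix.det_mul_column, mul_comm, ← prod_excess, ← Matrix.det_mul_row]
  congr 1
  ext j k
  simp only [Matrix.of_apply, redMat, Finset.mul_sum]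
  refine Finset.sum_congr rfl fun i _ => ?_
  -- The natural subtraction in `redMat` truncates only in this case, and there the weight is zero.
  by_cases h : i + excess M k < (j : ℕ)
  · rw [hw k j i j.2 h]
    ring
  · have h1 : z ^ (i + excess M k) = z ^ (j : ℕ) * z ^ (i + excess M k - j) := by
      rw [← pow_add]
      congr 1
      omega
    rw [pow_add] at h1
    linear_combination c k i * w k j i * h1

theorem redMat_mul_col (N : Fin (M + 1) → ℕ) (c : Fin (M + 1) → ℕ → ℝ)
    (w : Fin (M + 1) → ℕ → ℕ → ℝ) (v : Fin (M + 1) → ℝ) (z : ℝ) :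
    (redMat N (fun k i => v k * c k i) w z).det = (∏ k, v k) * (redMat N c w z).det := by
  rw [← Matrix.det_mul_row]
  congr 1
  ext j k
  simp only [Matrix.of_apply, redMat, Finset.mul_sum]
  exact Finset.sum_congr rfl fun i _ => by ring

/-- Homogeneity: a rescaling of the variable moves into the coefficients, up to powers attached to
the rows and to the last column. It serves the Laguerre limit with `s = 1 - q`. -/
theorem redMat_scale (N : Fin (M + 1) → ℕ) (c : Fin (M + 1) → ℕ → ℝ)
    {w : Fin (M + 1) → ℕ → ℕ → ℝ} (hw : Truncates w) (s z : ℝ) :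
    (∏ j : Fin (M + 1), s ^ (j : ℕ)) * (redMat N c w (s * z)).det =
      s ^ M * (redMat N (fun k i => s ^ i * c k i) w z).det := by
  rw [← Matrix.det_mul_column, ← prod_excess, ← Matrix.det_mul_row]
  congr 1
  ext j k
  simp only [Matrix.of_apply, redMat, Finset.mul_sum]
  refine Finset.sum_congr rfl fun i _ => ?_
  by_cases h : i + excess M k < (j : ℕ)
  · rw [hw k j i j.2 h]
    ring
  · have h1 : s ^ (i + excess M k) = s ^ (j : ℕ) * s ^ (i + excess M k - j) := by
      rw [← pow_add]
      congr 1
      omega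
    rw [pow_add] at h1
    rw [mul_pow]
    linear_combination (-c k i * w k j i * z ^ (i + excess M k - j)) * h1

theorem exists_poly_redMat (N : Fin (M + 1) → ℕ) (c : Fin (M + 1) → ℕ → ℝ)
    (w : Fin (M + 1) → ℕ → ℕ → ℝ) (K : ℝ) :
    ∃ Q : ℝ[X], ∀ z, Q.eval z = K * (redMat N c w z).det := by
  refine ⟨C K * Matrix.det (Matrix.of fun j k : Fin (M + 1) =>
    ∑ i ∈ Finset.range (N k + 1), C (c k i * w k j i) * X ^ (i + excess M k - j)), fun z => ?_⟩
  rw [eval_mul, eval_C]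
  congr 1
  rw [← coe_evalRingHom, RingHom.map_det]
  congr 1
  ext j k
  simp [redMat, eval_finsetSum]

theorem tendsto_redMat {l : Filter ℝ} (N : Fin (M + 1) → ℕ) {c : ℝ → Fin (M + 1) → ℕ → ℝ}
    {c' : Fin (M + 1) → ℕ → ℝ} {w : ℝ → Fin (M + 1) → ℕ → ℕ → ℝ} {w' : Fin (M + 1) → ℕ → ℕ → ℝ}
    (hc : ∀ k i, i ≤ N k → Tendsto (fun e => c e k i) l (𝓝 (c' k i)))
    (hw : ∀ k j i, Tendsto (fun e => w e k j i) l (𝓝 (w' k j i))) (z : ℝ) :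
    Tendsto (fun e => (redMat N (c e) (w e) z).det) l (𝓝 (redMat N c' w' z).det) := by
  refine tendsto_det fun j k => ?_
  simp only [redMat, Matrix.of_apply]
  refine tendsto_finsetSum _ fun i hi => ?_
  exact ((hc k i (by simpa [Nat.lt_succ_iff] using hi)).mul (hw k j i)).mul tendsto_const_nhds

/-- The weights `∏_{l < j} (q^{i + σ} - q^l) / (q - 1)` of the `q`-shift. -/
def qWeight (q α : ℝ) (k : Fin (M + 1)) (j i : ℕ) : ℝ :=
  ∏ l ∈ Finset.range j, (q ^ ((i : ℝ) + offset M α k) - q ^ (l : ℝ)) / (q - 1)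

/-- The weights `∏_{l < j} (i + σ - l)` of the derivative. -/
def diffWeight (α : ℝ) (k : Fin (M + 1)) (j i : ℕ) : ℝ :=
  ∏ l ∈ Finset.range j, ((i : ℝ) + offset M α k - l)

theorem qWeight_truncates (q α : ℝ) : Truncates (qWeight (M := M) q α) :=
  truncates_of_castSucc fun k j i hi =>
    Finset.prod_eq_zero (Finset.mem_range.2 hi) (by simp [offset])

theorem diffWeight_truncates (α : ℝ) : Truncates (diffWeight (M := M) α) :=
  truncates_of_castSucc fun k j i hi =>
    Finset.prod_eq_zero (Finset.mem_range.2 hi) (by simp [offset])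

/-- Each column is a functional that evaluates at the nodes `q ^ (i + σ)`, with `σ` its offset, and
the shift by `j` corresponds to `X ^ j`. The family `∏ (X - q ^ l)` vanishes at the low nodes of the
virtual columns and has a limit after division by `(q - 1) ^ j`. -/
theorem casoratian_mul_pow {q : ℝ} (hq : 0 < q) (hq1 : q < 1) (α : ℝ) (N : Fin (M + 1) → ℕ)
    (c : Fin (M + 1) → ℕ → ℝ) (x : ℝ) :
    casoratian
        (Fin.snoc (α := fun _ => ℝ → ℝ)
          (fun (j : Fin M) y => ∑ i ∈ Finset.range (N j.castSucc + 1),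
            c j.castSucc i * (q ^ y) ^ i)
          (fun y => (q ^ α) ^ y * ∑ i ∈ Finset.range (N (Fin.last M) + 1),
            c (Fin.last M) i * (q ^ y) ^ i)) x * (q ^ x) ^ M =
      (q ^ α) ^ x * (∏ j : Fin (M + 1), (q - 1) ^ (j : ℕ)) * (∏ j : Fin (M + 1), (q ^ x) ^ (j : ℕ)) *
        (redMat N c (qWeight q α) (q ^ x)).det := by
  have hqa : 0 < q ^ α := Real.rpow_pos_of_pos hq α
  set l : Fin (M + 1) → ℝ[X] →ₗ[ℝ] ℝ := fun k =>
    nodeFun (N k) (c k) (fun i => q ^ ((i : ℝ) + offset M α k)) (q ^ x) with hl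
  set v : Fin (M + 1) → ℝ := Fin.snoc (α := fun _ => ℝ) (fun _ => 1) ((q ^ α) ^ x) with hv
  have hvprod : ∏ k, v k = (q ^ α) ^ x := by
    rw [Fin.prod_univ_castSucc]
    simp [hv]
  have hpow : ∀ (i j : ℕ), (q ^ (x + (j : ℝ))) ^ i = (q ^ x) ^ i * (q ^ (i : ℝ)) ^ j := by
    intro i j
    rw [Real.rpow_add hq, mul_pow, Real.rpow_natCast, Real.rpow_natCast, ← pow_mul, ← pow_mul,
      mul_comm j i]
  have h1 : casoratian
        (Fin.snoc (α := fun _ => ℝ → ℝ)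
          (fun (j : Fin M) y => ∑ i ∈ Finset.range (N j.castSucc + 1),
            c j.castSucc i * (q ^ y) ^ i)
          (fun y => (q ^ α) ^ y * ∑ i ∈ Finset.range (N (Fin.last M) + 1),
            c (Fin.last M) i * (q ^ y) ^ i)) x =
      (q ^ α) ^ x * Matrix.det (Matrix.of fun j k => l k (X ^ (j : ℕ))) := by
    rw [← hvprod, ← Matrix.det_mul_row, casoratian]
    congr 1
    ext j k
    simp only [Matrix.of_apply, hl, hv, nodeFun_apply, eval_pow, eval_X]
    induction k using Fin.lastCases with
    | last =>
      simp only [Fin.snoc_last, offset]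
      rw [Real.rpow_add hqa, mul_assoc, Finset.mul_sum]
      congr 1
      refine Finset.sum_congr rfl fun i _ => ?_
      rw [hpow, Real.rpow_add hq, mul_pow, Real.rpow_natCast (q ^ α)]
      ring
    | cast k =>
      simp only [Fin.snoc_castSucc, offset, add_zero, one_mul]
      refine Finset.sum_congr rfl fun i _ => ?_
      rw [hpow]
      ring
  have h2 := det_functional_monic l (fun j => X ^ j)
    (fun j => ∏ i ∈ Finset.range j, (X - C (q ^ (i : ℝ))))
    (fun j => monic_X_pow j) (fun j => natDegree_X_pow j)
    (prodLinear_monic fun i => q ^ (i : ℝ)) (prodLinear_natDegree fun i => q ^ (i : ℝ))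
  have h3 : Matrix.det (Matrix.of fun j k : Fin (M + 1) =>
        l k (∏ i ∈ Finset.range (j : ℕ), (X - C (q ^ (i : ℝ))))) =
      (∏ j : Fin (M + 1), (q - 1) ^ (j : ℕ)) * Matrix.det (Matrix.of fun j k : Fin (M + 1) =>
        ∑ i ∈ Finset.range (N k + 1), c k i * qWeight q α k j i * (q ^ x) ^ i) := by
    rw [← Matrix.det_mul_column]
    congr 1
    ext j k
    simp only [Matrix.of_apply, hl, nodeFun_apply, eval_prod, eval_sub, eval_X, eval_C,
      Finset.mul_sum]
    refine Finset.sum_congr rfl fun i _ => ?_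
    have : (q - 1) ^ (j : ℕ) * qWeight q α k j i =
        ∏ l ∈ Finset.range (j : ℕ), (q ^ ((i : ℝ) + offset M α k) - q ^ (l : ℝ)) := by
      have hc : (q - 1) ^ (j : ℕ) = ∏ _l ∈ Finset.range (j : ℕ), (q - 1) := by simp
      rw [hc, qWeight, ← Finset.prod_mul_distrib]
      refine Finset.prod_congr rfl fun l _ => ?_
      have : q - 1 ≠ 0 := by linarith
      field_simp
    rw [← this]
    ring
  rw [h1, h2, h3]
  have h4 := det_weighted_mul_pow N c (qWeight_truncates q α) (q ^ x)
  linear_combination ((q ^ α) ^ x * ∏ j : Fin (M + 1), (q - 1) ^ (j : ℕ)) * h4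

theorem rpow_injective {q : ℝ} (hq : 0 < q) (hq1 : q < 1) : Function.Injective fun x : ℝ => q ^ x :=
  (Real.strictAnti_rpow_of_base_lt_one hq hq1).injective

/-! ### Multi-indexed polynomials of systems whose columns are polynomials in `q ^ x` -/

namespace ShiftSystem

variable {Λ : Type} (S : ShiftSystem Λ)

/-- Every difference of sinusoidal coordinates contributes one factor `q ^ x`, hence one factor per
pair. -/
theorem phiAux_q {q : ℝ} (hq : 0 < q) (hη : S.eta = fun x => 1 - q ^ x) (m : ℕ) (x : ℝ) :
    S.phiAux m x = (∏ j : Fin m, (q ^ x) ^ (j : ℕ)) * S.phiAux m 0 := by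
  rw [← prod_pairs_const, phiAux, phiAux, ← Finset.prod_mul_distrib]
  refine Finset.prod_congr rfl fun j _ => ?_
  rw [← Finset.prod_mul_distrib]
  refine Finset.prod_congr rfl fun k _ => ?_
  simp only [hη]
  rw [Real.rpow_add hq, Real.rpow_add hq, zero_add, zero_add]
  ring

theorem phiAux_q_zero_ne {q : ℝ} (hq : 0 < q) (hq1 : q < 1) (hη : S.eta = fun x => 1 - q ^ x)
    (m : ℕ) : S.phiAux m 0 ≠ 0 := by
  refine Finset.prod_ne_zero_iff.2 fun j _ => Finset.prod_ne_zero_iff.2 fun k hk => ?_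
  have hjk : (j : ℕ) ≠ k := fun h => (ne_of_lt (Finset.mem_Ioi.1 hk)) (Fin.ext h)
  simp only [hη]
  refine div_ne_zero (fun h => hjk ?_) (fun h => hjk ?_)
  · have : q ^ (0 + ((j : ℕ) : ℝ)) = q ^ (0 + ((k : ℕ) : ℝ)) := by linarith
    simpa using rpow_injective hq hq1 this
  · have : q ^ (((k : ℕ) : ℝ) - ((j : ℕ) : ℝ)) = q ^ (0 : ℝ) := by
      rw [Real.rpow_zero]
      linarith
    have := rpow_injective hq hq1 this
    exact_mod_cast (sub_eq_zero.1 this).symm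

/-- Existence, uniqueness and a determinant formula for the multi-indexed polynomials of a system
whose columns are polynomials in `q^x`. -/
theorem multiIndexed_q {p : Λ} {q α : ℝ} (hq : 0 < q) (hq1 : q < 1) {d : Fin M → ℕ} {n : ℕ}
    (hη : S.eta = fun x => 1 - q ^ x) (hν : S.nu p = fun x => (q ^ α) ^ x)
    (hν' : S.nu (S.shift p M) = fun x => (q ^ (α - M)) ^ x)
    (N : Fin (M + 1) → ℕ) (c : Fin (M + 1) → ℕ → ℝ)
    (hξ : ∀ j x, S.xi p (d j) x =
      ∑ i ∈ Finset.range (N j.castSucc + 1), c j.castSucc i * (q ^ x) ^ i)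
    (hP : ∀ x, S.P p n x =
      ∑ i ∈ Finset.range (N (Fin.last M) + 1), c (Fin.last M) i * (q ^ x) ^ i)
    (hlev : S.levelProd p d n ≠ 0) :
    (∃! Q : ℝ[X], S.IsMultiIndexed p d n Q) ∧
      ∀ z, (S.multiIndexed p d n).eval (1 - z) * S.levelProd p d n =
        (∏ j : Fin (M + 1), (q - 1) ^ (j : ℕ)) * (redMat N c (qWeight q α) z).det := by
  have hφ0 := S.phiAux_q_zero_ne hq hq1 hη
  have hK := S.constDn_mul_phiAux p d n (hφ0 M) (hφ0 (M + 1))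
  have hC : S.constDn p d n ≠ 0 := fun h => hlev (by rw [← hK, h, zero_mul])
  have hφ : ∀ x, S.phiAux (M + 1) x ≠ 0 := by
    intro x
    rw [S.phiAux_q hq hη]
    exact mul_ne_zero (Finset.prod_ne_zero_iff.2 fun j _ =>
      pow_ne_zero _ (Real.rpow_pos_of_pos hq x).ne') (hφ0 _)
  have hνne : ∀ x, S.nu (S.shift p M) x ≠ 0 := by
    intro x
    rw [hν']
    exact (Real.rpow_pos_of_pos (Real.rpow_pos_of_pos hq _) x).ne'
  have hηinj : Function.Injective S.eta := by
    rw [hη]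
    intro x y h
    exact rpow_injective hq hq1 (by simpa using h)
  have hcas : ∀ x, casoratian
        (Fin.snoc (α := fun _ => ℝ → ℝ) (fun j : Fin M => S.xi p (d j))
          (fun y => S.nu p y * S.P p n y)) x * (q ^ x) ^ M =
      (q ^ α) ^ x * (∏ j : Fin (M + 1), (q - 1) ^ (j : ℕ)) *
        (∏ j : Fin (M + 1), (q ^ x) ^ (j : ℕ)) * (redMat N c (qWeight q α) (q ^ x)).det := by
    intro x
    rw [← casoratian_mul_pow hq hq1 α N c x]
    have e1 : (fun j : Fin M => S.xi p (d j)) = fun (j : Fin M) y =>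
        ∑ i ∈ Finset.range (N j.castSucc + 1), c j.castSucc i * (q ^ y) ^ i := by
      funext j y
      exact hξ j y
    have e2 : (fun y => S.nu p y * S.P p n y) = fun y => (q ^ α) ^ y *
        ∑ i ∈ Finset.range (N (Fin.last M) + 1), c (Fin.last M) i * (q ^ y) ^ i := by
      funext y
      rw [hP, hν]
    rw [e1, e2]
  -- The parameter shift in `ν` accounts exactly for the power `(q ^ x) ^ M` multiplied into the
  -- Casoratian.
  have hshift : ∀ x : ℝ, (q ^ (α - M)) ^ x * (q ^ x) ^ M = (q ^ α) ^ x := by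
    intro x
    rw [← Real.rpow_mul hq.le, ← Real.rpow_mul_natCast hq.le, ← Real.rpow_add hq,
      ← Real.rpow_mul hq.le]
    congr 1
    ring
  have key : ∀ (Q : ℝ[X]) (x : ℝ), (casoratian
        (Fin.snoc (α := fun _ => ℝ → ℝ) (fun j : Fin M => S.xi p (d j))
          (fun y => S.nu p y * S.P p n y)) x =
      S.constDn p d n * S.phiAux (M + 1) x * Q.eval (S.eta x) * S.nu (S.shift p M) x) ↔
      Q.eval (1 - q ^ x) * S.levelProd p d n =
        (∏ j : Fin (M + 1), (q - 1) ^ (j : ℕ)) * (redMat N c (qWeight q α) (q ^ x)).det := by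
    intro Q x
    have hz : q ^ x ≠ 0 := (Real.rpow_pos_of_pos hq x).ne'
    have hzM : (q ^ x) ^ M ≠ 0 := pow_ne_zero _ hz
    have hprod : (∏ j : Fin (M + 1), (q ^ x) ^ (j : ℕ)) ≠ 0 :=
      Finset.prod_ne_zero_iff.2 fun j _ => pow_ne_zero _ hz
    have hax : (q ^ α) ^ x ≠ 0 := (Real.rpow_pos_of_pos (Real.rpow_pos_of_pos hq _) x).ne'
    have hη' : S.eta x = 1 - q ^ x := by rw [hη]
    have hν'' : S.nu (S.shift p M) x = (q ^ (α - M)) ^ x := by rw [hν']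
    rw [← mul_left_inj' hzM, hcas, hη', hν'', S.phiAux_q hq hη, ← hK]
    constructor
    · intro h
      refine mul_left_cancel₀ (mul_ne_zero hax hprod) ?_
      rw [← hshift x] at h ⊢
      linear_combination -h
    · intro h
      rw [← hshift x]
      linear_combination
        (-((q ^ (α - M)) ^ x * (q ^ x) ^ M * ∏ j : Fin (M + 1), (q ^ x) ^ (j : ℕ))) * h
  have hex : ∃! Q : ℝ[X], S.IsMultiIndexed p d n Q := by
    obtain ⟨R, hR⟩ := exists_poly_redMat N c (qWeight q α)
      ((∏ j : Fin (M + 1), (q - 1) ^ (j : ℕ)) / S.levelProd p d n)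
    refine ⟨R.comp (1 - X), fun x => (key _ x).2 ?_, fun Q hQ =>
      S.isMultiIndexed_unique hC hφ hνne hηinj hQ fun x => (key _ x).2 ?_⟩ <;>
    · rw [eval_comp]
      simp only [eval_sub, eval_one, eval_X, sub_sub_cancel, hR]
      field_simp
  refine ⟨hex, fun z => ?_⟩
  have hmi := S.isMultiIndexed_multiIndexed hex
  obtain ⟨R, hR⟩ := exists_poly_redMat N c (qWeight q α) (∏ j : Fin (M + 1), (q - 1) ^ (j : ℕ))
  -- The defining relation gives only the points `z = q ^ x`; these are infinitely many, so the
  -- identity extends to every real `z`.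
  have hpoly : ((S.multiIndexed p d n).comp (1 - X)) * C (S.levelProd p d n) = R := by
    refine eq_of_infinite_eval_eq _ _
      (Set.Infinite.mono ?_ (Set.infinite_range_of_injective (rpow_injective hq hq1)))
    rintro _ ⟨x, rfl⟩
    have := (key _ x).1 (hmi x)
    simpa [eval_comp, hR] using this
  rw [← hR, ← hpoly]
  simp [eval_comp]

end ShiftSystem

end

/-! ### Power coefficients of the little `q`-Jacobi polynomials -/

/-- The polynomial `∏_{l < k} (X - q^l)`. -/
def qBasis (q : ℝ) (k : ℕ) : ℝ[X] := ∏ l ∈ Finset.range k, (X - C (q ^ l))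

theorem qBasis_coeff_succ (q : ℝ) (k i : ℕ) :
    (qBasis q (k + 1)).coeff (i + 1) = (qBasis q k).coeff i - q ^ k * (qBasis q k).coeff (i + 1) := by
  rw [qBasis, Finset.prod_range_succ, ← qBasis, coeff_mul_X_sub_C]
  ring

theorem qBasis_coeff_zero (q : ℝ) (k : ℕ) :
    (qBasis q (k + 1)).coeff 0 = -(q ^ k * (qBasis q k).coeff 0) := by
  rw [qBasis, Finset.prod_range_succ, ← qBasis, mul_coeff_zero, coeff_sub,
    coeff_X_zero, coeff_C_zero]
  ring

theorem qBasis_natDegree (q : ℝ) (k : ℕ) : (qBasis q k).natDegree = k :=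
  prodLinear_natDegree (fun l => q ^ l) k

/-- Coefficient form of the `q`-derivative: for `f = qBasis q (k + 1)`, the difference `f(X) -
f(qX)` equals `(1 - q ^ (k + 1)) X` times `qBasis q k`. -/
theorem qBasis_qDeriv (q : ℝ) (k i : ℕ) :
    (1 - q ^ (i + 1)) * (qBasis q (k + 1)).coeff (i + 1) =
      (1 - q ^ (k + 1)) * (qBasis q k).coeff i := by
  induction k generalizing i with
  | zero =>
    rw [qBasis_coeff_succ]
    simp only [qBasis, Finset.range_zero, Finset.prod_empty, coeff_one]
    cases i <;> simp
  | succ k ih =>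
    rw [qBasis_coeff_succ, mul_sub]
    have h1 := ih i
    cases i with
    | zero =>
      have h2 := qBasis_coeff_zero q k
      linear_combination (-q ^ (k + 1)) * h1 + (1 - q - (1 - q ^ (k + 2))) * h2 -
        (q - q ^ (k + 2)) * (qBasis_coeff_zero q k) + (q - q ^ (k + 2)) * h2
    | succ i =>
      have h2 := ih i
      have h3 := qBasis_coeff_succ q k i
      linear_combination (-q ^ (k + 1)) * h1 + q * h2 + (-q * (1 - q ^ (k + 1))) * h3

theorem qBasis_qEuler (q : ℝ) (k i : ℕ) :
    (q ^ (k + 1) - q ^ (i + 1)) * (qBasis q k).coeff i =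
      (1 - q ^ (i + 1)) * q ^ k * (qBasis q k).coeff (i + 1) := by
  have h1 := qBasis_qDeriv q k i
  rw [qBasis_coeff_succ] at h1
  linear_combination h1

/-- The coefficients of the little `q`-Jacobi polynomial with respect to `qBasis`. -/
def lqjBasisCoeff (q a b : ℝ) (n k : ℕ) : ℝ :=
  qPoch ((q ^ n)⁻¹) q k * qPoch (a * b * q ^ (n + 1)) q k / (qPoch (b * q) q k * qPoch q q k) *
    ((-1) ^ k * q ^ (k.choose 2))⁻¹ * (1 / a) ^ k

theorem qPoch_succ (a q : ℝ) (k : ℕ) : qPoch a q (k + 1) = qPoch a q k * (1 - a * q ^ k) :=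
  Finset.prod_range_succ _ _

theorem qPoch_ne_zero {a q : ℝ} (hq : 0 < q) (hq1 : q < 1) (ha : a < 1) (k : ℕ) :
    qPoch a q k ≠ 0 := by
  refine Finset.prod_ne_zero_iff.2 fun i _ => ne_of_gt ?_
  have h1 : 0 < q ^ i := pow_pos hq i
  have h2 : q ^ i ≤ 1 := pow_le_one₀ hq.le hq1.le
  nlinarith

/-- Term ratio of the `₃φ₁` series; `b q < 1` keeps its denominators away from zero. -/
theorem lqjBasisCoeff_succ {q a b : ℝ} (hq : 0 < q) (hq1 : q < 1) (ha : a ≠ 0)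
    (hb : b * q < 1) (n k : ℕ) :
    lqjBasisCoeff q a b n (k + 1) * (a * (1 - q ^ (k + 1)) * (1 - b * q ^ (k + 1))) =
      lqjBasisCoeff q a b n k *
        (((q ^ n)⁻¹ - (q ^ k)⁻¹) * (1 - a * b * q ^ (n + k + 1))) := by
  have h1 := qPoch_ne_zero hq hq1 hb k
  have h2 := qPoch_ne_zero hq hq1 hq1 k
  have h3 := qPoch_ne_zero hq hq1 hb (k + 1)
  have h4 := qPoch_ne_zero hq hq1 hq1 (k + 1)
  rw [qPoch_succ] at h3 h4
  have h5 := right_ne_zero_of_mul h3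
  have h6 := right_ne_zero_of_mul h4
  have hqk : q ^ k ≠ 0 := pow_ne_zero _ hq.ne'
  have hqn : q ^ n ≠ 0 := pow_ne_zero _ hq.ne'
  have hqc : q ^ (k.choose 2) ≠ 0 := pow_ne_zero _ hq.ne'
  simp only [lqjBasisCoeff, qPoch_succ, Nat.choose_succ_succ' k 1, Nat.choose_one_right,
    pow_succ (-1 : ℝ), pow_add q k (k.choose 2), pow_succ (1 / a)]
  have e1 : 1 - a * b * q ^ (n + k + 1) = 1 - a * b * q ^ (n + 1) * q ^ k := by ring
  have e2 : 1 - q ^ (k + 1) = 1 - q * q ^ k := by ring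
  have e3 : 1 - b * q ^ (k + 1) = 1 - b * q * q ^ k := by ring
  have e4 : (q ^ n)⁻¹ - (q ^ k)⁻¹ = -((1 - (q ^ n)⁻¹ * q ^ k) * (q ^ k)⁻¹) := by
    field_simp
    ring
  rw [e1, e2, e3, e4]
  generalize 1 - b * q * q ^ k = u at *
  generalize 1 - q * q ^ k = v at *
  generalize 1 - a * b * q ^ (n + 1) * q ^ k = w at *
  generalize 1 - (q ^ n)⁻¹ * q ^ k = t at *
  field_simp

/-- The power coefficients of the little `q`-Jacobi polynomial in the variable `q^x`. -/
def lqjCoeff (q a b : ℝ) (n i : ℕ) : ℝ :=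
  ∑ k ∈ Finset.range (n + 1), lqjBasisCoeff q a b n k * (qBasis q k).coeff i

/-- The power `q ^ (x k)` in the argument of the series absorbs the negative powers in `(q ^ (-x);
q)_k`. -/
theorem littleQJacobi_eq_sum_qBasis {q : ℝ} (hq : 0 < q) (a b : ℝ) (n : ℕ) (x : ℝ) :
    littleQJacobi q a b n x =
      ∑ k ∈ Finset.range (n + 1), lqjBasisCoeff q a b n k * (qBasis q k).eval (q ^ x) := by
  refine Finset.sum_congr rfl fun k _ => ?_
  have hx : 0 < q ^ x := Real.rpow_pos_of_pos hq x
  have h : qPoch (q ^ (-x)) q k * (q ^ x) ^ k = (qBasis q k).eval (q ^ x) := by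
    have hc : (q ^ x) ^ k = ∏ _l ∈ Finset.range k, q ^ x := by simp
    rw [hc, qPoch, qBasis, eval_prod, ← Finset.prod_mul_distrib]
    refine Finset.prod_congr rfl fun l _ => ?_
    rw [Real.rpow_neg hq.le]
    simp only [eval_sub, eval_X, eval_C]
    field_simp
  rw [← h, lqjBasisCoeff, div_pow]
  ring

theorem littleQJacobi_eq_sum {q : ℝ} (hq : 0 < q) (a b : ℝ) (n : ℕ) (x : ℝ) :
    littleQJacobi q a b n x =
      ∑ i ∈ Finset.range (n + 1), lqjCoeff q a b n i * (q ^ x) ^ i := by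
  rw [littleQJacobi_eq_sum_qBasis hq]
  simp only [lqjCoeff, Finset.sum_mul]
  rw [Finset.sum_comm]
  refine Finset.sum_congr rfl fun k hk => ?_
  have hk' : (qBasis q k).natDegree < n + 1 := by
    rw [qBasis_natDegree]
    simpa using hk
  rw [eval_eq_sum_range' hk', Finset.mul_sum]
  exact Finset.sum_congr rfl fun i _ => by ring

/-- This is the normalisation at `x = 0`, that is at `z = 1`, where every basis polynomial except
the constant one vanishes. -/
theorem sum_lqjCoeff {q : ℝ} (hq : 0 < q) (a b : ℝ) (n : ℕ) :
    ∑ i ∈ Finset.range (n + 1), lqjCoeff q a b n i = 1 := by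
  have h1 := littleQJacobi_eq_sum hq a b n 0
  have h2 := littleQJacobi_eq_sum_qBasis hq a b n 0
  rw [Finset.sum_eq_single 0] at h2
  · simp only [Real.rpow_zero, one_pow, mul_one] at h1
    rw [← h1, h2]
    simp [lqjBasisCoeff, qPoch, qBasis]
  · intro k _ hk
    rw [qBasis, eval_prod, Finset.prod_eq_zero (i := 0) (by simpa using Nat.pos_of_ne_zero hk)]
    · simp
    · simp
  · simp

/-- Coefficient form of the `q`-difference equation. The factor on the left sends the basis element
of degree `k + 1` to itself and to its predecessor. After the series index is shifted by
`lqjBasisCoeff_succ`, the dependence on `k` cancels and only a factor in `i` is left. -/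
theorem lqjCoeff_succ {q a b : ℝ} (hq : 0 < q) (hq1 : q < 1) (ha : a ≠ 0) (hb : b * q < 1)
    (n i : ℕ) :
    lqjCoeff q a b n (i + 1) * ((1 - q ^ (i + 1)) * (a - (q ^ (i + 1))⁻¹)) =
      lqjCoeff q a b n i * (((q ^ n)⁻¹ - (q ^ i)⁻¹) * (1 - a * b * q ^ (n + i + 1))) := by
  set e := lqjBasisCoeff q a b n with he
  have hqp : ∀ k : ℕ, q ^ k ≠ 0 := fun k => pow_ne_zero _ hq.ne'
  have hterm : ∀ k, (qBasis q (k + 1)).coeff (i + 1) *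
      ((1 - q ^ (i + 1)) * (a - (q ^ (i + 1))⁻¹)) =
      a * (1 - q ^ (k + 1)) * (1 - b * q ^ (k + 1)) * (qBasis q k).coeff i +
      (qBasis q (k + 1)).coeff i *
        ((q ^ (k + 1))⁻¹ - (q ^ i)⁻¹ + a * b * q * (q ^ (k + 1) - q ^ i)) := by
    intro k
    have h1 := qBasis_qDeriv q k i
    have h2 := qBasis_qEuler q (k + 1) i
    have h3 : (1 - q ^ (i + 1)) * (q ^ (i + 1))⁻¹ * (qBasis q (k + 1)).coeff (i + 1) =
        ((q ^ i)⁻¹ - (q ^ (k + 1))⁻¹) * (qBasis q (k + 1)).coeff i := by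
      have hA := hqp i
      have hB := hqp k
      have h2' : (q ^ (k + 1) - q ^ i) * (qBasis q (k + 1)).coeff i =
          (1 - q ^ (i + 1)) * q ^ k * (qBasis q (k + 1)).coeff (i + 1) := by
        refine mul_left_cancel₀ hq.ne' ?_
        linear_combination h2
      rw [pow_succ q i, pow_succ q k, mul_inv, mul_inv]
      field_simp
      linear_combination (-1) * h2'
    linear_combination a * (1 - b * q ^ (k + 1)) * h1 - a * b * h2 - h3
  have hterm0 : (qBasis q 0).coeff (i + 1) * ((1 - q ^ (i + 1)) * (a - (q ^ (i + 1))⁻¹)) =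
      (qBasis q 0).coeff i * ((q ^ 0)⁻¹ - (q ^ i)⁻¹ + a * b * q * (q ^ 0 - q ^ i)) := by
    simp only [qBasis, Finset.range_zero, Finset.prod_empty, coeff_one]
    cases i <;> simp
  have hlhs : lqjCoeff q a b n (i + 1) * ((1 - q ^ (i + 1)) * (a - (q ^ (i + 1))⁻¹)) =
      (∑ k ∈ Finset.range n,
        e k * (((q ^ n)⁻¹ - (q ^ k)⁻¹) * (1 - a * b * q ^ (n + k + 1))) * (qBasis q k).coeff i) +
      ∑ k ∈ Finset.range (n + 1), e k * (qBasis q k).coeff i *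
        ((q ^ k)⁻¹ - (q ^ i)⁻¹ + a * b * q * (q ^ k - q ^ i)) := by
    rw [lqjCoeff, Finset.sum_mul, Finset.sum_range_succ', Finset.sum_range_succ' _ n, ← add_assoc,
      ← Finset.sum_add_distrib]
    congr 1
    · refine Finset.sum_congr rfl fun k _ => ?_
      rw [← lqjBasisCoeff_succ hq hq1 ha hb, mul_assoc, hterm]
      ring
    · rw [mul_assoc, hterm0]
      ring
  -- The term `k = n` may be added because its factor `(q ^ n)⁻¹ - (q ^ k)⁻¹` vanishes.
  have hlast : ∑ k ∈ Finset.range n,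
        e k * (((q ^ n)⁻¹ - (q ^ k)⁻¹) * (1 - a * b * q ^ (n + k + 1))) * (qBasis q k).coeff i =
      ∑ k ∈ Finset.range (n + 1),
        e k * (((q ^ n)⁻¹ - (q ^ k)⁻¹) * (1 - a * b * q ^ (n + k + 1))) * (qBasis q k).coeff i := by
    rw [Finset.sum_range_succ]
    simp
  rw [hlhs, hlast, ← Finset.sum_add_distrib, lqjCoeff, Finset.sum_mul]
  refine Finset.sum_congr rfl fun k _ => ?_
  have hA := hqp i
  have hB := hqp k
  have hC := hqp n
  have : ((q ^ n)⁻¹ - (q ^ k)⁻¹) * (1 - a * b * q ^ (n + k + 1)) +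
      ((q ^ k)⁻¹ - (q ^ i)⁻¹ + a * b * q * (q ^ k - q ^ i)) =
      ((q ^ n)⁻¹ - (q ^ i)⁻¹) * (1 - a * b * q ^ (n + i + 1)) := by
    simp only [pow_add, pow_one]
    field_simp
    ring
  rw [← this]
  ring

/-- The quotients of consecutive power coefficients of the little `q`-Jacobi polynomial. -/
def lqjRatio (q a b : ℝ) (n l : ℕ) : ℝ :=
  ((q ^ n)⁻¹ - (q ^ l)⁻¹) * (1 - a * b * q ^ (n + l + 1)) /
    ((1 - q ^ (l + 1)) * (a - (q ^ (l + 1))⁻¹))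

theorem lqjCoeff_eq {q a b : ℝ} (hq : 0 < q) (hq1 : q < 1) (ha : a ≠ 0) (hb : b * q < 1)
    {n : ℕ} (han : ∀ l < n, a ≠ (q ^ (l + 1))⁻¹) {i : ℕ} (hi : i ≤ n) :
    lqjCoeff q a b n i = lqjCoeff q a b n 0 * ∏ l ∈ Finset.range i, lqjRatio q a b n l := by
  induction i with
  | zero => simp
  | succ i ih =>
    have h1 := lqjCoeff_succ hq hq1 ha hb n i
    have h2 : a - (q ^ (i + 1))⁻¹ ≠ 0 := sub_ne_zero.2 (han i (by omega))
    have h3 : 1 - q ^ (i + 1) ≠ 0 := (sub_pos.2 (pow_lt_one₀ hq.le hq1 (by omega))).ne'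
    rw [Finset.prod_range_succ, ← mul_assoc, ← ih (by omega), lqjRatio, ← mul_div_assoc, ← h1,
      mul_div_cancel_right₀ _ (mul_ne_zero h3 h2)]

theorem lqjCoeff_zero_mul_sum {q a b : ℝ} (hq : 0 < q) (hq1 : q < 1) (ha : a ≠ 0)
    (hb : b * q < 1) {n : ℕ} (han : ∀ l < n, a ≠ (q ^ (l + 1))⁻¹) :
    lqjCoeff q a b n 0 *
      ∑ i ∈ Finset.range (n + 1), ∏ l ∈ Finset.range i, lqjRatio q a b n l = 1 := by
  rw [← sum_lqjCoeff hq a b n, Finset.mul_sum]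
  exact Finset.sum_congr rfl fun i hi =>
    (lqjCoeff_eq hq hq1 ha hb han (by simpa [Nat.lt_succ_iff] using hi)).symm

theorem littleQLaguerre_eq (q a : ℝ) (n : ℕ) (x : ℝ) :
    littleQLaguerre q a n x = littleQJacobi q a 0 n x := by
  simp [littleQLaguerre, littleQJacobi, qPoch]

/-! ### The limit `q → 1` -/

theorem tendsto_rpow_sub_div (s r : ℝ) :
    Tendsto (fun q : ℝ => (q ^ s - q ^ r) / (q - 1)) (𝓝[<] 1) (𝓝 (s - r)) := by
  have h : HasDerivAt (fun q : ℝ => q ^ s - q ^ r) (s - r) 1 := by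
    have h1 := Real.hasDerivAt_rpow_const (x := 1) (p := s) (Or.inl one_ne_zero)
    have h2 := Real.hasDerivAt_rpow_const (x := 1) (p := r) (Or.inl one_ne_zero)
    simpa using h1.fun_sub h2
  have h3 := (hasDerivAt_iff_tendsto_slope.1 h).mono_left
    (nhdsWithin_mono 1 (fun x (hx : x < 1) => hx.ne : Set.Iio (1 : ℝ) ⊆ {1}ᶜ))
  refine h3.congr fun q => ?_
  simp [slope_def_field]

theorem eventually_mem_unit : ∀ᶠ q : ℝ in 𝓝[<] 1, 0 < q ∧ q < 1 :=
  Ioo_mem_nhdsLT zero_lt_one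

theorem tendsto_qWeight {M : ℕ} (α : ℝ) (k : Fin (M + 1)) (j i : ℕ) :
    Tendsto (fun q => qWeight q α k j i) (𝓝[<] 1) (𝓝 (diffWeight α k j i)) :=
  tendsto_finsetProd _ fun _ _ => tendsto_rpow_sub_div _ _

/-- The limit of `lqjRatio`: the quotients of consecutive power coefficients of the Jacobi
polynomial. -/
def jacobiRatio (s β : ℝ) (n l : ℕ) : ℝ :=
  ((l : ℝ) - n) * (s + β + n + l + 1) / (((l : ℝ) + 1) * (s + l + 1))

/-- The quotients of consecutive power coefficients of the Laguerre polynomial. -/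
def laguerreRatio (s : ℝ) (n l : ℕ) : ℝ := ((l : ℝ) - n) / (((l : ℝ) + 1) * (s + l + 1))

/-- Two factors above and two below are differences of powers of `q`, each of first order in `q -
1`, so the orders balance. -/
theorem tendsto_lqjRatio (s β : ℝ) (n l : ℕ) (h : s + l + 1 ≠ 0) :
    Tendsto (fun q : ℝ => lqjRatio q (q ^ s) (q ^ β) n l) (𝓝[<] 1) (𝓝 (jacobiRatio s β n l)) := by
  have h1 := tendsto_rpow_sub_div (-n) (-l)
  have h2 := tendsto_rpow_sub_div 0 (s + β + n + l + 1)
  have h3 := tendsto_rpow_sub_div 0 (l + 1)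
  have h4 := tendsto_rpow_sub_div s (-(l + 1))
  have hl : ((l : ℝ) + 1) ≠ 0 := by positivity
  have h5 := (h1.mul h2).div (h3.mul h4)
    (mul_ne_zero (by simpa using (neg_ne_zero.2 hl)) (by convert h using 1; ring))
  have hlim : (-(n : ℝ) - -l) * (0 - (s + β + n + l + 1)) / ((0 - (l + 1)) * (s - -(l + 1))) =
      jacobiRatio s β n l := by
    have e : s - -((l : ℝ) + 1) = s + l + 1 := by ring
    rw [jacobiRatio, e]
    field_simp
    ring
  rw [← hlim]
  refine h5.congr' ?_
  filter_upwards [eventually_mem_unit] with q hq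
  have e1 : q ^ s * q ^ β * q ^ (n + l + 1) = q ^ (s + β + n + l + 1) := by
    rw [← Real.rpow_natCast, ← Real.rpow_add hq.1, ← Real.rpow_add hq.1]
    congr 1
    push_cast
    ring
  have e2 : ∀ m : ℕ, (q ^ m)⁻¹ = q ^ (-(m : ℝ)) := fun m => by
    rw [Real.rpow_neg hq.1.le, Real.rpow_natCast]
  have e3 : q ^ (l + 1) = q ^ ((l : ℝ) + 1) := by
    rw [← Real.rpow_natCast]
    push_cast
    rfl
  have hq1 : q - 1 ≠ 0 := sub_ne_zero.2 hq.2.ne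
  rw [lqjRatio, e1, e2, e2, e2, e3]
  push_cast
  simp only [Pi.div_apply, Real.rpow_zero]
  field_simp

/-- With `b = 0` one vanishing factor of the numerator is lost; the factor `1 - q` replaces it. -/
theorem tendsto_lqlRatio (s : ℝ) (n l : ℕ) (h : s + l + 1 ≠ 0) :
    Tendsto (fun q : ℝ => (1 - q) * lqjRatio q (q ^ s) 0 n l) (𝓝[<] 1)
      (𝓝 (laguerreRatio s n l)) := by
  have h1 := tendsto_rpow_sub_div (-n) (-l)
  have h3 := tendsto_rpow_sub_div 0 (l + 1)
  have h4 := tendsto_rpow_sub_div s (-(l + 1))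
  have hl : ((l : ℝ) + 1) ≠ 0 := by positivity
  have h5 := h1.neg.div (h3.mul h4)
    (mul_ne_zero (by simpa using (neg_ne_zero.2 hl)) (by convert h using 1; ring))
  have hlim : -(-(n : ℝ) - -l) / ((0 - (l + 1)) * (s - -(l + 1))) = laguerreRatio s n l := by
    have e : s - -((l : ℝ) + 1) = s + l + 1 := by ring
    rw [laguerreRatio, e]
    field_simp
    ring
  rw [← hlim]
  refine h5.congr' ?_
  filter_upwards [eventually_mem_unit] with q hq
  have e2 : ∀ m : ℕ, (q ^ m)⁻¹ = q ^ (-(m : ℝ)) := fun m => by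
    rw [Real.rpow_neg hq.1.le, Real.rpow_natCast]
  have e3 : q ^ (l + 1) = q ^ ((l : ℝ) + 1) := by
    rw [← Real.rpow_natCast]
    push_cast
    rfl
  have hq1 : q - 1 ≠ 0 := sub_ne_zero.2 hq.2.ne
  have hq2 : 1 - q ≠ 0 := sub_ne_zero.2 hq.2.ne'
  rw [lqjRatio, e2, e2, e2, e3]
  push_cast
  simp only [Pi.div_apply, Real.rpow_zero, mul_zero, zero_mul, sub_zero, mul_one]
  rw [show (1 : ℝ) - q = -(q - 1) by ring]
  field_simp

/-! ### Hypergeometric columns -/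

/-- Parameters of the columns: `-α` for the virtual states and `α` for the eigenstate. -/
def colParam (M : ℕ) (α : ℝ) : Fin (M + 1) → ℝ := Fin.snoc (α := fun _ => ℝ) (fun _ => -α) α

/-- Degrees of the columns. -/
def colDeg {M : ℕ} (d : Fin M → ℕ) (n : ℕ) : Fin (M + 1) → ℕ :=
  Fin.snoc (α := fun _ => ℕ) d n

/-- For a virtual column `l + 1 ≤ d_j < α` makes the expression negative; for the eigenstate `α >
-1` makes it positive. Hence no coefficient recursion breaks down below the degree of its column. -/
theorem colParam_add_ne_zero {M : ℕ} {α : ℝ} {d : Fin M → ℕ} {n : ℕ} (hα : -1 < α)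
    (hd : ∀ j, (d j : ℝ) < α) (k : Fin (M + 1)) (l : ℕ) (hl : l < colDeg d n k) :
    colParam M α k + l + 1 ≠ 0 := by
  induction k using Fin.lastCases with
  | last =>
    simp only [colParam, Fin.snoc_last]
    have : (0 : ℝ) ≤ l := l.cast_nonneg
    linarith
  | cast k =>
    simp only [colParam, colDeg, Fin.snoc_castSucc] at hl ⊢
    have h1 := hd k
    have h2 : (l : ℝ) + 1 ≤ d k := by exact_mod_cast hl
    linarith

/-- A hypergeometric recursion of the coefficients at `0` gives a two-term recursion of the
derivatives at `1`. -/
theorem derivative_recursion {n : ℕ} {c : ℕ → ℝ} {o α β E : ℝ} (ho : o * (o - α) = 0)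
    (hc : ∀ i ≤ n, c (i + 1) * ((i + o + 1) * (i + o + 1 - α)) =
      c i * ((i + o) ^ 2 + (β + 1 - α) * (i + o) - E)) (hn : c (n + 1) = 0) (j : ℕ) :
    (β + 1 + j) * ∑ i ∈ Finset.range (n + 1), c i * ∏ l ∈ Finset.range (j + 1), ((i : ℝ) + o - l) =
      (E - (j ^ 2 + j * (β + 1 - α))) *
        ∑ i ∈ Finset.range (n + 1), c i * ∏ l ∈ Finset.range j, ((i : ℝ) + o - l) := by
  -- The sum is reindexed by the recursion. The lowest term drops out because `o` is an exponent at
  -- the origin (`ho`), the highest because the series terminates (`hn`). What then remains is an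
  -- identity term by term.
  have h1 : ∑ i ∈ Finset.range (n + 1),
        c i * (((i : ℝ) + o - α) * ∏ l ∈ Finset.range (j + 1), ((i : ℝ) + o - l)) =
      ∑ i ∈ Finset.range (n + 1), c i * (((i : ℝ) + o) ^ 2 + (β + 1 - α) * (i + o) - E) *
        ∏ l ∈ Finset.range j, ((i : ℝ) + o - l) := by
    rw [Finset.sum_range_succ', Finset.sum_range_succ _ n, ← hc n le_rfl, hn]
    congr 1
    · refine Finset.sum_congr rfl fun i hi => ?_
      rw [← hc i (Finset.mem_range.1 hi).le, Finset.prod_range_succ']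
      have : ∏ l ∈ Finset.range j, (((i + 1 : ℕ) : ℝ) + o - ((l + 1 : ℕ) : ℝ)) =
          ∏ l ∈ Finset.range j, ((i : ℝ) + o - l) :=
        Finset.prod_congr rfl fun l _ => by push_cast; ring
      rw [this]
      push_cast
      ring
    · rw [Finset.prod_range_succ']
      push_cast
      linear_combination c 0 * (∏ l ∈ Finset.range j, (0 + o - ((l : ℝ) + 1))) * ho
  rw [← sub_eq_zero] at h1 ⊢
  rw [← neg_eq_zero, ← h1, Finset.mul_sum, Finset.mul_sum, ← Finset.sum_sub_distrib,
    ← Finset.sum_sub_distrib, ← Finset.sum_neg_distrib]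
  refine Finset.sum_congr rfl fun i _ => ?_
  rw [Finset.prod_range_succ]
  ring

/-- If the value at `1` were zero, `derivative_recursion` with `β + 1 + j > 0` would annihilate
every derivative there. The polynomial would then be zero, against `c 0 ≠ 0`. -/
theorem sum_ne_zero_of_recursion {n : ℕ} {c : ℕ → ℝ} {α β E : ℝ}
    (hc : ∀ i ≤ n, c (i + 1) * ((i + 0 + 1) * (i + 0 + 1 - α)) =
      c i * ((i + 0) ^ 2 + (β + 1 - α) * (i + 0) - E)) (hn : c (n + 1) = 0) (h0 : c 0 ≠ 0)
    (hβ : -1 < β) : ∑ i ∈ Finset.range (n + 1), c i ≠ 0 := by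
  intro hsum
  have hL : ∀ j, ∑ i ∈ Finset.range (n + 1), c i * ∏ l ∈ Finset.range j, ((i : ℝ) + 0 - l) = 0 := by
    intro j
    induction j with
    | zero => simpa using hsum
    | succ j ih =>
      have h1 := derivative_recursion (zero_mul (0 - α)) hc hn j
      rw [ih, mul_zero] at h1
      have h2 : (0 : ℝ) ≤ j := j.cast_nonneg
      exact (mul_eq_zero.1 h1).resolve_left (by linarith)
  set F : ℝ[X] := ∑ i ∈ Finset.range (n + 1), monomial i (c i) with hF
  have hT : taylor 1 F = 0 := by
    ext j
    rw [taylor_coeff, coeff_zero]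
    refine (mul_eq_zero.1 (?_ : ((j.factorial : ℝ)) * _ = 0)).resolve_left (by positivity)
    rw [← hL j, hF, map_sum, eval_finsetSum, Finset.mul_sum]
    refine Finset.sum_congr rfl fun i _ => ?_
    rw [hasseDeriv_monomial, eval_monomial, one_pow, mul_one, add_zero,
      ← descPochhammer_eval_eq_prod_range, descPochhammer_eval_eq_descFactorial,
      Nat.descFactorial_eq_factorial_mul_choose]
    push_cast
    ring
  have hF0 : F = 0 := (taylor_injective 1) (by rw [hT, map_zero])
  refine h0 ?_
  have : F.coeff 0 = c 0 := by
    rw [hF, finsetSum_coeff, Finset.sum_eq_single 0]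
    · simp
    · intro i _ hi
      simp [coeff_monomial, hi]
    · simp
  rw [← this, hF0, coeff_zero]

/-- The normalised power coefficients of the Jacobi columns. -/
def jacobiCoeff {M : ℕ} (d : Fin M → ℕ) (n : ℕ) (α β : ℝ) (k : Fin (M + 1)) (i : ℕ) : ℝ :=
  ∏ l ∈ Finset.range i, jacobiRatio (colParam M α k) β (colDeg d n k) l

/-- The normalised power coefficients of the Laguerre columns. -/
def laguerreCoeff {M : ℕ} (d : Fin M → ℕ) (n : ℕ) (α : ℝ) (k : Fin (M + 1)) (i : ℕ) : ℝ :=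
  ∏ l ∈ Finset.range i, laguerreRatio (colParam M α k) (colDeg d n k) l

theorem prod_jacobiRatio_succ {s β : ℝ} {n : ℕ} (hs : ∀ l < n, s + l + 1 ≠ 0) (i : ℕ) (hi : i ≤ n) :
    (∏ l ∈ Finset.range (i + 1), jacobiRatio s β n l) * (((i : ℝ) + 1) * (s + i + 1)) =
      (∏ l ∈ Finset.range i, jacobiRatio s β n l) * (((i : ℝ) - n) * (s + β + n + i + 1)) := by
  rw [Finset.prod_range_succ]
  rcases hi.lt_or_eq with h | rfl
  · have h1 := hs i h
    have h2 : (i : ℝ) + 1 ≠ 0 := by positivity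
    rw [jacobiRatio]
    field_simp
  · simp [jacobiRatio]

theorem prod_jacobiRatio_eq_zero (s β : ℝ) (n : ℕ) :
    ∏ l ∈ Finset.range (n + 1), jacobiRatio s β n l = 0 :=
  Finset.prod_eq_zero (Finset.self_mem_range_succ n) (by simp [jacobiRatio])

theorem sum_prod_jacobiRatio_ne_zero {s β : ℝ} {n : ℕ} (hs : ∀ l < n, s + l + 1 ≠ 0)
    (hβ : -1 < β) :
    ∑ i ∈ Finset.range (n + 1), ∏ l ∈ Finset.range i, jacobiRatio s β n l ≠ 0 := by
  -- With this `E` the quadratic factors as `(i - n) (i + s + β + n + 1)`, the numerator of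
  -- `jacobiRatio`.
  refine sum_ne_zero_of_recursion (α := -s) (β := β) (E := n * (s + β + n + 1)) (fun i hi => ?_)
    (prod_jacobiRatio_eq_zero s β n) (by simp) hβ
  have := prod_jacobiRatio_succ (β := β) hs i hi
  linear_combination this

/-- The limiting levels of the Jacobi system. -/
def jacobiLevel {M : ℕ} (d : Fin M → ℕ) (n : ℕ) (α β : ℝ) : Fin (M + 1) → ℝ :=
  Fin.snoc (α := fun _ => ℝ) (fun j : Fin M => -((α - d j) * (β + d j + 1)))
    ((n : ℝ) * (α + β + n + 1))

/-- The virtual columns and `z ^ α` times the eigenstate column solve one hypergeometric equation,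
with exponents `0` and `α` at the origin and different spectral parameters. Its other finite
singular point is `z = 1`, where the derivatives satisfy a two-term recursion. -/
theorem redMat_jacobi_one {M : ℕ} {d : Fin M → ℕ} {n : ℕ} {α β : ℝ} (hα : -1 < α) (hβ : -1 < β)
    (hd : ∀ j, (d j : ℝ) < α) :
    (redMat (colDeg d n) (jacobiCoeff d n α β) (diffWeight α) 1).det =
      (∏ k, ∑ i ∈ Finset.range (colDeg d n k + 1), jacobiCoeff d n α β k i) *
        ∏ j : Fin (M + 1), ∏ k ∈ Finset.Ioi j,
          (jacobiLevel d n α β k - jacobiLevel d n α β j) / (β + 1 + j) := by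
  have hrec := det_of_recursion
    (fun (k : Fin (M + 1)) j => ∑ i ∈ Finset.range (colDeg d n k + 1),
      jacobiCoeff d n α β k i * ∏ l ∈ Finset.range j, ((i : ℝ) + offset M α k - l))
    -- The constant `α (β + 1)` fits the levels to the spectral parameter of `derivative_recursion`;
    -- it cancels in the differences.
    (fun k => jacobiLevel d n α β k + α * (β + 1)) (fun j => (j : ℝ) ^ 2 + j * (β + 1 - α))
    (fun j => β + 1 + j)
    (fun i _ => by have : (0 : ℝ) ≤ i := i.cast_nonneg; linarith)
    (fun k j _ => by
      refine derivative_recursion ?_ (fun i hi => ?_) (prod_jacobiRatio_eq_zero _ _ _) j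
      · induction k using Fin.lastCases <;> simp [offset]
      · have h1 := prod_jacobiRatio_succ (β := β)
          (fun l hl => colParam_add_ne_zero hα hd k l hl) i hi
        change jacobiCoeff d n α β k (i + 1) * _ = jacobiCoeff d n α β k i * _ at h1
        induction k using Fin.lastCases with
        | last =>
          simp only [colParam, colDeg, offset, jacobiLevel, Fin.snoc_last] at h1 ⊢
          linear_combination h1
        | cast k =>
          simp only [colParam, colDeg, offset, jacobiLevel, Fin.snoc_castSucc] at h1 ⊢
          linear_combination h1)
  simp only [Finset.range_zero, Finset.prod_empty, mul_one, add_sub_add_right_eq_sub] at hrec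
  rw [← hrec]
  congr 1
  ext j k
  simp [redMat, diffWeight]

theorem tendsto_prod_pairs {m : ℕ} {l : Filter ℝ} {u : ℝ → Fin m → Fin m → ℝ}
    {v : Fin m → Fin m → ℝ} (h : ∀ j k, Tendsto (fun e => u e j k) l (𝓝 (v j k))) :
    Tendsto (fun e => ∏ j, ∏ k ∈ Finset.Ioi j, u e j k) l (𝓝 (∏ j, ∏ k ∈ Finset.Ioi j, v j k)) :=
  tendsto_finsetProd _ fun j _ => tendsto_finsetProd _ fun k _ => h j k

theorem redMat_congr {M : ℕ} {N : Fin (M + 1) → ℕ} {c c' : Fin (M + 1) → ℕ → ℝ}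
    (h : ∀ k, ∀ i ≤ N k, c k i = c' k i) (w : Fin (M + 1) → ℕ → ℕ → ℝ) (z : ℝ) :
    redMat N c w z = redMat N c' w z := by
  ext j k
  simp only [redMat, Matrix.of_apply]
  exact Finset.sum_congr rfl fun i hi => by rw [h k i (by simpa [Nat.lt_succ_iff] using hi)]

section

/-! ### The little `q`-Jacobi and little `q`-Laguerre systems -/

variable {M : ℕ} {d : Fin M → ℕ} {n : ℕ} {q α β : ℝ}

theorem rpow_ne_inv_pow (hq : 0 < q) (hq1 : q < 1) {s : ℝ} {l : ℕ} (h : s + l + 1 ≠ 0) :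
    q ^ s ≠ (q ^ (l + 1))⁻¹ := by
  rw [← Real.rpow_natCast, ← Real.rpow_neg hq.le]
  intro h'
  have := rpow_injective hq hq1 h'
  push_cast at this
  exact h (by linarith)

theorem rpow_mul_self_lt_one (hq : 0 < q) (hq1 : q < 1) (hβ : -1 < β) : q ^ β * q < 1 := by
  have : q ^ β * q = q ^ (β + 1) := by rw [Real.rpow_add hq, Real.rpow_one]
  rw [this]
  exact Real.rpow_lt_one hq.le hq1 (by linarith)

theorem inv_pow_eq_rpow (hq : 0 < q) (m : ℕ) : (q ^ m)⁻¹ = q ^ (-(m : ℝ)) := by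
  rw [Real.rpow_neg hq.le, Real.rpow_natCast]

theorem lqj_virtualEnergy (hq : 0 < q) (v : ℕ) :
    (littleQJacobiSystem q).virtualEnergy (α, β) v =
      -((1 - q ^ (α - v)) * (1 - q ^ (β + v + 1))) := by
  have h1 : q ^ (α - v) = q ^ α * (q ^ v)⁻¹ := by
    rw [inv_pow_eq_rpow hq, ← Real.rpow_add hq]
    rfl
  have h2 : q ^ (β + v + 1) = q ^ β * q ^ v * q := by
    rw [Real.rpow_add hq, Real.rpow_add hq, Real.rpow_natCast, Real.rpow_one]
  have h3 : q ^ (-α) = (q ^ α)⁻¹ := Real.rpow_neg hq.le α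
  have ha : q ^ α ≠ 0 := (Real.rpow_pos_of_pos hq α).ne'
  have hv : q ^ v ≠ 0 := pow_ne_zero _ hq.ne'
  simp only [ShiftSystem.virtualEnergy, littleQJacobiSystem, h1, h2, h3]
  rw [pow_succ]
  field_simp
  ring

theorem lqj_energy (hq : 0 < q) :
    (littleQJacobiSystem q).energy (α, β) n = (q ^ (-(n : ℝ)) - 1) * (1 - q ^ (α + β + n + 1)) := by
  have h2 : q ^ (α + β + n + 1) = q ^ α * q ^ β * q ^ (n + 1) := by
    rw [Real.rpow_add hq, Real.rpow_add hq, Real.rpow_add hq, Real.rpow_natCast, Real.rpow_one,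
      pow_succ]
    ring
  simp only [littleQJacobiSystem, h2, inv_pow_eq_rpow hq]

theorem lqj_alphaB' (hq : 0 < q) (x : ℝ) :
    (littleQJacobiSystem q).alphaB' (α, β) x = q ^ (-x) - q ^ (β + 1) := by
  have h3 : q ^ (-α) = (q ^ α)⁻¹ := Real.rpow_neg hq.le α
  have ha : q ^ α ≠ 0 := (Real.rpow_pos_of_pos hq α).ne'
  simp only [ShiftSystem.alphaB', littleQJacobiSystem, h3]
  rw [Real.rpow_add hq, Real.rpow_one, mul_inv_cancel_left₀ ha]

/-- Two virtual energies coincide only if `d_j = d_k` or `α - β = d_j + d_k + 1`. An eigenstate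
energy exceeds each virtual energy, since `d_j < α` and `β > -1`. -/
theorem lqj_levelProd_ne_zero (hq : 0 < q) (hq1 : q < 1) (hd : Function.Injective d)
    (hβ : -1 < β) (hα : ∀ j, (d j : ℝ) < α) (hαβ : ∀ j k, j ≠ k → α - β ≠ d j + d k + 1) :
    (littleQJacobiSystem q).levelProd (α, β) d n ≠ 0 := by
  have hinj := rpow_injective hq hq1
  refine ShiftSystem.levelProd_ne_zero _ _ _ _ (ShiftSystem.levels_ne _ _ _ _ ?_ ?_) ?_
  · intro j k hjk h
    rw [lqj_virtualEnergy hq, lqj_virtualEnergy hq] at h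
    have e : ∀ u w : ℝ, q ^ (α - u) * q ^ (β + w + 1) = q ^ (α + β + w - u + 1) := fun u w => by
      rw [← Real.rpow_add hq]
      congr 1
      ring
    have e1 : q ^ (α - d j) * q ^ (β + d j + 1) = q ^ (α - d k) * q ^ (β + d k + 1) := by
      rw [e, e]
      congr 1
      ring
    -- The two powers in each virtual energy have a product independent of the index (`e1`). Equal
    -- energies then force equal sums, so the two pairs agree up to order.
    have hfac : (q ^ (α - d j) - q ^ (α - d k)) * (q ^ (β + d k + 1) - q ^ (α - d j)) = 0 := by
      linear_combination (-q ^ (α - d j)) * (h + e1) + e1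
    rcases mul_eq_zero.1 hfac with h1 | h1
    · have := hinj (sub_eq_zero.1 h1)
      exact hjk (hd (by exact_mod_cast (sub_right_inj.1 this)))
    · have := hinj (sub_eq_zero.1 h1)
      exact hαβ j k hjk (by linarith)
  · intro j h
    rw [lqj_virtualEnergy hq, lqj_energy hq] at h
    have hfac : q ^ (-(n : ℝ)) * ((1 - q ^ (α - d j + n)) * (1 - q ^ (β + d j + 1 + n))) = 0 := by
      have e1 : q ^ (α - d j) = q ^ (-(n : ℝ)) * q ^ (α - d j + n) := by
        rw [← Real.rpow_add hq]
        congr 1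
        ring
      have e2 : q ^ (β + d j + 1) = q ^ (-(n : ℝ)) * q ^ (β + d j + 1 + n) := by
        rw [← Real.rpow_add hq]
        congr 1
        ring
      have e3 : q ^ (-(n : ℝ)) * (q ^ (α - d j + n) * q ^ (β + d j + 1 + n)) =
          q ^ (α + β + n + 1) := by
        rw [← Real.rpow_add hq, ← Real.rpow_add hq]
        congr 1
        ring
      have e4 : q ^ (α - d j) * q ^ (β + d j + 1) = q ^ (-(n : ℝ)) * q ^ (α + β + n + 1) := by
        rw [← Real.rpow_add hq, ← Real.rpow_add hq]
        congr 1
        ring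
      linear_combination h + e1 + e2 + e3 - e4
    have hn : (0 : ℝ) ≤ n := n.cast_nonneg
    have hdj : (0 : ℝ) ≤ d j := (d j).cast_nonneg
    have h1 : q ^ (α - d j + n) < 1 := Real.rpow_lt_one hq.le hq1 (by linarith [hα j])
    have h2 : q ^ (β + d j + 1 + n) < 1 := Real.rpow_lt_one hq.le hq1 (by linarith)
    have h3 := Real.rpow_pos_of_pos hq (-(n : ℝ))
    have : 0 < q ^ (-(n : ℝ)) * ((1 - q ^ (α - d j + n)) * (1 - q ^ (β + d j + 1 + n))) :=
      mul_pos h3 (mul_pos (by linarith) (by linarith))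
    exact this.ne' hfac
  · intro j h
    rw [lqj_alphaB' hq] at h
    have := hinj (sub_eq_zero.1 h)
    have hj : (0 : ℝ) ≤ j := j.cast_nonneg
    linarith

/-- The power coefficients of the columns of the little `q`-Jacobi Casoratian, normalised at `0`. -/
def lqjColCoeff (d : Fin M → ℕ) (n : ℕ) (α b q : ℝ) (k : Fin (M + 1)) (i : ℕ) : ℝ :=
  ∏ l ∈ Finset.range i, lqjRatio q (q ^ colParam M α k) b (colDeg d n k) l

theorem redMat_lqjCoeff (hq : 0 < q) (hq1 : q < 1) {b : ℝ} (hb : b * q < 1) (hα : -1 < α)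
    (hd : ∀ j, (d j : ℝ) < α) (w : Fin (M + 1) → ℕ → ℕ → ℝ) (z : ℝ) :
    (redMat (colDeg d n) (fun k => lqjCoeff q (q ^ colParam M α k) b (colDeg d n k)) w z).det =
      (∏ k, lqjCoeff q (q ^ colParam M α k) b (colDeg d n k) 0) *
        (redMat (colDeg d n) (lqjColCoeff d n α b q) w z).det := by
  rw [← redMat_mul_col]
  congr 1
  refine redMat_congr (fun k i hi => ?_) _ _
  exact lqjCoeff_eq hq hq1 (Real.rpow_pos_of_pos hq _).ne' hb
    (fun l hl => rpow_ne_inv_pow hq hq1 (colParam_add_ne_zero hα hd k l hl)) hi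

theorem lqjCoeff_zero_mul_sum_col (hq : 0 < q) (hq1 : q < 1) {b : ℝ} (hb : b * q < 1)
    (hα : -1 < α) (hd : ∀ j, (d j : ℝ) < α) (k : Fin (M + 1)) :
    lqjCoeff q (q ^ colParam M α k) b (colDeg d n k) 0 *
      ∑ i ∈ Finset.range (colDeg d n k + 1), lqjColCoeff d n α b q k i = 1 :=
  lqjCoeff_zero_mul_sum hq hq1 (Real.rpow_pos_of_pos hq _).ne' hb
    (fun l hl => rpow_ne_inv_pow hq hq1 (colParam_add_ne_zero hα hd k l hl))

theorem lqj_multiIndexed (hq : 0 < q) (hq1 : q < 1) (hd : Function.Injective d)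
    (hα : -1 < α) (hβ : -1 < β) (hdα : ∀ j, (d j : ℝ) < α)
    (hαβ : ∀ j k, j ≠ k → α - β ≠ d j + d k + 1) :
    (∃! Q : ℝ[X], (littleQJacobiSystem q).IsMultiIndexed (α, β) d n Q) ∧
      ∀ z, ((littleQJacobiSystem q).multiIndexed (α, β) d n).eval (1 - z) *
          ((littleQJacobiSystem q).levelProd (α, β) d n) =
        (∏ j : Fin (M + 1), (q - 1) ^ (j : ℕ)) *
          ((∏ k, lqjCoeff q (q ^ colParam M α k) (q ^ β) (colDeg d n k) 0) *
            (redMat (colDeg d n) (lqjColCoeff d n α (q ^ β) q) (qWeight q α) z).det) := by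
  have h := ShiftSystem.multiIndexed_q (littleQJacobiSystem q) (p := (α, β)) (α := α) (d := d)
    (n := n) hq hq1 rfl rfl rfl
    (colDeg d n) (fun k => lqjCoeff q (q ^ colParam M α k) (q ^ β) (colDeg d n k))
    (fun j x => by
      simp only [colDeg, colParam, Fin.snoc_castSucc]
      exact littleQJacobi_eq_sum hq _ _ _ _)
    (fun x => by
      simp only [colDeg, colParam, Fin.snoc_last]
      exact littleQJacobi_eq_sum hq _ _ _ _)
    (lqj_levelProd_ne_zero hq hq1 hd hβ hdα hαβ)
  refine ⟨h.1, fun z => ?_⟩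
  rw [h.2 z, redMat_lqjCoeff hq hq1 (rpow_mul_self_lt_one hq hq1 hβ) hα hdα]

theorem tendsto_lqjColCoeff (hα : -1 < α) (hd : ∀ j, (d j : ℝ) < α) (k : Fin (M + 1)) (i : ℕ)
    (hi : i ≤ colDeg d n k) :
    Tendsto (fun q : ℝ => lqjColCoeff d n α (q ^ β) q k i) (𝓝[<] 1)
      (𝓝 (jacobiCoeff d n α β k i)) :=
  tendsto_finsetProd _ fun l hl => tendsto_lqjRatio _ _ _ _
    (colParam_add_ne_zero hα hd k l ((Finset.mem_range.1 hl).trans_le hi))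

theorem tendsto_lqj_levels (k : Fin (M + 1)) :
    Tendsto (fun q : ℝ => (littleQJacobiSystem q).levels (α, β) d n k / ((q - 1) * (q - 1)))
      (𝓝[<] 1) (𝓝 (jacobiLevel d n α β k)) := by
  induction k using Fin.lastCases with
  | last =>
    simp only [ShiftSystem.levels, jacobiLevel, Fin.snoc_last]
    have h := (tendsto_rpow_sub_div (-(n : ℝ)) 0).mul (tendsto_rpow_sub_div 0 (α + β + n + 1))
    have e : (-(n : ℝ) - 0) * (0 - (α + β + n + 1)) = n * (α + β + n + 1) := by ring
    rw [e] at h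
    refine h.congr' ?_
    filter_upwards [eventually_mem_unit] with q hq
    rw [lqj_energy hq.1, Real.rpow_zero, div_mul_div_comm]
  | cast k =>
    simp only [ShiftSystem.levels, jacobiLevel, Fin.snoc_castSucc]
    have h := ((tendsto_rpow_sub_div 0 (α - d k)).mul (tendsto_rpow_sub_div 0 (β + d k + 1))).neg
    have e : -((0 - (α - d k)) * (0 - (β + d k + 1))) = -((α - d k) * (β + d k + 1)) := by ring
    rw [e] at h
    refine h.congr' ?_
    filter_upwards [eventually_mem_unit] with q hq
    rw [lqj_virtualEnergy hq.1, Real.rpow_zero, div_mul_div_comm, neg_div]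

/-- A level difference is divided by `(q - 1) ^ 2` and `αB'` by `q - 1`. The net factor of one `q -
1` per pair gives the product of powers in the denominator. -/
theorem tendsto_lqj_levelProd (hβ : -1 < β) :
    Tendsto (fun q : ℝ => (littleQJacobiSystem q).levelProd (α, β) d n /
        ∏ j : Fin (M + 1), (q - 1) ^ (j : ℕ)) (𝓝[<] 1)
      (𝓝 (∏ j : Fin (M + 1), ∏ k ∈ Finset.Ioi j,
          (jacobiLevel d n α β k - jacobiLevel d n α β j) / (β + 1 + j))) := by
  have h : ∀ j k : Fin (M + 1), Tendsto (fun q : ℝ =>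
      ((littleQJacobiSystem q).levels (α, β) d n j - (littleQJacobiSystem q).levels (α, β) d n k) /
        (littleQJacobiSystem q).alphaB' (α, β) ((j : ℕ) : ℝ) / (q - 1)) (𝓝[<] 1)
      (𝓝 ((jacobiLevel d n α β k - jacobiLevel d n α β j) / (β + 1 + j))) := by
    intro j k
    have hj : (0 : ℝ) ≤ (j : ℕ) := Nat.cast_nonneg _
    have h1 := ((tendsto_lqj_levels (d := d) (n := n) (α := α) (β := β) j).sub
      (tendsto_lqj_levels (d := d) (n := n) (α := α) (β := β) k)).div (tendsto_rpow_sub_div (-((j : ℕ) : ℝ)) (β + 1))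
      (by intro h; linarith)
    have e : (jacobiLevel d n α β j - jacobiLevel d n α β k) / (-((j : ℕ) : ℝ) - (β + 1)) =
        (jacobiLevel d n α β k - jacobiLevel d n α β j) / (β + 1 + j) := by
      rw [← neg_div_neg_eq]
      congr 1 <;> ring
    rw [e] at h1
    refine h1.congr' ?_
    filter_upwards [eventually_mem_unit] with q hq
    have hq1 : q - 1 ≠ 0 := sub_ne_zero.2 hq.2.ne
    rw [lqj_alphaB' hq.1, Pi.div_apply]
    field_simp
  refine (tendsto_prod_pairs h).congr fun q => ?_
  rw [ShiftSystem.levelProd, ← prod_pairs_const, ← Finset.prod_div_distrib]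
  exact Finset.prod_congr rfl fun j _ => Finset.prod_div_distrib _ _

theorem jacobiLevelProd_ne_zero (hd : Function.Injective d) (hβ : -1 < β)
    (hα : ∀ j, (d j : ℝ) < α) (hαβ : ∀ j k, j ≠ k → α - β ≠ d j + d k + 1) :
    ∏ j : Fin (M + 1), ∏ k ∈ Finset.Ioi j,
      (jacobiLevel d n α β k - jacobiLevel d n α β j) / (β + 1 + j) ≠ 0 := by
  refine Finset.prod_ne_zero_iff.2 fun j _ => Finset.prod_ne_zero_iff.2 fun k hk => div_ne_zero ?_ ?_
  · have hjk : j < k := Finset.mem_Ioi.1 hk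
    have hn : (0 : ℝ) ≤ n := n.cast_nonneg
    induction j using Fin.lastCases with
    | last => exact absurd hjk (Fin.le_last k).not_gt
    | cast j =>
      have hdj : (0 : ℝ) ≤ d j := (d j).cast_nonneg
      induction k using Fin.lastCases with
      | last =>
        simp only [jacobiLevel, Fin.snoc_last, Fin.snoc_castSucc]
        have : (0 : ℝ) < (α - d j + n) * (β + d j + 1 + n) :=
          mul_pos (by linarith [hα j]) (by linarith)
        nlinarith
      | cast k =>
        simp only [jacobiLevel, Fin.snoc_castSucc]
        have hne : j ≠ k := fun h => hjk.ne (by rw [h])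
        have h1 : ((d k : ℝ) - d j) ≠ 0 := by
          rw [sub_ne_zero]
          exact_mod_cast fun h => hne (hd h).symm
        have h2 : (β - α + d j + d k + 1) ≠ 0 := fun h => hαβ j k hne (by linarith)
        have h3 := mul_ne_zero h1 h2
        intro h
        exact h3 (by linear_combination h)
  · have : (0 : ℝ) ≤ (j : ℕ) := Nat.cast_nonneg _
    intro h
    linarith

/-- The constant coefficient of each `q`-column is the reciprocal of its normalised column sum.
Together with the limiting level product, the limits of these sums form precisely the determinant at
`z = 1`. -/
theorem tendsto_lqj_multiIndexed (hd : Function.Injective d)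
    (hα : -1 < α) (hβ : -1 < β) (hdα : ∀ j, (d j : ℝ) < α)
    (hαβ : ∀ j k, j ≠ k → α - β ≠ d j + d k + 1) (z : ℝ) :
    (redMat (colDeg d n) (jacobiCoeff d n α β) (diffWeight α) 1).det ≠ 0 ∧
    Tendsto (fun q : ℝ => ((littleQJacobiSystem q).multiIndexed (α, β) d n).eval (1 - z))
      (𝓝[<] 1) (𝓝 ((redMat (colDeg d n) (jacobiCoeff d n α β) (diffWeight α) z).det /
        (redMat (colDeg d n) (jacobiCoeff d n α β) (diffWeight α) 1).det)) := by
  have hS : ∀ k : Fin (M + 1),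
      ∑ i ∈ Finset.range (colDeg d n k + 1), jacobiCoeff d n α β k i ≠ 0 := fun k =>
    sum_prod_jacobiRatio_ne_zero (fun l hl => colParam_add_ne_zero hα hdα k l hl) hβ
  have hL := jacobiLevelProd_ne_zero (n := n) hd hβ hdα hαβ
  have hone := redMat_jacobi_one (n := n) hα hβ hdα
  rw [hone]
  refine ⟨mul_ne_zero (Finset.prod_ne_zero_iff.2 fun k _ => hS k) hL, ?_⟩
  have hden : Tendsto (fun q : ℝ => ∏ k : Fin (M + 1), ∑ i ∈ Finset.range (colDeg d n k + 1),
      lqjColCoeff d n α (q ^ β) q k i) (𝓝[<] 1)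
      (𝓝 (∏ k : Fin (M + 1), ∑ i ∈ Finset.range (colDeg d n k + 1), jacobiCoeff d n α β k i)) :=
    tendsto_finsetProd _ fun k _ => tendsto_finsetSum _ fun i hi =>
      tendsto_lqjColCoeff hα hdα k i (by simpa [Nat.lt_succ_iff] using hi)
  have hnum := tendsto_redMat (colDeg d n)
    (fun k i hi => tendsto_lqjColCoeff (β := β) (n := n) hα hdα k i hi)
    (fun k j i => tendsto_qWeight α k j i) z
  have hlim := hnum.div (hden.mul (tendsto_lqj_levelProd (d := d) (n := n) (α := α) hβ))
    (mul_ne_zero (Finset.prod_ne_zero_iff.2 fun k _ => hS k) hL)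
  refine hlim.congr' ?_
  filter_upwards [eventually_mem_unit] with q hq
  have hmi := (lqj_multiIndexed (n := n) hq.1 hq.2 hd hα hβ hdα hαβ).2 z
  have hlev := lqj_levelProd_ne_zero (n := n) hq.1 hq.2 hd hβ hdα hαβ
  have hq1 : (∏ j : Fin (M + 1), (q - 1) ^ (j : ℕ)) ≠ 0 :=
    Finset.prod_ne_zero_iff.2 fun j _ => pow_ne_zero _ (sub_ne_zero.2 hq.2.ne)
  have hc : (∏ k : Fin (M + 1), lqjCoeff q (q ^ colParam M α k) (q ^ β) (colDeg d n k) 0) *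
      ∏ k : Fin (M + 1), ∑ i ∈ Finset.range (colDeg d n k + 1),
        lqjColCoeff d n α (q ^ β) q k i = 1 := by
    rw [← Finset.prod_mul_distrib]
    exact Finset.prod_eq_one fun k _ =>
      lqjCoeff_zero_mul_sum_col hq.1 hq.2 (rpow_mul_self_lt_one hq.1 hq.2 hβ) hα hdα k
  have hSq := right_ne_zero_of_mul_eq_one hc
  rw [Pi.div_apply, div_eq_iff (mul_ne_zero hSq (div_ne_zero hlev hq1))]
  rw [← mul_div_assoc, ← mul_div_assoc, eq_div_iff hq1]
  linear_combination (-(∏ k : Fin (M + 1), ∑ i ∈ Finset.range (colDeg d n k + 1),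
        lqjColCoeff d n α (q ^ β) q k i)) * hmi -
    ((∏ j : Fin (M + 1), (q - 1) ^ (j : ℕ)) *
      (redMat (colDeg d n) (lqjColCoeff d n α (q ^ β) q) (qWeight q α) z).det) * hc

/-! The little `q`-Laguerre system -/

theorem lql_virtualEnergy (hq : 0 < q) (v : ℕ) :
    (littleQLaguerreSystem q).virtualEnergy α v = q ^ (α - v) - 1 := by
  have h1 : q ^ (α - v) = q ^ α * (q ^ v)⁻¹ := by
    rw [inv_pow_eq_rpow hq, ← Real.rpow_add hq]
    rfl
  simp only [ShiftSystem.virtualEnergy, littleQLaguerreSystem, h1]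
  ring

theorem lql_levelProd_ne_zero (hq : 0 < q) (hq1 : q < 1) (hd : Function.Injective d)
    (hα : ∀ j, (d j : ℝ) < α) : (littleQLaguerreSystem q).levelProd α d n ≠ 0 := by
  have hinj := rpow_injective hq hq1
  refine ShiftSystem.levelProd_ne_zero _ _ _ _ (ShiftSystem.levels_ne _ _ _ _ ?_ ?_) ?_
  · intro j k hjk h
    rw [lql_virtualEnergy hq, lql_virtualEnergy hq] at h
    have := hinj (sub_left_inj.1 h)
    exact hjk (hd (by exact_mod_cast (sub_right_inj.1 this)))
  · intro j h
    rw [lql_virtualEnergy hq] at h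
    simp only [littleQLaguerreSystem, inv_pow_eq_rpow hq] at h
    have := hinj (sub_left_inj.1 h)
    have hn : (0 : ℝ) ≤ n := n.cast_nonneg
    linarith [hα j]
  · intro j
    simp only [ShiftSystem.alphaB', littleQLaguerreSystem]
    exact mul_ne_zero (Real.rpow_pos_of_pos hq _).ne'
      (mul_ne_zero (Real.rpow_pos_of_pos hq _).ne' (Real.rpow_pos_of_pos hq _).ne')

theorem lql_multiIndexed (hq : 0 < q) (hq1 : q < 1) (hd : Function.Injective d)
    (hα : -1 < α) (hdα : ∀ j, (d j : ℝ) < α) :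
    (∃! Q : ℝ[X], (littleQLaguerreSystem q).IsMultiIndexed α d n Q) ∧
      ∀ z, ((littleQLaguerreSystem q).multiIndexed α d n).eval (1 - z) *
          ((littleQLaguerreSystem q).levelProd α d n) =
        (∏ j : Fin (M + 1), (q - 1) ^ (j : ℕ)) *
          ((∏ k, lqjCoeff q (q ^ colParam M α k) 0 (colDeg d n k) 0) *
            (redMat (colDeg d n) (lqjColCoeff d n α 0 q) (qWeight q α) z).det) := by
  have h := ShiftSystem.multiIndexed_q (littleQLaguerreSystem q) (p := α) (α := α) (d := d)
    (n := n) hq hq1 rfl rfl rfl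
    (colDeg d n) (fun k => lqjCoeff q (q ^ colParam M α k) 0 (colDeg d n k))
    (fun j x => by
      simp only [colDeg, colParam, Fin.snoc_castSucc]
      rw [← littleQJacobi_eq_sum hq, ← littleQLaguerre_eq]
      rfl)
    (fun x => by
      simp only [colDeg, colParam, Fin.snoc_last]
      rw [← littleQJacobi_eq_sum hq, ← littleQLaguerre_eq]
      rfl)
    (lql_levelProd_ne_zero hq hq1 hd hdα)
  refine ⟨h.1, fun z => ?_⟩
  rw [h.2 z, redMat_lqjCoeff hq hq1 (by simp) hα hdα]

theorem tendsto_lqlColCoeff (hα : -1 < α) (hd : ∀ j, (d j : ℝ) < α) (k : Fin (M + 1)) (i : ℕ)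
    (hi : i ≤ colDeg d n k) :
    Tendsto (fun q : ℝ => (1 - q) ^ i * lqjColCoeff d n α 0 q k i) (𝓝[<] 1)
      (𝓝 (laguerreCoeff d n α k i)) := by
  have h : Tendsto (fun q : ℝ => ∏ l ∈ Finset.range i,
      ((1 - q) * lqjRatio q (q ^ colParam M α k) 0 (colDeg d n k) l)) (𝓝[<] 1)
      (𝓝 (laguerreCoeff d n α k i)) :=
    tendsto_finsetProd _ fun l hl => tendsto_lqlRatio _ _ _
      (colParam_add_ne_zero hα hd k l ((Finset.mem_range.1 hl).trans_le hi))
  refine h.congr fun q => ?_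
  rw [Finset.prod_mul_distrib, Finset.prod_const, Finset.card_range, lqjColCoeff]

theorem laguerreCoeff_succ {k : Fin (M + 1)} {j : ℕ} (h : colParam M α k + j + 1 ≠ 0) :
    laguerreCoeff d n α k (j + 1) * ((j + 1) * (colParam M α k + j + 1)) =
      laguerreCoeff d n α k j * (j - colDeg d n k) := by
  have h2 : (j : ℝ) + 1 ≠ 0 := by positivity
  rw [laguerreCoeff, Finset.prod_range_succ, ← laguerreCoeff, laguerreRatio]
  field_simp

theorem laguerreCoeff_eq_zero {k : Fin (M + 1)} {j : ℕ} (h : colDeg d n k < j) :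
    laguerreCoeff d n α k j = 0 :=
  Finset.prod_eq_zero (Finset.mem_range.2 h) (by simp [laguerreRatio])

/-- Pigeonhole: there are only `M - 1` positive integers below `M`, too few for `M` distinct
indices. -/
theorem card_lt_of_lt (hd : Function.Injective d) (hd1 : ∀ j, 1 ≤ d j)
    (hα : ∀ j, (d j : ℝ) < α) (hM : 0 < M) : (M : ℝ) < α := by
  by_contra hlt
  push Not at hlt
  have hmem : ∀ j ∈ Finset.univ, d j ∈ Finset.Ioo 0 M := by
    intro j _
    have h1 : (d j : ℝ) < M := (hα j).trans_le hlt
    exact Finset.mem_Ioo.2 ⟨hd1 j, by exact_mod_cast h1⟩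
  have := Finset.card_le_card_of_injOn d hmem hd.injOn
  simp at this
  omega

/-- At `0` the eigenstate column survives only in its corner `∏ (α - l)` over `l < M`, non-zero
because `M < α`. The remaining minor consists of the Taylor coefficients of the virtual columns
times factorials; their recursion makes it a Vandermonde product in the `d_j`. -/
theorem redMat_laguerre_zero_ne (hd : Function.Injective d) (hd1 : ∀ j, 1 ≤ d j)
    (hdα : ∀ j, (d j : ℝ) < α) :
    (redMat (colDeg d n) (laguerreCoeff d n α) (diffWeight α) 0).det ≠ 0 := by
  set A := redMat (colDeg d n) (laguerreCoeff d n α) (diffWeight α) 0 with hA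
  have hlast : ∀ j : Fin (M + 1), j ≠ Fin.last M → A j (Fin.last M) = 0 := by
    intro j hj
    have hjM : (j : ℕ) < M := lt_of_le_of_ne (Nat.lt_succ_iff.1 j.2) fun h => hj (Fin.ext h)
    simp only [hA, redMat, Matrix.of_apply, excess, Fin.snoc_last]
    exact Finset.sum_eq_zero fun i _ => by rw [zero_pow (by omega), mul_zero]
  have hcorner : A (Fin.last M) (Fin.last M) ≠ 0 := by
    simp only [hA, redMat, Matrix.of_apply, excess, Fin.snoc_last, Fin.val_last]
    rw [Finset.sum_eq_single 0]
    · simp only [laguerreCoeff, diffWeight, offset, Fin.snoc_last, Finset.range_zero,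
        Finset.prod_empty, one_mul, Nat.cast_zero, zero_add, Nat.sub_self, pow_zero, mul_one]
      refine Finset.prod_ne_zero_iff.2 fun l hl => ?_
      have hl' := Finset.mem_range.1 hl
      have h1 := card_lt_of_lt hd hd1 hdα (by omega)
      have h2 : (l : ℝ) < M := by exact_mod_cast hl'
      intro h
      linarith
    · intro i _ hi
      rw [zero_pow (by omega), mul_zero]
    · simp
  have hminor : (A.submatrix (Fin.last M).succAbove (Fin.last M).succAbove).det ≠ 0 := by
    have hentry : A.submatrix (Fin.last M).succAbove (Fin.last M).succAbove =
        Matrix.of fun j k : Fin M => laguerreCoeff d n α k.castSucc j * ((j : ℕ).factorial : ℝ) := by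
      ext j k
      simp only [hA, redMat, Matrix.submatrix_apply, Matrix.of_apply, Fin.succAbove_last, excess,
        Fin.snoc_castSucc, Fin.val_castSucc, add_zero]
      have hdiag : diffWeight α k.castSucc j j = ((j : ℕ).factorial : ℝ) := by
        simp only [diffWeight, offset, Fin.snoc_castSucc, add_zero]
        rw [← descPochhammer_eval_eq_prod_range, descPochhammer_eval_eq_descFactorial,
          Nat.descFactorial_self]
      rw [Finset.sum_eq_single (j : ℕ)]
      · rw [hdiag, Nat.sub_self, pow_zero, mul_one]
      · intro i _ hi
        rcases lt_or_gt_of_ne hi with h | h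
        · rw [diffWeight_truncates α k.castSucc j i (by omega) (by simpa [excess] using h)]
          ring
        · rw [zero_pow (by omega), mul_zero]
      · intro hj
        rw [laguerreCoeff_eq_zero (by simpa [Nat.lt_succ_iff] using hj)]
        ring
    have hpos : ∀ j : ℕ, j + 1 < M → (j : ℝ) + 1 - α ≠ 0 := by
      intro j hj
      have h1 := card_lt_of_lt hd hd1 hdα (by omega)
      have h2 : (j : ℝ) + 1 < M := by exact_mod_cast hj
      intro h
      linarith
    have hdet := det_of_recursion
      (fun (k : Fin M) j => laguerreCoeff d n α k.castSucc j * (j.factorial : ℝ))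
      (fun k => -(d k : ℝ)) (fun j => -(j : ℝ)) (fun j => (j : ℝ) + 1 - α) hpos
      (fun k j hj => by
        have h1 : colParam M α k.castSucc + j + 1 = j + 1 - α := by
          simp only [colParam, Fin.snoc_castSucc]
          ring
        have h2 := laguerreCoeff_succ (d := d) (n := n) (α := α) (k := k.castSucc) (j := j)
          (by rw [h1]; exact hpos j hj)
        rw [h1] at h2
        simp only [colDeg, Fin.snoc_castSucc] at h2
        rw [Nat.factorial_succ]
        push_cast
        linear_combination (j.factorial : ℝ) * h2)
    rw [hentry, hdet]
    refine mul_ne_zero ?_ ?_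
    · simp [laguerreCoeff]
    · refine Finset.prod_ne_zero_iff.2 fun j _ => Finset.prod_ne_zero_iff.2 fun k hk => ?_
      have hjk : j < k := Finset.mem_Ioi.1 hk
      refine div_ne_zero ?_ ?_
      · intro h
        have : (d j : ℝ) = d k := by linarith
        exact hjk.ne (hd (by exact_mod_cast this))
      · exact hpos j (by have := k.2; have : (j : ℕ) < k := hjk; omega)
  rw [Matrix.det_succ_column A (Fin.last M), Finset.sum_eq_single (Fin.last M)]
  · exact mul_ne_zero (mul_ne_zero (pow_ne_zero _ (by norm_num)) hcorner) hminor
  · intro j _ hj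
    rw [hlast j hj]
    ring
  · simp

/-- The normalisation and all powers of `1 - q` released by `redMat_scale` are independent of `t`,
so they cancel in the ratio before the limit is taken. -/
theorem tendsto_lql_multiIndexed (hd : Function.Injective d) (hd1 : ∀ j, 1 ≤ d j)
    (hα : -1 < α) (hdα : ∀ j, (d j : ℝ) < α) (t : ℝ) :
    Tendsto (fun q : ℝ => ((littleQLaguerreSystem q).multiIndexed α d n).eval (1 - (1 - q) * t) /
        ((littleQLaguerreSystem q).multiIndexed α d n).eval 1)
      (𝓝[<] 1) (𝓝 ((redMat (colDeg d n) (laguerreCoeff d n α) (diffWeight α) t).det /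
        (redMat (colDeg d n) (laguerreCoeff d n α) (diffWeight α) 0).det)) := by
  have hnum := fun z => tendsto_redMat (colDeg d n)
    (fun k i hi => tendsto_lqlColCoeff (n := n) hα hdα k i hi)
    (fun k j i => tendsto_qWeight α k j i) z
  refine ((hnum t).div (hnum 0) (redMat_laguerre_zero_ne hd hd1 hdα)).congr' ?_
  filter_upwards [eventually_mem_unit] with q hq
  have hmi := (lql_multiIndexed (n := n) hq.1 hq.2 hd hα hdα).2
  have hlev := lql_levelProd_ne_zero (n := n) hq.1 hq.2 hd hdα
  have hq1 : (∏ j : Fin (M + 1), (q - 1) ^ (j : ℕ)) ≠ 0 :=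
    Finset.prod_ne_zero_iff.2 fun j _ => pow_ne_zero _ (sub_ne_zero.2 hq.2.ne)
  have hs : (∏ j : Fin (M + 1), (1 - q) ^ (j : ℕ)) ≠ 0 :=
    Finset.prod_ne_zero_iff.2 fun j _ => pow_ne_zero _ (sub_ne_zero.2 hq.2.ne')
  have hsM : (1 - q) ^ M ≠ 0 := pow_ne_zero _ (sub_ne_zero.2 hq.2.ne')
  have hc : (∏ k : Fin (M + 1), lqjCoeff q (q ^ colParam M α k) 0 (colDeg d n k) 0) ≠ 0 :=
    Finset.prod_ne_zero_iff.2 fun k _ => left_ne_zero_of_mul_eq_one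
      (lqjCoeff_zero_mul_sum_col (n := n) (b := 0) hq.1 hq.2 (by simp) hα hdα k)
  have hval : ∀ u : ℝ, ((littleQLaguerreSystem q).multiIndexed α d n).eval (1 - (1 - q) * u) =
      ((∏ j : Fin (M + 1), (q - 1) ^ (j : ℕ)) *
        (∏ k, lqjCoeff q (q ^ colParam M α k) 0 (colDeg d n k) 0) * (1 - q) ^ M /
        ((∏ j : Fin (M + 1), (1 - q) ^ (j : ℕ)) * (littleQLaguerreSystem q).levelProd α d n)) *
      (redMat (colDeg d n) (fun k i => (1 - q) ^ i * lqjColCoeff d n α 0 q k i)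
        (qWeight q α) u).det := by
    intro u
    have h1 := hmi ((1 - q) * u)
    have h2 := redMat_scale (colDeg d n) (lqjColCoeff d n α 0 q) (qWeight_truncates q α) (1 - q) u
    rw [div_mul_eq_mul_div, eq_div_iff (mul_ne_zero hs hlev)]
    linear_combination (∏ j : Fin (M + 1), (1 - q) ^ (j : ℕ)) * h1 +
      ((∏ j : Fin (M + 1), (q - 1) ^ (j : ℕ)) *
        (∏ k, lqjCoeff q (q ^ colParam M α k) 0 (colDeg d n k) 0)) * h2
  have h0 : ((littleQLaguerreSystem q).multiIndexed α d n).eval 1 =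
      ((littleQLaguerreSystem q).multiIndexed α d n).eval (1 - (1 - q) * 0) := by simp
  rw [h0, hval, hval, mul_div_mul_left]
  · rfl
  · exact div_ne_zero (mul_ne_zero (mul_ne_zero hq1 hc) hsM) (mul_ne_zero hs hlev)

end

section

/-! ### Wronskians of columns of powers -/

theorem iteratedDeriv_sum_rpow {N : ℕ} {c : ℕ → ℝ} {s a b : ℝ} {f : ℝ → ℝ}
    (hf : ∀ y, 0 < a + b * y → f y =
      ∑ i ∈ Finset.range (N + 1), c i * (a + b * y) ^ ((i : ℝ) + s)) (j : ℕ) :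
    ∀ y, 0 < a + b * y → iteratedDeriv j f y = b ^ j * ∑ i ∈ Finset.range (N + 1),
      c i * ((∏ l ∈ Finset.range j, ((i : ℝ) + s - l)) * (a + b * y) ^ ((i : ℝ) + s - j)) := by
  induction j with
  | zero =>
    intro y hy
    simpa using hf y hy
  | succ j ih =>
    intro y hy
    have hopen : IsOpen {y : ℝ | 0 < a + b * y} := isOpen_lt continuous_const (by fun_prop)
    have heq : iteratedDeriv j f =ᶠ[𝓝 y] fun y => b ^ j * ∑ i ∈ Finset.range (N + 1),
        c i * ((∏ l ∈ Finset.range j, ((i : ℝ) + s - l)) * (a + b * y) ^ ((i : ℝ) + s - j)) := by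
      filter_upwards [hopen.mem_nhds hy] with x hx using ih x hx
    rw [iteratedDeriv_succ, heq.deriv_eq]
    have hu : HasDerivAt (fun y : ℝ => a + b * y) b y := by
      simpa using ((hasDerivAt_id y).const_mul b).const_add a
    have hd : ∀ i : ℕ, HasDerivAt (fun y : ℝ => c i *
        ((∏ l ∈ Finset.range j, ((i : ℝ) + s - l)) * (a + b * y) ^ ((i : ℝ) + s - j)))
        (c i * ((∏ l ∈ Finset.range j, ((i : ℝ) + s - l)) *
          (b * ((i : ℝ) + s - j) * (a + b * y) ^ ((i : ℝ) + s - j - 1)))) y := fun i =>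
      ((hu.rpow_const (Or.inl hy.ne')).const_mul _).const_mul _
    rw [((HasDerivAt.fun_sum fun i _ => hd i).const_mul (b ^ j)).deriv, pow_succ, mul_assoc]
    congr 1
    rw [Finset.mul_sum]
    refine Finset.sum_congr rfl fun i _ => ?_
    rw [Finset.prod_range_succ, show (i : ℝ) + s - (j + 1 : ℕ) = i + s - j - 1 by push_cast; ring]
    ring

/-- Taking out the common `u ^ (-α)` changes the derivative weights into evaluations of `∏ (X - (α +
l))` at `i + offset`. These monic rows may be exchanged for `∏ (X - l)`, which gives `diffWeight`.
-/
theorem rpow_mul_wronskianDet {M : ℕ} {a b α : ℝ} {N : Fin (M + 1) → ℕ}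
    {c : Fin (M + 1) → ℕ → ℝ} {f : Fin (M + 1) → ℝ → ℝ}
    (hf : ∀ k y, 0 < a + b * y → f k y = ∑ i ∈ Finset.range (N k + 1),
      c k i * (a + b * y) ^ ((i : ℝ) + (offset M α k - α))) {y : ℝ} (hy : 0 < a + b * y) :
    (a + b * y) ^ ((α + 1) * M) * wronskianDet f y =
      (∏ j : Fin (M + 1), b ^ (j : ℕ)) * (redMat N c (diffWeight α) (a + b * y)).det := by
  set u := a + b * y with hu
  set l : Fin (M + 1) → ℝ[X] →ₗ[ℝ] ℝ := fun k =>
    nodeFun (N k) (c k) (fun i => (i : ℝ) + offset M α k) u with hl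
  set v : Fin (M + 1) → ℝ := fun k => u ^ (offset M α k - α - offset M α k) with hv
  have hentry : ∀ j k : Fin (M + 1), iteratedDeriv (j : ℕ) (f k) y =
      b ^ (j : ℕ) * ((u ^ (j : ℕ))⁻¹ * (u ^ (-α) * (u ^ offset M α k *
        l k (∏ i ∈ Finset.range (j : ℕ), (X - C (α + i)))))) := by
    intro j k
    rw [iteratedDeriv_sum_rpow (hf k) j y hy]
    congr 1
    simp only [hl, nodeFun_apply, Finset.mul_sum, eval_prod, eval_sub, eval_X, eval_C]
    refine Finset.sum_congr rfl fun i _ => ?_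
    have h1 : u ^ ((i : ℝ) + (offset M α k - α) - (j : ℕ)) =
        u ^ i * (u ^ offset M α k * (u ^ (-α) * (u ^ (j : ℕ))⁻¹)) := by
      rw [← Real.rpow_natCast u i, ← Real.rpow_natCast u j, ← Real.rpow_neg hy.le,
        ← Real.rpow_add hy, ← Real.rpow_add hy, ← Real.rpow_add hy]
      congr 1
      ring
    have h2 : ∏ l ∈ Finset.range (j : ℕ), ((i : ℝ) + (offset M α k - α) - l) =
        ∏ l ∈ Finset.range (j : ℕ), ((i : ℝ) + offset M α k - (α + l)) :=
      Finset.prod_congr rfl fun l _ => by ring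
    rw [h1, h2]
    ring
  have hW : wronskianDet f y = (∏ j : Fin (M + 1), b ^ (j : ℕ)) *
      ((∏ j : Fin (M + 1), (u ^ (j : ℕ))⁻¹) * ((∏ _j : Fin (M + 1), u ^ (-α)) *
        ((∏ k, u ^ offset M α k) * Matrix.det (Matrix.of fun j k : Fin (M + 1) =>
          l k (∏ i ∈ Finset.range (j : ℕ), (X - C (α + i))))))) := by
    rw [← Matrix.det_mul_row, ← Matrix.det_mul_row, ← Matrix.det_mul_column,
      ← Matrix.det_mul_column]
    rw [wronskianDet]
    congr 1
    ext j k
    exact hentry j k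
  have h2 := det_functional_monic l (fun j => ∏ i ∈ Finset.range j, (X - C (α + i)))
    (fun j => ∏ i ∈ Finset.range j, (X - C (i : ℝ)))
    (prodLinear_monic _) (prodLinear_natDegree _) (prodLinear_monic _) (prodLinear_natDegree _)
  have h3 : Matrix.det (Matrix.of fun j k : Fin (M + 1) =>
        l k (∏ i ∈ Finset.range (j : ℕ), (X - C (i : ℝ)))) =
      Matrix.det (Matrix.of fun j k : Fin (M + 1) =>
        ∑ i ∈ Finset.range (N k + 1), c k i * diffWeight α k j i * u ^ i) := by
    congr 1
    ext j k
    simp only [Matrix.of_apply, hl, nodeFun_apply, eval_prod, eval_sub, eval_X, eval_C]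
    refine Finset.sum_congr rfl fun i _ => ?_
    rw [diffWeight]
    ring
  have h4 := det_weighted_mul_pow N c (diffWeight_truncates α) u
  have h5 : (∏ j : Fin (M + 1), (u ^ (j : ℕ))⁻¹) * ∏ j : Fin (M + 1), u ^ (j : ℕ) = 1 := by
    rw [← Finset.prod_mul_distrib]
    exact Finset.prod_eq_one fun j _ => inv_mul_cancel₀ (pow_ne_zero _ hy.ne')
  -- Exponent count: `(α + 1) M - α (M + 1) + α = M`, the power required by `det_weighted_mul_pow`.
  have h6 : u ^ ((α + 1) * M) * (∏ _j : Fin (M + 1), u ^ (-α)) * (∏ k, u ^ offset M α k) =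
      u ^ M := by
    rw [Fin.prod_univ_castSucc (fun k => u ^ offset M α k)]
    simp only [offset, Fin.snoc_castSucc, Fin.snoc_last, Real.rpow_zero, Finset.prod_const,
      Finset.card_univ, Fintype.card_fin, one_pow, one_mul]
    rw [← Real.rpow_mul_natCast hy.le, ← Real.rpow_add hy, ← Real.rpow_add hy,
      ← Real.rpow_natCast u M]
    congr 1
    push_cast
    ring
  rw [hW, h2, h3]
  set D := Matrix.det (Matrix.of fun j k : Fin (M + 1) =>
        ∑ i ∈ Finset.range (N k + 1), c k i * diffWeight α k j i * u ^ i)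
  linear_combination ((∏ j : Fin (M + 1), b ^ (j : ℕ)) * (∏ j : Fin (M + 1), (u ^ (j : ℕ))⁻¹) * D) *
    h6 + ((∏ j : Fin (M + 1), b ^ (j : ℕ)) * (∏ j : Fin (M + 1), (u ^ (j : ℕ))⁻¹)) * h4 +
    ((∏ j : Fin (M + 1), b ^ (j : ℕ)) * (redMat N c (diffWeight α) u).det) * h5

/-! ### Classical Laguerre and Jacobi columns -/

theorem ascPochhammer_eval_succ_left (m : ℕ) (x : ℝ) :
    (ascPochhammer ℝ (m + 1)).eval x = x * (ascPochhammer ℝ m).eval (x + 1) := by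
  rw [ascPochhammer_succ_left]
  simp [eval_comp]

theorem ascPochhammer_eval_ne_zero {x : ℝ} (m : ℕ) (h : ∀ l < m, x + l ≠ 0) :
    (ascPochhammer ℝ m).eval x ≠ 0 := by
  induction m with
  | zero => simp
  | succ m ih =>
    rw [ascPochhammer_succ_eval]
    exact mul_ne_zero (ih fun l hl => h l (by omega)) (h m (by omega))

/-- The value `(s + 1)_n / n!` at `0` of the Laguerre polynomial. -/
def columnScale (s : ℝ) (n : ℕ) : ℝ := (ascPochhammer ℝ n).eval (s + 1) / n.factorial

theorem columnScale_ne_zero {s : ℝ} {n : ℕ} (hs : ∀ l < n, s + l + 1 ≠ 0) :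
    columnScale s n ≠ 0 :=
  div_ne_zero (ascPochhammer_eval_ne_zero n fun l hl => by
    have := hs l hl
    rwa [show s + 1 + l = s + l + 1 by ring]) (by positivity)

theorem laguerreL_coeff {s : ℝ} {n : ℕ} (hs : ∀ l < n, s + l + 1 ≠ 0) {k : ℕ} (hk : k ≤ n) :
    (ascPochhammer ℝ (n - k)).eval (s + k + 1) / ((n - k).factorial * k.factorial) * (-1) ^ k =
      columnScale s n * ∏ l ∈ Finset.range k, laguerreRatio s n l := by
  induction k with
  | zero => simp [columnScale]
  | succ k ih =>
    obtain ⟨m, rfl⟩ : ∃ m, n = k + 1 + m := ⟨n - (k + 1), by omega⟩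
    rw [Finset.prod_range_succ, ← mul_assoc, ← ih (by omega),
      show k + 1 + m - k = m + 1 by omega, show k + 1 + m - (k + 1) = m by omega,
      ascPochhammer_eval_succ_left, laguerreRatio]
    have h1 := hs k (by omega)
    have h2 : s + k + 1 + 1 = s + ((k + 1 : ℕ) : ℝ) + 1 := by push_cast; ring
    rw [h2, Nat.factorial_succ, Nat.factorial_succ]
    have h3 : ((k : ℝ) + 1) ≠ 0 := by positivity
    have h4 : ((m : ℝ) + 1) ≠ 0 := by positivity
    push_cast
    field_simp
    ring

theorem laguerreL_eq_sum {s : ℝ} {n : ℕ} (hs : ∀ l < n, s + l + 1 ≠ 0) (x : ℝ) :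
    laguerreL s n x = ∑ i ∈ Finset.range (n + 1),
      columnScale s n * (∏ l ∈ Finset.range i, laguerreRatio s n l) * x ^ i := by
  refine Finset.sum_congr rfl fun i hi => ?_
  rw [← laguerreL_coeff hs (by simpa [Nat.lt_succ_iff] using hi), neg_pow]
  ring

theorem jacobiP_coeff {s β : ℝ} {n : ℕ} (hs : ∀ l < n, s + l + 1 ≠ 0) {k : ℕ} (hk : k ≤ n) :
    (ascPochhammer ℝ k).eval (n + s + β + 1) * (ascPochhammer ℝ (n - k)).eval (s + k + 1) /
        ((n - k).factorial * k.factorial) * (-1) ^ k =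
      columnScale s n * ∏ l ∈ Finset.range k, jacobiRatio s β n l := by
  induction k with
  | zero => simp [columnScale]
  | succ k ih =>
    obtain ⟨m, rfl⟩ : ∃ m, n = k + 1 + m := ⟨n - (k + 1), by omega⟩
    rw [Finset.prod_range_succ, ← mul_assoc, ← ih (by omega),
      show k + 1 + m - k = m + 1 by omega, show k + 1 + m - (k + 1) = m by omega,
      ascPochhammer_eval_succ_left m (s + k + 1), ascPochhammer_succ_eval k, jacobiRatio]
    have h1 := hs k (by omega)
    have h2 : s + k + 1 + 1 = s + ((k + 1 : ℕ) : ℝ) + 1 := by push_cast; ring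
    rw [h2, Nat.factorial_succ, Nat.factorial_succ]
    have h3 : ((k : ℝ) + 1) ≠ 0 := by positivity
    have h4 : ((m : ℝ) + 1) ≠ 0 := by positivity
    push_cast
    field_simp
    ring

theorem jacobiP_eq_sum {s β : ℝ} {n : ℕ} (hs : ∀ l < n, s + l + 1 ≠ 0) (y : ℝ) :
    jacobiP s β n y = ∑ i ∈ Finset.range (n + 1),
      columnScale s n * (∏ l ∈ Finset.range i, jacobiRatio s β n l) *
        (1 / 2 + -1 / 2 * y) ^ i := by
  refine Finset.sum_congr rfl fun i hi => ?_
  rw [← jacobiP_coeff hs (by simpa [Nat.lt_succ_iff] using hi),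
    show (y - 1) / 2 = -1 * (1 / 2 + -1 / 2 * y) by ring, mul_pow]
  ring

variable {M : ℕ} {d : Fin M → ℕ} {n : ℕ} {α β : ℝ}

/-- The common factor of the classical multi-indexed polynomials and the determinants of normalised
columns. -/
def classicalScale (d : Fin M → ℕ) (n : ℕ) (α b : ℝ) : ℝ :=
  (∏ j : Fin (M + 1), b ^ (j : ℕ)) * ∏ k, columnScale (colParam M α k) (colDeg d n k)

theorem classicalScale_ne_zero (hα : -1 < α) (hd : ∀ j, (d j : ℝ) < α) {b : ℝ} (hb : b ≠ 0) :
    classicalScale d n α b ≠ 0 :=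
  mul_ne_zero (Finset.prod_ne_zero_iff.2 fun _ _ => pow_ne_zero _ hb)
    (Finset.prod_ne_zero_iff.2 fun k _ =>
      columnScale_ne_zero fun l hl => colParam_add_ne_zero hα hd k l hl)

theorem isMultiIndexedLaguerreII_iff (hα : -1 < α) (hd : ∀ j, (d j : ℝ) < α) (Q : ℝ[X]) :
    IsMultiIndexedLaguerreII (α + 1 / 2) d n Q ↔ ∀ y, 0 < y → Q.eval y =
      classicalScale d n α 1 *
        (redMat (colDeg d n) (laguerreCoeff d n α) (diffWeight α) y).det := by
  refine forall_congr' fun y => forall_congr' fun hy => ?_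
  have key := rpow_mul_wronskianDet (M := M) (a := 0) (b := 1) (α := α) (N := colDeg d n)
    (c := fun k i => columnScale (colParam M α k) (colDeg d n k) * laguerreCoeff d n α k i)
    (f := Fin.snoc (α := fun _ => ℝ → ℝ)
          (fun (j : Fin M) (y : ℝ) => y ^ (1 / 2 - (α + 1 / 2)) *
            laguerreL (1 / 2 - (α + 1 / 2)) (d j) y)
          (laguerreL (α + 1 / 2 - 1 / 2) n)) (fun k y hy => by
      have hs := colParam_add_ne_zero (n := n) hα hd k
      rw [zero_add, one_mul] at hy ⊢
      induction k using Fin.lastCases with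
      | last =>
        simp only [colParam, colDeg, Fin.snoc_last, offset] at hs ⊢
        rw [add_sub_cancel_right, laguerreL_eq_sum hs]
        simp [laguerreCoeff, colParam, colDeg]
      | cast k =>
        simp only [colParam, colDeg, Fin.snoc_castSucc, offset] at hs ⊢
        rw [show 1 / 2 - (α + 1 / 2) = -α by ring, laguerreL_eq_sum hs, Finset.mul_sum]
        refine Finset.sum_congr rfl fun i _ => ?_
        rw [zero_sub, Real.rpow_add hy, Real.rpow_natCast]
        simp only [laguerreCoeff, colParam, colDeg, Fin.snoc_castSucc]
        ring) (y := y) (by simpa using hy)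
  rw [zero_add, one_mul, redMat_mul_col, ← mul_assoc] at key
  rw [show (α + 1 / 2 + 1 / 2) * (M : ℝ) = (α + 1) * M by ring, key]
  rfl

theorem isMultiIndexedJacobiII_iff (hα : -1 < α) (hd : ∀ j, (d j : ℝ) < α) (Q : ℝ[X]) :
    IsMultiIndexedJacobiII (α + 1 / 2) (β + 1 / 2) d n Q ↔ ∀ y, -1 < y → y < 1 → Q.eval y =
      classicalScale d n α (-1 / 2) *
        (redMat (colDeg d n) (jacobiCoeff d n α β) (diffWeight α) ((1 - y) / 2)).det := by
  refine forall_congr' fun y => forall_congr' fun _ => forall_congr' fun hy => ?_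
  have hu : ∀ y : ℝ, (1 - y) / 2 = 1 / 2 + -1 / 2 * y := fun y => by ring
  have key := rpow_mul_wronskianDet (M := M) (a := 1 / 2) (b := -1 / 2) (α := α) (N := colDeg d n)
    (c := fun k i => columnScale (colParam M α k) (colDeg d n k) * jacobiCoeff d n α β k i)
    (f := Fin.snoc (α := fun _ => ℝ → ℝ)
          (fun (j : Fin M) (y : ℝ) =>
            ((1 - y) / 2) ^ (1 / 2 - (α + 1 / 2)) *
              jacobiP (1 / 2 - (α + 1 / 2)) (β + 1 / 2 - 1 / 2) (d j) y)
          (jacobiP (α + 1 / 2 - 1 / 2) (β + 1 / 2 - 1 / 2) n)) (fun k y hy => by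
      have hs := colParam_add_ne_zero (n := n) hα hd k
      induction k using Fin.lastCases with
      | last =>
        simp only [colParam, colDeg, Fin.snoc_last, offset] at hs ⊢
        rw [add_sub_cancel_right, jacobiP_eq_sum hs]
        simp [jacobiCoeff, colParam, colDeg]
      | cast k =>
        simp only [colParam, colDeg, Fin.snoc_castSucc, offset] at hs ⊢
        rw [show 1 / 2 - (α + 1 / 2) = -α by ring, jacobiP_eq_sum hs, Finset.mul_sum, hu]
        refine Finset.sum_congr rfl fun i _ => ?_
        rw [zero_sub, Real.rpow_add hy, Real.rpow_natCast]
        simp only [jacobiCoeff, colParam, colDeg, Fin.snoc_castSucc, add_sub_cancel_right]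
        ring) (y := y) (by rw [← hu]; linarith)
  rw [redMat_mul_col, ← mul_assoc, ← hu] at key
  rw [show (α + 1 / 2 + 1 / 2) * (M : ℝ) = (α + 1) * M by ring, key]
  rfl

theorem existsUnique_multiIndexedLaguerreII (hα : -1 < α) (hd : ∀ j, (d j : ℝ) < α) :
    (∃! Q : ℝ[X], IsMultiIndexedLaguerreII (α + 1 / 2) d n Q) ∧
      ∀ y, (multiIndexedLaguerreII (α + 1 / 2) d n).eval y = classicalScale d n α 1 *
        (redMat (colDeg d n) (laguerreCoeff d n α) (diffWeight α) y).det := by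
  obtain ⟨R, hR⟩ := exists_poly_redMat (colDeg d n) (laguerreCoeff d n α) (diffWeight α)
    (classicalScale d n α 1)
  have huniq : ∀ Q : ℝ[X], IsMultiIndexedLaguerreII (α + 1 / 2) d n Q → Q = R := fun Q hQ =>
    eq_of_infinite_eval_eq _ _ (Set.Infinite.mono
      (fun y hy => by
        rw [Set.mem_ofPred_eq, hR]
        exact (isMultiIndexedLaguerreII_iff hα hd Q).1 hQ y hy) (Set.Ioi_infinite (0 : ℝ)))
  have hRi : IsMultiIndexedLaguerreII (α + 1 / 2) d n R :=
    (isMultiIndexedLaguerreII_iff hα hd R).2 fun y _ => hR y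
  refine ⟨⟨R, hRi, huniq⟩, fun y => ?_⟩
  rw [← hR, multiIndexedLaguerreII, huniq _ (Classical.epsilon_spec ⟨R, hRi⟩)]

theorem existsUnique_multiIndexedJacobiII (hα : -1 < α) (hd : ∀ j, (d j : ℝ) < α) :
    (∃! Q : ℝ[X], IsMultiIndexedJacobiII (α + 1 / 2) (β + 1 / 2) d n Q) ∧
      ∀ z, (multiIndexedJacobiII (α + 1 / 2) (β + 1 / 2) d n).eval (1 - 2 * z) =
        classicalScale d n α (-1 / 2) *
          (redMat (colDeg d n) (jacobiCoeff d n α β) (diffWeight α) z).det := by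
  obtain ⟨R, hR⟩ := exists_poly_redMat (colDeg d n) (jacobiCoeff d n α β) (diffWeight α)
    (classicalScale d n α (-1 / 2))
  have hRe : ∀ y, (R.comp (C (1 / 2) * (1 - X))).eval y = R.eval ((1 - y) / 2) := by
    intro y
    rw [eval_comp]
    congr 1
    simp
    ring
  have huniq : ∀ Q : ℝ[X], IsMultiIndexedJacobiII (α + 1 / 2) (β + 1 / 2) d n Q →
      Q = R.comp (C (1 / 2) * (1 - X)) := fun Q hQ =>
    eq_of_infinite_eval_eq _ _ (Set.Infinite.mono
      (fun y hy => by
        rw [Set.mem_ofPred_eq, hRe, hR]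
        exact (isMultiIndexedJacobiII_iff hα hd Q).1 hQ y hy.1 hy.2)
      (Set.Ioo_infinite (show (-1 : ℝ) < 1 by norm_num)))
  have hRi : IsMultiIndexedJacobiII (α + 1 / 2) (β + 1 / 2) d n (R.comp (C (1 / 2) * (1 - X))) :=
    (isMultiIndexedJacobiII_iff hα hd _).2 fun y _ _ => by rw [hRe, hR]
  refine ⟨⟨_, hRi, huniq⟩, fun z => ?_⟩
  rw [multiIndexedJacobiII, huniq _ (Classical.epsilon_spec ⟨_, hRi⟩), hRe, ← hR]
  congr 1
  ring

/-! ### The two limits `q → 1` -/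

theorem littleQJacobi_to_jacobi (hd : Function.Injective d) (hα : -1 < α) (hβ : -1 < β)
    (hdα : ∀ j, (d j : ℝ) < α) (hαβ : ∀ j k, j ≠ k → α - β ≠ d j + d k + 1) :
    (∀ q : ℝ, 0 < q → q < 1 →
        ∃! Q : ℝ[X], (littleQJacobiSystem q).IsMultiIndexed (α, β) d n Q) ∧
      (∃! Q : ℝ[X], IsMultiIndexedJacobiII (α + 1 / 2) (β + 1 / 2) d n Q) ∧
      (multiIndexedJacobiII (α + 1 / 2) (β + 1 / 2) d n).eval (-1) ≠ 0 ∧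
      ∀ η : ℝ,
        Tendsto
          (fun q : ℝ => ((littleQJacobiSystem q).multiIndexed (α, β) d n).eval (1 - η))
          (𝓝[<] 1)
          (𝓝 ((multiIndexedJacobiII (α + 1 / 2) (β + 1 / 2) d n).eval (1 - 2 * η) /
            (multiIndexedJacobiII (α + 1 / 2) (β + 1 / 2) d n).eval (-1))) := by
  obtain ⟨hex, hval⟩ := existsUnique_multiIndexedJacobiII (n := n) (β := β) hα hdα
  have hlim := tendsto_lqj_multiIndexed (n := n) hd hα hβ hdα hαβ
  have hsc : classicalScale d n α (-1 / 2) ≠ 0 := classicalScale_ne_zero hα hdα (by norm_num)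
  have h1 : (multiIndexedJacobiII (α + 1 / 2) (β + 1 / 2) d n).eval (-1) =
      classicalScale d n α (-1 / 2) *
        (redMat (colDeg d n) (jacobiCoeff d n α β) (diffWeight α) 1).det := by
    rw [← hval]
    norm_num
  refine ⟨fun q hq hq1 => (lqj_multiIndexed hq hq1 hd hα hβ hdα hαβ).1, hex, ?_, fun z => ?_⟩
  · rw [h1]
    exact mul_ne_zero hsc (hlim 0).1
  · rw [h1, hval, mul_div_mul_left _ _ hsc]
    exact (hlim z).2

theorem littleQLaguerre_to_laguerre (hd : Function.Injective d) (hd1 : ∀ j, 1 ≤ d j)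
    (hα : -1 < α) (hdα : ∀ j, (d j : ℝ) < α) :
    (∀ q : ℝ, 0 < q → q < 1 →
        ∃! Q : ℝ[X], (littleQLaguerreSystem q).IsMultiIndexed α d n Q) ∧
      (∃! Q : ℝ[X], IsMultiIndexedLaguerreII (α + 1 / 2) d n Q) ∧
      (multiIndexedLaguerreII (α + 1 / 2) d n).eval 0 ≠ 0 ∧
      ∀ η : ℝ,
        Tendsto
          (fun q : ℝ =>
            ((littleQLaguerreSystem q).multiIndexed α d n).eval (1 - (1 - q) * η) /
              ((littleQLaguerreSystem q).multiIndexed α d n).eval 1)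
          (𝓝[<] 1)
          (𝓝 ((multiIndexedLaguerreII (α + 1 / 2) d n).eval η /
            (multiIndexedLaguerreII (α + 1 / 2) d n).eval 0)) := by
  obtain ⟨hex, hval⟩ := existsUnique_multiIndexedLaguerreII (n := n) hα hdα
  have hsc : classicalScale d n α 1 ≠ 0 := classicalScale_ne_zero hα hdα one_ne_zero
  refine ⟨fun q hq hq1 => (lql_multiIndexed hq hq1 hd hα hdα).1, hex, ?_, fun z => ?_⟩
  · rw [hval]
    exact mul_ne_zero hsc (redMat_laguerre_zero_ne hd hd1 hdα)
  · rw [hval, hval, mul_div_mul_left _ _ hsc]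
    exact tendsto_lql_multiIndexed hd hd1 hα hdα z

end

section

/-! ### Newton series and the Meixner system -/

/-- The value at `t` of the Newton series with step `h` whose coefficients are those of a
polynomial. -/
def newtonEval (h t : ℝ) : ℝ[X] →ₗ[ℝ] ℝ :=
  Polynomial.lsum fun i => LinearMap.toSpanSingleton ℝ ℝ (∏ l ∈ Finset.range i, (t - l * h))

theorem newtonEval_monomial (h t : ℝ) (i : ℕ) (a : ℝ) :
    newtonEval h t (monomial i a) = a * ∏ l ∈ Finset.range i, (t - l * h) := by
  rw [newtonEval, lsum_apply, sum_monomial_index _ _ (by simp)]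
  simp

theorem newtonEval_eq_sum (h t : ℝ) {N : ℕ} {A : ℝ[X]} (hA : A.natDegree < N + 1) :
    newtonEval h t A =
      ∑ i ∈ Finset.range (N + 1), A.coeff i * ∏ l ∈ Finset.range i, (t - l * h) := by
  conv_lhs => rw [A.as_sum_range' (N + 1) hA, map_sum]
  exact Finset.sum_congr rfl fun i _ => newtonEval_monomial h t i _

/-- The operator `κ D - ε` on polynomials. -/
def diffOp (κ ε : ℝ) : Module.End ℝ ℝ[X] := κ • derivative - ε • 1

theorem diffOp_apply (κ ε : ℝ) (A : ℝ[X]) : diffOp κ ε A = κ • derivative A - ε • A := rfl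

/-- On falling factorials of step `h`, the forward difference is `h` times the formal derivative of
the coefficient polynomial. -/
theorem newtonEval_add_step (h t : ℝ) (A : ℝ[X]) :
    newtonEval h (t + h) A = newtonEval h t (A + h • derivative A) := by
  induction A using Polynomial.induction_on' with
  | add p r hp hr =>
    rw [map_add, hp, hr, ← map_add, derivative_add]
    congr 1
    module
  | monomial i a =>
    rw [map_add, map_smul, derivative_monomial, newtonEval_monomial, newtonEval_monomial,
      newtonEval_monomial]
    cases i with
    | zero => simp
    | succ i =>
      rw [Finset.prod_range_succ', Finset.prod_range_succ]
      have : ∏ l ∈ Finset.range i, (t + h - ((l + 1 : ℕ) : ℝ) * h) =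
          ∏ l ∈ Finset.range i, (t - l * h) :=
        Finset.prod_congr rfl fun l _ => by push_cast; ring
      rw [this]
      simp only [Nat.add_sub_cancel, smul_eq_mul]
      push_cast
      ring

/-- The weighted shift `κ (1 + h D)` is `1 + h (κ D - ε)`, which is where the operator `diffOp`
comes from. -/
theorem newtonEval_add_mul_step {h κ ε : ℝ} (hκ : 1 - h * ε = κ) (t : ℝ) (A : ℝ[X]) (j : ℕ) :
    κ ^ j * newtonEval h (t + j * h) A = newtonEval h t (((1 + h • diffOp κ ε) ^ j) A) := by
  induction j generalizing A with
  | zero => simp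
  | succ j ih =>
    rw [pow_succ (1 + h • diffOp κ ε), Module.End.mul_apply, ← ih,
      show t + ((j + 1 : ℕ) : ℝ) * h = t + j * h + h by push_cast; ring, newtonEval_add_step]
    have : (1 + h • diffOp κ ε) A = κ • (A + h • derivative A) := by
      rw [LinearMap.add_apply, LinearMap.smul_apply, diffOp_apply, Module.End.one_apply, ← hκ]
      module
    rw [this, map_smul, smul_eq_mul, pow_succ]
    ring

/-- The confluent hypergeometric polynomial `₁F₁(-v; α + 1; σ X)`. -/
def confluentPoly (α : ℝ) (v : ℕ) (σ : ℝ) : ℝ[X] :=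
  ∑ i ∈ Finset.range (v + 1), monomial i (σ ^ i * ∏ l ∈ Finset.range i, laguerreRatio α v l)

theorem confluentPoly_coeff (α : ℝ) (v : ℕ) (σ : ℝ) (i : ℕ) :
    (confluentPoly α v σ).coeff i = σ ^ i * ∏ l ∈ Finset.range i, laguerreRatio α v l := by
  rw [confluentPoly, finsetSum_coeff]
  simp only [coeff_monomial]
  rw [Finset.sum_ite_eq' (Finset.range (v + 1)) i]
  split_ifs with h
  · rfl
  · rw [Finset.prod_eq_zero (i := v) (by simp at h ⊢; omega) (by simp [laguerreRatio]), mul_zero]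

theorem confluentPoly_natDegree_lt (α : ℝ) (v : ℕ) (σ : ℝ) :
    (confluentPoly α v σ).natDegree < v + 1 := by
  refine Nat.lt_succ_of_le (natDegree_sum_le_of_forall_le _ _ fun i hi => ?_)
  exact (natDegree_monomial_le _).trans (by simpa [Nat.lt_succ_iff] using hi)

/-- Kummer's equation in the variable `σ X`. -/
theorem confluentPoly_ode {α : ℝ} (hα : -1 < α) (v : ℕ) (σ : ℝ) :
    X * derivative (derivative (confluentPoly α v σ)) +
      (C (α + 1) - C σ * X) * derivative (confluentPoly α v σ) +
      C (σ * v) * confluentPoly α v σ = 0 := by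
  ext i
  have hrec : ((i : ℝ) + 1) * (α + i + 1) * (confluentPoly α v σ).coeff (i + 1) =
      σ * (i - v) * (confluentPoly α v σ).coeff i := by
    have h0 : (0 : ℝ) ≤ i := i.cast_nonneg
    have h1 : (i : ℝ) + 1 ≠ 0 := by positivity
    have h2 : α + i + 1 ≠ 0 := by
      intro h
      linarith
    rw [confluentPoly_coeff, confluentPoly_coeff, Finset.prod_range_succ, laguerreRatio]
    field_simp
    ring
  have e1 : (C (α + 1) - C σ * X) * derivative (confluentPoly α v σ) =
      C (α + 1) * derivative (confluentPoly α v σ) -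
        C σ * (X * derivative (confluentPoly α v σ)) := by ring
  rw [e1]
  cases i with
  | zero =>
    simp only [coeff_add, coeff_sub, coeff_C_mul, coeff_X_mul_zero, coeff_derivative, coeff_zero]
    push_cast at hrec ⊢
    linear_combination hrec
  | succ i =>
    simp only [coeff_add, coeff_sub, coeff_C_mul, coeff_X_mul, coeff_derivative, coeff_zero]
    push_cast at hrec ⊢
    linear_combination hrec

theorem ascPochhammer_div_eq_prod {α : ℝ} (hα : -1 < α) (v k : ℕ) :
    (ascPochhammer ℝ k).eval (-(v : ℝ)) / ((ascPochhammer ℝ k).eval (α + 1) * k.factorial) =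
      ∏ l ∈ Finset.range k, laguerreRatio α v l := by
  induction k with
  | zero => simp
  | succ k ih =>
    have h0 : (0 : ℝ) ≤ k := k.cast_nonneg
    have h1 : (k : ℝ) + 1 ≠ 0 := by positivity
    have h2 : α + k + 1 ≠ 0 := by
      intro h
      linarith
    have h3 : α + 1 + k ≠ 0 := by
      intro h
      linarith
    have h4 : (ascPochhammer ℝ k).eval (α + 1) ≠ 0 :=
      (ascPochhammer_pos k _ (by linarith)).ne'
    rw [Finset.prod_range_succ, ← ih, ascPochhammer_succ_eval, ascPochhammer_succ_eval,
      Nat.factorial_succ, laguerreRatio, show α + k + 1 = α + 1 + k by ring]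
    push_cast
    field_simp
    ring

theorem meixner_eq_newtonEval {α c h σ : ℝ} (hα : -1 < α) (hc : 1 - c⁻¹ = -(h * σ)) (v : ℕ)
    (x : ℝ) : meixner (α + 1) c v x = newtonEval h (h * x) (confluentPoly α v σ) := by
  rw [newtonEval_eq_sum _ _ (confluentPoly_natDegree_lt α v σ), meixner]
  refine Finset.sum_congr rfl fun k _ => ?_
  rw [confluentPoly_coeff, ← ascPochhammer_div_eq_prod hα, hc, neg_pow, mul_pow]
  have hprod : (-1) ^ k * h ^ k * (ascPochhammer ℝ k).eval (-x) =
      ∏ l ∈ Finset.range k, (h * x - l * h) := by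
    have : (-1) ^ k * h ^ k = ∏ _l ∈ Finset.range k, (-h) := by
      rw [← mul_pow, Finset.prod_const, Finset.card_range]
      ring
    rw [this]
    have heval : (ascPochhammer ℝ k).eval (-x) = ∏ l ∈ Finset.range k, (-x + l) := by
      clear * -
      induction k with
      | zero => simp
      | succ k ih => rw [Finset.prod_range_succ, ascPochhammer_succ_eval, ih]
    rw [heval, ← Finset.prod_mul_distrib]
    exact Finset.prod_congr rfl fun l _ => by ring
  rw [← hprod]
  ring

/-! ### The Meixner columns and their limit -/

/-- The coefficients `κ` in the operators of the columns. -/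
def colKappa (M : ℕ) (c : ℝ) : Fin (M + 1) → ℝ := Fin.snoc (α := fun _ => ℝ) (fun _ => 1) c

/-- The arguments `σ` of the confluent hypergeometric columns. -/
def colSigma (M : ℕ) (s : ℝ) : Fin (M + 1) → ℝ := Fin.snoc (α := fun _ => ℝ) (fun _ => -1) s

variable {M : ℕ} {d : Fin M → ℕ} {n : ℕ} {α : ℝ}

/-- The matrix of iterated difference quotients of the Meixner columns. -/
def meixnerMat (d : Fin M → ℕ) (n : ℕ) (α c t : ℝ) : Matrix (Fin (M + 1)) (Fin (M + 1)) ℝ :=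
  Matrix.of fun j k => newtonEval (1 - c) t
    ((diffOp (colKappa M c k) (offset M 1 k) ^ (j : ℕ))
      (confluentPoly α (colDeg d n k) (colSigma M c⁻¹ k)))

/-- The matrix of iterated derivatives of the limiting Laguerre columns. -/
def laguerreMat (d : Fin M → ℕ) (n : ℕ) (α t : ℝ) : Matrix (Fin (M + 1)) (Fin (M + 1)) ℝ :=
  Matrix.of fun j k => ((diffOp 1 (offset M 1 k) ^ (j : ℕ))
      (confluentPoly α (colDeg d n k) (colSigma M 1 k))).eval t

/-- The functional `p ↦ l (p(S) A)`. -/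
def opFun (l : ℝ[X] →ₗ[ℝ] ℝ) (S : Module.End ℝ ℝ[X]) (A : ℝ[X]) : ℝ[X] →ₗ[ℝ] ℝ :=
  l ∘ₗ LinearMap.applyₗ A ∘ₗ (aeval S).toLinearMap

theorem opFun_apply (l : ℝ[X] →ₗ[ℝ] ℝ) (S : Module.End ℝ ℝ[X]) (A p : ℝ[X]) :
    opFun l S A p = l (aeval S p A) := rfl

/-- In column `k` the shift acts as `S k = 1 + (1 - c) diffOp`. Exchanging `X ^ j` for `(X - 1) ^ j`
leaves `(1 - c) ^ j` times a power of `diffOp`. -/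
theorem casoratian_meixner {c : ℝ} (hc : 0 < c) (hα : -1 < α) (x : ℝ) :
    casoratian
        (Fin.snoc (α := fun _ => ℝ → ℝ) (fun j : Fin M => meixnerSystem.xi (α + 1, c) (d j))
          (fun y => meixnerSystem.nu (α + 1, c) y * meixnerSystem.P (α + 1, c) n y)) x =
      c ^ x * ((∏ j : Fin (M + 1), (1 - c) ^ (j : ℕ)) *
        (meixnerMat d n α c ((1 - c) * x)).det) := by
  set S : Fin (M + 1) → Module.End ℝ ℝ[X] := fun k =>
    1 + (1 - c) • diffOp (colKappa M c k) (offset M 1 k) with hS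
  set l : Fin (M + 1) → ℝ[X] →ₗ[ℝ] ℝ := fun k =>
    opFun (newtonEval (1 - c) ((1 - c) * x)) (S k)
      (confluentPoly α (colDeg d n k) (colSigma M c⁻¹ k)) with hl
  have hκ : ∀ k, 1 - (1 - c) * offset M 1 k = colKappa M c k := by
    intro k
    induction k using Fin.lastCases <;> simp [offset, colKappa]
  have hcol : ∀ j k : Fin (M + 1), l k (X ^ (j : ℕ)) = colKappa M c k ^ (j : ℕ) *
      newtonEval (1 - c) ((1 - c) * (x + (j : ℕ)))
        (confluentPoly α (colDeg d n k) (colSigma M c⁻¹ k)) := by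
    intro j k
    simp only [hl, opFun_apply, map_pow, aeval_X, hS]
    rw [← newtonEval_add_mul_step (hκ k),
      show (1 - c) * x + ((j : ℕ) : ℝ) * (1 - c) = (1 - c) * (x + (j : ℕ)) by ring]
  set v : Fin (M + 1) → ℝ := Fin.snoc (α := fun _ => ℝ) (fun _ => 1) (c ^ x) with hv
  have hvprod : ∏ k, v k = c ^ x := by
    rw [Fin.prod_univ_castSucc]
    simp [hv]
  have h1 : casoratian
        (Fin.snoc (α := fun _ => ℝ → ℝ) (fun j : Fin M => meixnerSystem.xi (α + 1, c) (d j))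
          (fun y => meixnerSystem.nu (α + 1, c) y * meixnerSystem.P (α + 1, c) n y)) x =
      c ^ x * Matrix.det (Matrix.of fun j k => l k (X ^ (j : ℕ))) := by
    rw [← hvprod, ← Matrix.det_mul_row, casoratian]
    congr 1
    ext j k
    simp only [Matrix.of_apply, hcol]
    induction k using Fin.lastCases with
    | last =>
      simp only [Fin.snoc_last, hv, colKappa, colDeg, colSigma, meixnerSystem]
      -- Here `1 - c⁻¹ = -(1 - c) c⁻¹`; for the twisted parameter `c⁻¹` the argument is `1 - c`,
      -- hence `σ = -1` in the virtual columns.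
      rw [meixner_eq_newtonEval (h := 1 - c) (σ := c⁻¹) hα (by field_simp; ring),
        Real.rpow_add hc, Real.rpow_natCast]
      ring
    | cast k =>
      simp only [Fin.snoc_castSucc, hv, colKappa, colDeg, colSigma, meixnerSystem,
        ShiftSystem.xi]
      rw [meixner_eq_newtonEval (h := 1 - c) (σ := -1) hα (by rw [inv_inv]; ring), one_pow,
        one_mul, one_mul]
  have h2 := det_functional_monic l (fun j => X ^ j) (fun j => ∏ _i ∈ Finset.range j, (X - C 1))
    (fun j => monic_X_pow j) (fun j => natDegree_X_pow j)
    (prodLinear_monic fun _ => 1) (prodLinear_natDegree fun _ => 1)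
  have h3 : Matrix.det (Matrix.of fun j k : Fin (M + 1) =>
        l k (∏ _i ∈ Finset.range (j : ℕ), (X - C 1))) =
      (∏ j : Fin (M + 1), (1 - c) ^ (j : ℕ)) * (meixnerMat d n α c ((1 - c) * x)).det := by
    rw [← Matrix.det_mul_column]
    congr 1
    ext j k
    simp only [Matrix.of_apply, hl, opFun_apply, meixnerMat]
    have : aeval (S k) (∏ _i ∈ Finset.range (j : ℕ), (X - C (1 : ℝ))) =
        (1 - c) ^ (j : ℕ) • diffOp (colKappa M c k) (offset M 1 k) ^ (j : ℕ) := by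
      rw [Finset.prod_const, Finset.card_range, map_pow, map_sub, aeval_X, aeval_C, map_one,
        ← _root_.smul_pow]
      congr 1
      simp [hS]
    rw [this, LinearMap.smul_apply, map_smul, smul_eq_mul]
  rw [h1, h2, h3]

/-! ### Existence, normalisation and limit of the Meixner determinants -/

theorem exists_poly_det {m : ℕ} {G : ℝ → Matrix (Fin m) (Fin m) ℝ}
    (h : ∀ j k, ∃ P : ℝ[X], ∀ t, P.eval t = G t j k) (K : ℝ) :
    ∃ Q : ℝ[X], ∀ t, Q.eval t = K * (G t).det := by
  choose P hP using h
  refine ⟨C K * Matrix.det (Matrix.of P), fun t => ?_⟩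
  rw [eval_mul, eval_C, ← coe_evalRingHom, RingHom.map_det]
  congr 2
  ext j k
  simp [hP]

theorem exists_poly_newtonEval (h : ℝ) (A : ℝ[X]) : ∃ P : ℝ[X], ∀ t, P.eval t = newtonEval h t A := by
  refine ⟨∑ i ∈ Finset.range (A.natDegree + 1),
    C (A.coeff i) * ∏ l ∈ Finset.range i, (X - C (l * h)), fun t => ?_⟩
  rw [newtonEval_eq_sum h t (Nat.lt_succ_self _)]
  simp [eval_finsetSum, eval_prod]

/-- The limit of the normalisation constants of the Meixner system. -/
def meixnerConst (d : Fin M → ℕ) (n : ℕ) (α : ℝ) : ℝ :=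
  ∏ j : Fin (M + 1), ∏ k ∈ Finset.Ioi j,
    ((Fin.snoc (α := fun _ => ℝ) (fun i : Fin M => (d i : ℝ)) (-(α + 1 + n)) : Fin (M + 1) → ℝ) k -
      (Fin.snoc (α := fun _ => ℝ) (fun i : Fin M => (d i : ℝ)) (-(α + 1 + n)) :
        Fin (M + 1) → ℝ) j) / (α + 1 + j)

theorem meixnerConst_ne_zero (hd : Function.Injective d) (hα : -1 < α) :
    meixnerConst d n α ≠ 0 := by
  refine Finset.prod_ne_zero_iff.2 fun j _ => Finset.prod_ne_zero_iff.2 fun k hk => div_ne_zero ?_ ?_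
  · have hjk : j < k := Finset.mem_Ioi.1 hk
    induction j using Fin.lastCases with
    | last => exact absurd hjk (Fin.le_last k).not_gt
    | cast j =>
      induction k using Fin.lastCases with
      | last =>
        simp only [Fin.snoc_last, Fin.snoc_castSucc]
        have h1 : (0 : ℝ) ≤ d j := (d j).cast_nonneg
        have h2 : (0 : ℝ) ≤ n := n.cast_nonneg
        intro h
        linarith
      | cast k =>
        simp only [Fin.snoc_castSucc]
        rw [sub_ne_zero]
        exact_mod_cast fun h => hjk.ne (by rw [hd h])
  · have : (0 : ℝ) ≤ (j : ℕ) := Nat.cast_nonneg _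
    intro h
    linarith

theorem meixner_phiAux (m : ℕ) (x : ℝ) : meixnerSystem.phiAux m x = 1 := by
  refine Finset.prod_eq_one fun j _ => Finset.prod_eq_one fun k hk => ?_
  have hlt : j < k := Finset.mem_Ioi.1 hk
  have hjk : (j : ℕ) < k := hlt
  have : ((k : ℕ) : ℝ) - (j : ℕ) ≠ 0 := sub_ne_zero.2 (by exact_mod_cast hjk.ne')
  simp only [meixnerSystem]
  rw [add_sub_add_left_eq_sub, div_self this]

/-- All levels are affine in `d_j` or `-(α + 1 + n)` with the common slope `-(1 - c)`, so each pair
contributes one factor `1 - c` and the rest does not depend on `c`. -/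
theorem meixner_constDn {c : ℝ} (hc : 0 < c) :
    meixnerSystem.constDn (α + 1, c) d n =
      (∏ j : Fin (M + 1), (1 - c) ^ (j : ℕ)) * meixnerConst d n α := by
  have h := meixnerSystem.constDn_mul_phiAux (α + 1, c) d n (by simp [meixner_phiAux])
    (by simp [meixner_phiAux])
  rw [meixner_phiAux, mul_one] at h
  rw [h, ← prod_pairs_const, meixnerConst, ShiftSystem.levelProd, ← Finset.prod_mul_distrib]
  refine Finset.prod_congr rfl fun j _ => ?_
  rw [← Finset.prod_mul_distrib]
  refine Finset.prod_congr rfl fun k _ => ?_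
  have hlev : ∀ k : Fin (M + 1), meixnerSystem.levels (α + 1, c) d n k =
      -((1 - c) * ((Fin.snoc (α := fun _ => ℝ) (fun i : Fin M => (d i : ℝ)) (-(α + 1 + n)) :
        Fin (M + 1) → ℝ) k + (α + 1))) := by
    intro k
    induction k using Fin.lastCases with
    | last =>
      simp only [ShiftSystem.levels, Fin.snoc_last, meixnerSystem]
      ring
    | cast k =>
      simp only [ShiftSystem.levels, Fin.snoc_castSucc, meixnerSystem, ShiftSystem.virtualEnergy]
      field_simp
      ring
  have hB : meixnerSystem.alphaB' (α + 1, c) ((j : ℕ) : ℝ) = α + 1 + j := by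
    simp only [ShiftSystem.alphaB', meixnerSystem]
    field_simp
    ring
  rw [hlev, hlev, hB]
  ring

theorem meixner_multiIndexed (hd : Function.Injective d) (hα : -1 < α) {c : ℝ} (hc : 0 < c)
    (hc1 : c < 1) :
    (∃! Q : ℝ[X], meixnerSystem.IsMultiIndexed (α + 1, c) d n Q) ∧
      ∀ x, (meixnerSystem.multiIndexed (α + 1, c) d n).eval x =
        (meixnerMat d n α c ((1 - c) * x)).det / meixnerConst d n α := by
  have hK := meixnerConst_ne_zero (n := n) hd hα
  have hp : (∏ j : Fin (M + 1), (1 - c) ^ (j : ℕ)) ≠ 0 :=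
    Finset.prod_ne_zero_iff.2 fun j _ => pow_ne_zero _ (sub_ne_zero.2 hc1.ne')
  have key : ∀ (Q : ℝ[X]), meixnerSystem.IsMultiIndexed (α + 1, c) d n Q ↔
      ∀ x, Q.eval x = (meixnerMat d n α c ((1 - c) * x)).det / meixnerConst d n α := by
    intro Q
    refine forall_congr' fun x => ?_
    have hcx : c ^ x ≠ 0 := (Real.rpow_pos_of_pos hc x).ne'
    rw [casoratian_meixner hc hα, meixner_constDn hc, meixner_phiAux, mul_one, eq_div_iff hK]
    simp only [meixnerSystem]
    constructor
    · intro h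
      refine mul_left_cancel₀ (mul_ne_zero hcx hp) ?_
      linear_combination -h
    · intro h
      linear_combination (-(c ^ x * ∏ j : Fin (M + 1), (1 - c) ^ (j : ℕ))) * h
  have hex : ∃! Q : ℝ[X], meixnerSystem.IsMultiIndexed (α + 1, c) d n Q := by
    obtain ⟨R, hR⟩ := exists_poly_det (G := meixnerMat d n α c)
      (fun j k => exists_poly_newtonEval _ _) (meixnerConst d n α)⁻¹
    refine ⟨R.comp (C (1 - c) * X), (key _).2 fun x => ?_, fun Q hQ => Polynomial.funext fun x => ?_⟩
    · rw [eval_comp, hR]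
      simp only [eval_mul, eval_C, eval_X]
      ring
    · rw [(key _).1 hQ, eval_comp, hR]
      simp only [eval_mul, eval_C, eval_X]
      ring
  exact ⟨hex, (key _).1 (meixnerSystem.isMultiIndexed_multiIndexed hex)⟩

/-- A degree bound uniform in `c`, so that the limit can be taken in a sum of fixed length. -/
theorem diffOp_pow_natDegree_lt {κ ε : ℝ} {A : ℝ[X]} {N : ℕ} (hA : A.natDegree < N + 1) (j : ℕ) :
    ((diffOp κ ε ^ j) A).natDegree < N + 1 := by
  induction j with
  | zero => simpa using hA
  | succ j ih =>
    rw [pow_succ', Module.End.mul_apply, diffOp_apply]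
    refine Nat.lt_succ_of_le ((natDegree_sub_le _ _).trans (max_le ?_ ?_))
    · exact (natDegree_smul_le _ _).trans ((natDegree_derivative_le _).trans (by omega))
    · exact (natDegree_smul_le _ _).trans (by omega)

theorem tendsto_diffOp_pow_coeff {l : Filter ℝ} {κ : ℝ → ℝ} {κ' ε : ℝ} {A : ℝ → ℝ[X]} {A' : ℝ[X]}
    (hκ : Tendsto κ l (𝓝 κ')) (hA : ∀ i, Tendsto (fun c => (A c).coeff i) l (𝓝 (A'.coeff i)))
    (j i : ℕ) : Tendsto (fun c => ((diffOp (κ c) ε ^ j) (A c)).coeff i) l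
      (𝓝 (((diffOp κ' ε ^ j) A').coeff i)) := by
  induction j generalizing i with
  | zero => simpa using hA i
  | succ j ih =>
    simp only [pow_succ', Module.End.mul_apply, diffOp_apply, coeff_sub, coeff_smul, smul_eq_mul,
      coeff_derivative]
    exact (hκ.mul ((ih (i + 1)).mul_const _)).sub ((ih i).const_mul _)

theorem tendsto_meixnerMat (t : ℝ) :
    Tendsto (fun c => (meixnerMat d n α c t).det) (𝓝[<] 1) (𝓝 (laguerreMat d n α t).det) := by
  have hid : Tendsto (fun c : ℝ => c) (𝓝[<] 1) (𝓝 1) := tendsto_nhdsWithin_of_tendsto_nhds tendsto_id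
  refine tendsto_det fun j k => ?_
  simp only [meixnerMat, laguerreMat, Matrix.of_apply]
  set N := colDeg d n k
  have hdeg : ∀ κ σ : ℝ, ((diffOp κ (offset M 1 k) ^ (j : ℕ)) (confluentPoly α N σ)).natDegree <
      N + 1 := fun κ σ => diffOp_pow_natDegree_lt (confluentPoly_natDegree_lt α N σ) j
  rw [eval_eq_sum_range' (hdeg _ _)]
  simp only [fun c t => newtonEval_eq_sum (1 - c) t (hdeg (colKappa M c k) (colSigma M c⁻¹ k))]
  refine tendsto_finsetSum _ fun i _ => Tendsto.mul ?_ ?_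
  · refine tendsto_diffOp_pow_coeff ?_ (fun i => ?_) j i
    · induction k using Fin.lastCases with
      | last => simpa [colKappa] using hid
      | cast k => simp [colKappa]
    · simp only [confluentPoly_coeff]
      refine Tendsto.mul_const _ (Tendsto.pow ?_ i)
      induction k using Fin.lastCases with
      | last => simpa [colSigma] using hid.inv₀ one_ne_zero
      | cast k => simp [colSigma]
  · have h : Tendsto (fun c : ℝ => ∏ l ∈ Finset.range i, (t - l * (1 - c))) (𝓝[<] 1)
        (𝓝 (∏ l ∈ Finset.range i, (t - l * (1 - 1)))) :=
      tendsto_finsetProd _ fun l _ => ((hid.const_sub 1).const_mul _).const_sub t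
    simpa using h

/-- Each application of `D - ε` differentiates the coefficients `X` and `C β + X` once, raising both
constants by one. -/
theorem diffOp_confluent_ode {ε β C₀ : ℝ} {A : ℝ[X]}
    (h0 : X * (diffOp 1 ε ^ 2) A + (C β + X) * diffOp 1 ε A + C C₀ * A = 0) (j : ℕ) :
    X * (diffOp 1 ε ^ (j + 2)) A + (C (β + j) + X) * (diffOp 1 ε ^ (j + 1)) A +
      C (C₀ + j) * (diffOp 1 ε ^ j) A = 0 := by
  induction j with
  | zero => simpa using h0
  | succ j ih =>
    have h1 := congrArg (diffOp 1 ε) ih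
    have hs : ∀ i, (diffOp 1 ε ^ (i + 1)) A =
        derivative ((diffOp 1 ε ^ i) A) - C ε * (diffOp 1 ε ^ i) A := by
      intro i
      rw [pow_succ', Module.End.mul_apply, diffOp_apply, one_smul, smul_eq_C_mul]
    rw [map_zero, diffOp_apply, one_smul, smul_eq_C_mul] at h1
    simp only [derivative_add, derivative_mul, derivative_X, derivative_C, zero_mul, zero_add,
      one_mul] at h1
    rw [show j + 1 + 2 = j + 2 + 1 by ring, hs (j + 2), show j + 1 + 1 = j + 2 by ring]
    rw [show (diffOp 1 ε ^ (j + 2)) A = derivative ((diffOp 1 ε ^ (j + 1)) A) -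
      C ε * (diffOp 1 ε ^ (j + 1)) A from hs (j + 1)] at h1 ⊢
    have h2 := hs j
    simp only [Nat.cast_add, Nat.cast_one, C_add, C_1] at h1 ⊢
    linear_combination h1 + (C C₀ + C (j : ℝ)) * h2

/-- Since `D - 1` is `D` conjugated by `e ^ X`, the eigenstate column stands for `e ^ (-X)` times a
Laguerre polynomial. It solves the same type of equation as the virtual columns, with parameter `-(α
+ 1 + n)` in place of `d_j`. At the singular point `0` only the two-term recursion is left, and
every column starts with the value `1`. -/
theorem laguerreMat_zero_det (hα : -1 < α) :
    (laguerreMat d n α 0).det = meixnerConst d n α := by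
  have hode : ∀ k : Fin (M + 1), X * (diffOp 1 (offset M 1 k) ^ 2)
        (confluentPoly α (colDeg d n k) (colSigma M 1 k)) +
      (C (α + 1) + X) * diffOp 1 (offset M 1 k)
        (confluentPoly α (colDeg d n k) (colSigma M 1 k)) +
      C (-(Fin.snoc (α := fun _ => ℝ) (fun i : Fin M => (d i : ℝ)) (-(α + 1 + n)) :
        Fin (M + 1) → ℝ) k) * confluentPoly α (colDeg d n k) (colSigma M 1 k) = 0 := by
    intro k
    have h := confluentPoly_ode hα (colDeg d n k) (colSigma M 1 k)
    rw [pow_two, Module.End.mul_apply]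
    simp only [diffOp_apply, one_smul, smul_eq_C_mul, derivative_sub, derivative_C_mul]
    induction k using Fin.lastCases with
    | last =>
      simp only [offset, colDeg, colSigma, Fin.snoc_last, neg_neg, one_mul, C_1] at h ⊢
      simp only [C_add, C_1] at h ⊢
      linear_combination h
    | cast k =>
      simp only [offset, colDeg, colSigma, Fin.snoc_castSucc, C_0, neg_mul, one_mul, C_neg,
        C_1] at h ⊢
      linear_combination h
  have hrec := det_of_recursion
    (fun (k : Fin (M + 1)) j => ((diffOp 1 (offset M 1 k) ^ j)
      (confluentPoly α (colDeg d n k) (colSigma M 1 k))).eval 0)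
    (Fin.snoc (α := fun _ => ℝ) (fun i : Fin M => (d i : ℝ)) (-(α + 1 + n)))
    (fun j => (j : ℝ)) (fun j => α + 1 + j)
    (fun i _ => by
      have : (0 : ℝ) ≤ i := i.cast_nonneg
      intro h
      linarith)
    (fun k j _ => by
      have h := congrArg (Polynomial.eval 0) (diffOp_confluent_ode (hode k) j)
      simp only [eval_add, eval_mul, eval_X, eval_C, eval_zero, zero_mul, zero_add, add_zero] at h
      linear_combination h)
  have h1 : ∀ k : Fin (M + 1),
      (confluentPoly α (colDeg d n k) (colSigma M 1 k)).eval 0 = 1 := by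
    intro k
    rw [← coeff_zero_eq_eval_zero, confluentPoly_coeff]
    simp
  simp only [pow_zero, Module.End.one_apply, h1, Finset.prod_const_one, one_mul] at hrec
  exact hrec

/-! ### Type I Laguerre polynomials -/

theorem iteratedDeriv_exp_mul_eval (δ s : ℝ) (A : ℝ[X]) (j : ℕ) :
    iteratedDeriv j (fun y => Real.exp (δ * y) * (s * A.eval y)) =
      fun y => Real.exp (δ * y) * (s * ((diffOp 1 (-δ) ^ j) A).eval y) := by
  induction j with
  | zero => simp
  | succ j ih =>
    rw [iteratedDeriv_succ, ih]
    funext y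
    have h1 : HasDerivAt (fun y : ℝ => Real.exp (δ * y)) (Real.exp (δ * y) * δ) y := by
      simpa using ((hasDerivAt_id y).const_mul δ).exp
    rw [(h1.fun_mul ((((diffOp 1 (-δ) ^ j) A).hasDerivAt y).const_mul s)).deriv, pow_succ',
      Module.End.mul_apply, diffOp_apply]
    simp only [one_smul, neg_smul, sub_neg_eq_add, eval_add, eval_smul, smul_eq_mul]
    ring

theorem laguerreL_eq_confluent (hα : -1 < α) (v : ℕ) {σ : ℝ} (y : ℝ) :
    laguerreL α v (σ * y) = columnScale α v * (confluentPoly α v σ).eval y := by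
  rw [laguerreL_eq_sum (fun l _ => by
    have : (0 : ℝ) ≤ l := l.cast_nonneg
    intro h
    linarith), eval_eq_sum_range' (confluentPoly_natDegree_lt α v σ), Finset.mul_sum]
  refine Finset.sum_congr rfl fun i _ => ?_
  rw [confluentPoly_coeff, mul_pow]
  ring

/-- Behind the exponential factor, differentiation acts as `D + 1` on a virtual column and as `D` on
the eigenstate. Both equal the corresponding `diffOp` plus one, and the common shift by one is a
change of monic basis. -/
theorem isMultiIndexedLaguerreI_iff (hα : -1 < α) (Q : ℝ[X]) :
    IsMultiIndexedLaguerreI (α + 1 / 2) d n Q ↔ ∀ y, Q.eval y =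
      (∏ k, columnScale α (colDeg d n k)) * (laguerreMat d n α y).det := by
  refine forall_congr' fun y => ?_
  set δ : Fin (M + 1) → ℝ := fun k => 1 - offset M 1 k with hδ
  set l : Fin (M + 1) → ℝ[X] →ₗ[ℝ] ℝ := fun k =>
    opFun (Polynomial.leval y) (diffOp 1 (offset M 1 k))
      (confluentPoly α (colDeg d n k) (colSigma M 1 k)) with hl
  have hW : wronskianDet (Fin.snoc (α := fun _ => ℝ → ℝ)
          (fun (j : Fin M) (y : ℝ) => Real.exp y * laguerreL (α + 1 / 2 - 1 / 2) (d j) (-y))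
          (laguerreL (α + 1 / 2 - 1 / 2) n)) y =
      (∏ k, Real.exp (δ k * y) * columnScale α (colDeg d n k)) *
        Matrix.det (Matrix.of fun j k : Fin (M + 1) =>
          l k (∏ _i ∈ Finset.range (j : ℕ), (X - C (-1)))) := by
    rw [← Matrix.det_mul_row, wronskianDet]
    congr 1
    ext j k
    have hf : (Fin.snoc (α := fun _ => ℝ → ℝ)
          (fun (j : Fin M) (y : ℝ) => Real.exp y * laguerreL (α + 1 / 2 - 1 / 2) (d j) (-y))
          (laguerreL (α + 1 / 2 - 1 / 2) n) : Fin (M + 1) → ℝ → ℝ) k =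
        fun y => Real.exp (δ k * y) * (columnScale α (colDeg d n k) *
          (confluentPoly α (colDeg d n k) (colSigma M 1 k)).eval y) := by
      funext y
      rw [← laguerreL_eq_confluent hα, add_sub_cancel_right]
      induction k using Fin.lastCases <;> simp [hδ, offset, colDeg, colSigma]
    have hop : aeval (diffOp 1 (offset M 1 k)) (∏ _i ∈ Finset.range (j : ℕ), (X - C (-1 : ℝ))) =
        diffOp 1 (-δ k) ^ (j : ℕ) := by
      rw [Finset.prod_const, Finset.card_range, map_pow, map_sub, aeval_X, aeval_C]
      congr 1
      simp only [hδ, diffOp, map_neg, map_one]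
      module
    simp only [Matrix.of_apply, hf, iteratedDeriv_exp_mul_eval, hl, opFun_apply, hop,
      Polynomial.leval_apply]
    ring
  have h2 := det_functional_monic l (fun j => ∏ _i ∈ Finset.range j, (X - C (-1)))
    (fun j => X ^ j) (prodLinear_monic fun _ => -1) (prodLinear_natDegree fun _ => -1)
    (fun j => monic_X_pow j) (fun j => natDegree_X_pow j)
  have h3 : Matrix.det (Matrix.of fun j k : Fin (M + 1) => l k (X ^ (j : ℕ))) =
      (laguerreMat d n α y).det := by
    congr 1
    ext j k
    simp [hl, opFun_apply, laguerreMat]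
  have h4 : Real.exp (-(M * y)) * ∏ k : Fin (M + 1), Real.exp (δ k * y) = 1 := by
    rw [Fin.prod_univ_castSucc]
    simp only [hδ, offset, Fin.snoc_castSucc, Fin.snoc_last, sub_zero, one_mul, sub_self, zero_mul,
      Real.exp_zero, mul_one, Finset.prod_const, Finset.card_univ, Fintype.card_fin]
    rw [← Real.exp_nat_mul, ← Real.exp_add]
    simp
  rw [hW, h2, h3, Finset.prod_mul_distrib, ← mul_assoc, ← mul_assoc, h4, one_mul]

theorem existsUnique_multiIndexedLaguerreI (hα : -1 < α) :
    (∃! Q : ℝ[X], IsMultiIndexedLaguerreI (α + 1 / 2) d n Q) ∧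
      ∀ y, (multiIndexedLaguerreI (α + 1 / 2) d n).eval y =
        (∏ k, columnScale α (colDeg d n k)) * (laguerreMat d n α y).det := by
  have hex : ∃! Q : ℝ[X], IsMultiIndexedLaguerreI (α + 1 / 2) d n Q := by
    obtain ⟨R, hR⟩ := exists_poly_det (G := laguerreMat d n α) (fun j k => ⟨_, fun _ => rfl⟩)
      (∏ k, columnScale α (colDeg d n k))
    refine ⟨R, (isMultiIndexedLaguerreI_iff hα R).2 hR, fun Q hQ => Polynomial.funext fun y => ?_⟩
    rw [hR, (isMultiIndexedLaguerreI_iff hα Q).1 hQ]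
  exact ⟨hex, (isMultiIndexedLaguerreI_iff hα _).1 (Classical.epsilon_spec hex.exists)⟩

theorem meixner_to_laguerre (hd : Function.Injective d) (hα : -1 < α) :
    (∀ c : ℝ, 0 < c → c < 1 →
        ∃! Q : ℝ[X], meixnerSystem.IsMultiIndexed (α + 1, c) d n Q) ∧
      (∃! Q : ℝ[X], IsMultiIndexedLaguerreI (α + 1 / 2) d n Q) ∧
      (multiIndexedLaguerreI (α + 1 / 2) d n).eval 0 ≠ 0 ∧
      ∀ η : ℝ,
        Tendsto
          (fun c : ℝ => (meixnerSystem.multiIndexed (α + 1, c) d n).eval (η / (1 - c)))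
          (𝓝[<] 1)
          (𝓝 ((multiIndexedLaguerreI (α + 1 / 2) d n).eval η /
            (multiIndexedLaguerreI (α + 1 / 2) d n).eval 0)) := by
  obtain ⟨hex, hval⟩ := existsUnique_multiIndexedLaguerreI (d := d) (n := n) hα
  have hK := meixnerConst_ne_zero (n := n) hd hα
  have hsc : (∏ k, columnScale α (colDeg d n k)) ≠ 0 :=
    Finset.prod_ne_zero_iff.2 fun k _ => columnScale_ne_zero fun l _ => by
      have : (0 : ℝ) ≤ l := l.cast_nonneg
      intro h
      linarith
  refine ⟨fun c hc hc1 => (meixner_multiIndexed hd hα hc hc1).1, hex, ?_, fun t => ?_⟩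
  · rw [hval, laguerreMat_zero_det hα]
    exact mul_ne_zero hsc hK
  · rw [hval, hval, mul_div_mul_left _ _ hsc, laguerreMat_zero_det hα]
    refine ((tendsto_meixnerMat t).div_const _).congr' ?_
    filter_upwards [eventually_mem_unit] with c hc
    have : 1 - c ≠ 0 := sub_ne_zero.2 hc.2.ne'
    rw [(meixner_multiIndexed hd hα hc.1 hc.2).2, mul_div_cancel₀ _ this]

end

end

theorem mainTheorem9 {M : ℕ} (d : Fin M → ℕ) (hd : Function.Injective d)
    (hd1 : ∀ j, 1 ≤ d j) (n : ℕ) :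
    -- Meixner to Laguerre, type I
    (∀ α : ℝ, -1 < α →
      (∀ c : ℝ, 0 < c → c < 1 →
        ∃! Q : ℝ[X], meixnerSystem.IsMultiIndexed (α + 1, c) d n Q) ∧
      (∃! Q : ℝ[X], IsMultiIndexedLaguerreI (α + 1 / 2) d n Q) ∧
      (multiIndexedLaguerreI (α + 1 / 2) d n).eval 0 ≠ 0 ∧
      ∀ η : ℝ,
        Tendsto
          (fun c : ℝ => (meixnerSystem.multiIndexed (α + 1, c) d n).eval (η / (1 - c)))
          (𝓝[<] 1)
          (𝓝 ((multiIndexedLaguerreI (α + 1 / 2) d n).eval η /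
            (multiIndexedLaguerreI (α + 1 / 2) d n).eval 0))) ∧
    -- little q-Jacobi to Jacobi, type II
    (∀ α β : ℝ, -1 < α → -1 < β → (∀ j, (d j : ℝ) < α) →
      (∀ j k, j ≠ k → α - β ≠ d j + d k + 1) →
      (∀ q : ℝ, 0 < q → q < 1 →
        ∃! Q : ℝ[X], (littleQJacobiSystem q).IsMultiIndexed (α, β) d n Q) ∧
      (∃! Q : ℝ[X], IsMultiIndexedJacobiII (α + 1 / 2) (β + 1 / 2) d n Q) ∧
      (multiIndexedJacobiII (α + 1 / 2) (β + 1 / 2) d n).eval (-1) ≠ 0 ∧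
      ∀ η : ℝ,
        Tendsto
          (fun q : ℝ => ((littleQJacobiSystem q).multiIndexed (α, β) d n).eval (1 - η))
          (𝓝[<] 1)
          (𝓝 ((multiIndexedJacobiII (α + 1 / 2) (β + 1 / 2) d n).eval (1 - 2 * η) /
            (multiIndexedJacobiII (α + 1 / 2) (β + 1 / 2) d n).eval (-1)))) ∧
    -- little q-Laguerre to Laguerre, type II
    (∀ α : ℝ, -1 < α → (∀ j, (d j : ℝ) < α) →
      (∀ q : ℝ, 0 < q → q < 1 →
        ∃! Q : ℝ[X], (littleQLaguerreSystem q).IsMultiIndexed α d n Q) ∧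
      (∃! Q : ℝ[X], IsMultiIndexedLaguerreII (α + 1 / 2) d n Q) ∧
      (multiIndexedLaguerreII (α + 1 / 2) d n).eval 0 ≠ 0 ∧
      ∀ η : ℝ,
        Tendsto
          (fun q : ℝ =>
            ((littleQLaguerreSystem q).multiIndexed α d n).eval (1 - (1 - q) * η) /
              ((littleQLaguerreSystem q).multiIndexed α d n).eval 1)
          (𝓝[<] 1)
          (𝓝 ((multiIndexedLaguerreII (α + 1 / 2) d n).eval η /
            (multiIndexedLaguerreII (α + 1 / 2) d n).eval 0))) := by
  exact ⟨fun α hα => meixner_to_laguerre hd hα,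
    fun α β hα hβ hdα hαβ => littleQJacobi_to_jacobi hd hα hβ hdα hαβ,
    fun α hα hdα => littleQLaguerre_to_laguerre hd hd1 hα hdα⟩
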